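/- Let $M$ be a connected smooth manifold (without boundary) of dimension $2n$ with a smooth Riemannian metric $g=\langle\cdot,\cdot\rangle$ that is complete, let $J$ be a smooth almost complex structure on $M$ ($J^2=-\mathrm{id}$) that is compatible with $g$, i.e. $\langle JX,JY\rangle=\langle X,Y\rangle$, and let $\omega(X,Y)=\langle X,JY\rangle$ be the associated two-form; thus $(M,\omega,J,g)$ is an almost Hermitian manifold. ($\omega$ need not be closed; in particular the result holds when $\omega$ is a symplectic form and $J$, $g$ are compatible with it.) Let $\nabla$ be the Levi-Civita connection of $g$, let $\mathbf{Rm}(X,Y)Z=\nabla_X\nabla_YZ-\nabla_Y\nabla_XZ-\nabla_{[X,Y]}Z$ be its curvature tensor, and let $\mathcal N(X)=(\nabla_XJ)X$. Let $k_1,k_2>0$. 1. If $$\langle \mathbf{Rm}(JX,X)X,JX\rangle-|\mathcal N(X)|^2\ \ge\ k_1^2$$ for all unit tangent vectors $X$, then the diameter of $M$ with respect to the Riemannian distance is at most $\pi/k_1$. 2. If $$\mathrm{tr}_{\{X,JX\}^\perp}\bigl(Y\mapsto\langle \mathbf{Rm}(Y,X)X,Y\rangle\bigr)-|\mathcal N(X)|^2\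 \ge\ k_2^2$$ for all unit tangent vectors $X$, where $\mathrm{tr}_{\{X,JX\}^\perp}$ denotes the trace of the bilinear form restricted to the orthogonal complement of $\{X,JX\}$ in the tangent space, then the diameter of $M$ with respect to the Riemannian distance is at most $\sqrt{2n-2}\,\pi/k_2$. -/

import Mathlib

open Bundle FiberBundle VectorField Module
open scoped Manifold ContDiff ENNReal InnerProductSpace

noncomputable section

namespace AlmostHermitian

theorem finiteDimensional_tangentSpace {E : Type*} [NormedAddCommGroup E] [NormedSpace ℝ E]
    [FiniteDimensional ℝ E] {H : Type*} [TopologicalSpace H] {I : ModelWithCorners ℝ E H}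
    {M : Type*} [TopologicalSpace M] [ChartedSpace H M] (x : M) :
    FiniteDimensional ℝ (TangentSpace I x) :=
  inferInstanceAs (FiniteDimensional ℝ E)

variable
  {E : Type*} [NormedAddCommGroup E] [NormedSpace ℝ E]
  {H : Type*} [TopologicalSpace H] {I : ModelWithCorners ℝ E H}
  {M : Type*} [TopologicalSpace M] [ChartedSpace H M]
  [RiemannianBundle (fun x : M ↦ TangentSpace I x)]

/-! ### The Levi-Civita connection -/

/-- The right-hand side of the Koszul formula for `⟨∇_X Y, Z⟩`, at the point `x`. -/
def koszul (Y X Z : Π x : M, TangentSpace I x) (x : M) : ℝ :=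
  (1 / 2 : ℝ) *
    (d% (fun y ↦ inner ℝ (Y y) (Z y)) x (X x)
      + d% (fun y ↦ inner ℝ (X y) (Z y)) x (Y x)
      - d% (fun y ↦ inner ℝ (X y) (Y y)) x (Z x)
      + inner ℝ (mlieBracket I X Y x) (Z x)
      - inner ℝ (mlieBracket I X Z x) (Y x)
      - inner ℝ (mlieBracket I Y Z x) (X x))

variable [IsManifold I ∞ M]
  [IsContMDiffRiemannianBundle I ∞ E (fun x : M ↦ TangentSpace I x)]

theorem mdiffAt_inner {X Y : Π x : M, TangentSpace I x} {x : M}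
    (hX : MDiffAt (T% X) x) (hY : MDiffAt (T% Y) x) :
    MDiffAt (fun y ↦ inner ℝ (X y) (Y y)) x :=
  MDifferentiableAt.inner_bundle (E := fun x : M ↦ TangentSpace I x) hX hY

variable [FiniteDimensional ℝ E]

theorem koszul_tensorial_left {Y Z : Π x : M, TangentSpace I x} {x : M}
    (hY : MDiffAt (T% Y) x) (hZ : MDiffAt (T% Z) x) :
    TensorialAt I E (koszul Y · Z x) x where
  smul {f X} hf hX := by
    have : CompleteSpace E := FiniteDimensional.complete ℝ E
    simp only [koszul, Pi.smul_apply', mlieBracket_smul_left hf hX, real_inner_smul_left,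
      real_inner_smul_right, inner_add_left, mvfderiv_fun_mul hf (mdiffAt_inner hX hZ),
      mvfderiv_fun_mul hf (mdiffAt_inner hX hY)]
    simp [real_inner_comm]
    ring
  add {X X'} hX hX' := by
    have : CompleteSpace E := FiniteDimensional.complete ℝ E
    simp only [koszul, Pi.add_apply, mlieBracket_add_left hX hX', inner_add_left, inner_add_right,
      mvfderiv_fun_add (mdiffAt_inner hX hZ) (mdiffAt_inner hX' hZ),
      mvfderiv_fun_add (mdiffAt_inner hX hY) (mdiffAt_inner hX' hY)]
    simp
    ring

theorem koszul_tensorial_right {Y X : Π x : M, TangentSpace I x} {x : M}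
    (hY : MDiffAt (T% Y) x) (hX : MDiffAt (T% X) x) :
    TensorialAt I E (koszul Y X · x) x where
  smul {f Z} hf hZ := by
    have : CompleteSpace E := FiniteDimensional.complete ℝ E
    simp only [koszul, Pi.smul_apply', mlieBracket_smul_right hf hZ, real_inner_smul_right,
      real_inner_smul_left, inner_add_left, mvfderiv_fun_mul hf (mdiffAt_inner hX hZ),
      mvfderiv_fun_mul hf (mdiffAt_inner hY hZ)]
    simp [real_inner_comm]
    ring
  add {Z Z'} hZ hZ' := by
    have : CompleteSpace E := FiniteDimensional.complete ℝ E
    simp only [koszul, Pi.add_apply, mlieBracket_add_right hZ hZ', inner_add_left, inner_add_right,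
      mvfderiv_fun_add (mdiffAt_inner hX hZ) (mdiffAt_inner hX hZ'),
      mvfderiv_fun_add (mdiffAt_inner hY hZ) (mdiffAt_inner hY hZ')]
    simp
    ring

open Classical in
/-- `∇ Y` at `x`, as a linear map `X ↦ ∇_X Y`: the representative, with respect to the metric, of
the Koszul expression. It has the value `0` where `Y` is not differentiable. -/
def leviCivitaFun (Y : Π x : M, TangentSpace I x) (x : M) :
    TangentSpace I x →L[ℝ] TangentSpace I x :=
  haveI := finiteDimensional_tangentSpace (I := I) x
  haveI : CompleteSpace (TangentSpace I x) := FiniteDimensional.complete ℝ _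
  if hY : MDiffAt (T% Y) x then
    (InnerProductSpace.toDual ℝ (TangentSpace I x)).symm.toContinuousLinearEquiv.toContinuousLinearMap
      ∘L TensorialAt.mkHom₂ (koszul Y · · x) x
        (fun _ hZ ↦ koszul_tensorial_left hY hZ) (fun _ hX ↦ koszul_tensorial_right hY hX)
  else 0

theorem inner_leviCivitaFun {X Y Z : Π x : M, TangentSpace I x} {x : M}
    (hX : MDiffAt (T% X) x) (hY : MDiffAt (T% Y) x) (hZ : MDiffAt (T% Z) x) :
    inner ℝ (leviCivitaFun Y x (X x)) (Z x) = koszul Y X Z x := by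
  have := finiteDimensional_tangentSpace (I := I) x
  have : CompleteSpace (TangentSpace I x) := FiniteDimensional.complete ℝ _
  rw [← TensorialAt.mkHom₂_apply (Φ := (koszul Y · · x))
    (fun _ hZ ↦ koszul_tensorial_left hY hZ) (fun _ hX ↦ koszul_tensorial_right hY hX) hX hZ]
  simp only [leviCivitaFun, hY, dite_true]
  exact InnerProductSpace.toDual_symm_apply

theorem isCovariantDerivativeOn_leviCivitaFun :
    IsCovariantDerivativeOn E (leviCivitaFun (I := I) (M := M)) := by
  have : CompleteSpace E := FiniteDimensional.complete ℝ E
  constructor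
  · intro Y Y' x hY hY' _
    ext u
    refine ext_inner_right ℝ fun w ↦ ?_
    have hu := mdifferentiableAt_extend I E u
    have hw := mdifferentiableAt_extend I E w
    have h := fun {Y : Π x : M, TangentSpace I x} (hY : MDiffAt (T% Y) x) ↦
      inner_leviCivitaFun hu hY hw
    simp only [extend_apply_self] at h
    have hs : MDiffAt (T% (Y + Y')) x := mdifferentiableAt_add_section hY hY'
    rw [h hs, add_apply, inner_add_left, h hY, h hY']
    simp only [koszul, Pi.add_apply, mlieBracket_add_right hY hY', mlieBracket_add_left hY hY',
      inner_add_left, inner_add_right,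
      mvfderiv_fun_add (mdiffAt_inner hY hw) (mdiffAt_inner hY' hw),
      mvfderiv_fun_add (mdiffAt_inner hu hY) (mdiffAt_inner hu hY')]
    simp
    ring
  · intro Y f x hY hf _
    ext u
    refine ext_inner_right ℝ fun w ↦ ?_
    have hu := mdifferentiableAt_extend I E u
    have hw := mdifferentiableAt_extend I E w
    have h := fun {Y : Π x : M, TangentSpace I x} (hY : MDiffAt (T% Y) x) ↦
      inner_leviCivitaFun hu hY hw
    simp only [extend_apply_self] at h
    have hs : MDiffAt (T% (f • Y)) x := hf.smul_section hY
    rw [h hs]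
    simp only [add_apply, smul_apply, inner_add_left, real_inner_smul_left, h hY]
    simp only [koszul, Pi.smul_apply', mlieBracket_smul_right hf hY, mlieBracket_smul_left hf hY,
      real_inner_smul_left, real_inner_smul_right, inner_add_left,
      mvfderiv_fun_mul hf (mdiffAt_inner hY hw), mvfderiv_fun_mul hf (mdiffAt_inner hu hY)]
    simp [real_inner_comm, real_inner_smul_right]
    ring

variable (I M) in
/-- The Levi-Civita connection of the Riemannian metric on `M`. Its value on a vector field `Y`
is written `leviCivita I M Y x u`, for `∇_u Y` at `x`. -/
def leviCivita : CovariantDerivative I E (fun x : M ↦ TangentSpace I x) where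
  toFun := leviCivitaFun
  isCovariantDerivativeOnUniv := isCovariantDerivativeOn_leviCivitaFun

theorem leviCivita_metric {X Y Z : Π x : M, TangentSpace I x} {x : M}
    (hX : MDiffAt (T% X) x) (hY : MDiffAt (T% Y) x) (hZ : MDiffAt (T% Z) x) :
    d% (fun y ↦ inner ℝ (Y y) (Z y)) x (X x) =
      inner ℝ (leviCivita I M Y x (X x)) (Z x) + inner ℝ (Y x) (leviCivita I M Z x (X x)) := by
  have h1 := inner_leviCivitaFun hX hY hZ
  have h2 := inner_leviCivitaFun hX hZ hY
  rw [real_inner_comm] at h2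
  change _ = inner ℝ (leviCivitaFun Y x (X x)) (Z x) + inner ℝ (Y x) (leviCivitaFun Z x (X x))
  rw [h1, h2]
  have h3 : (fun y ↦ inner ℝ (Z y) (Y y)) = (fun y ↦ inner ℝ (Y y) (Z y)) :=
    funext fun _ ↦ real_inner_comm _ _
  simp only [koszul, mlieBracket_swap (V := Z) (W := Y), h3, Pi.neg_apply, inner_neg_left]
  ring

theorem leviCivita_torsion [CompleteSpace E] : (leviCivita I M).torsion = 0 := by
  rw [CovariantDerivative.torsion_eq_zero_iff]
  intro X Y x hX hY
  refine ext_inner_right ℝ fun w ↦ ?_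
  have hw := mdifferentiableAt_extend I E w
  have h1 := inner_leviCivitaFun hX hY hw
  have h2 := inner_leviCivitaFun hY hX hw
  simp only [extend_apply_self] at h1 h2
  change inner ℝ (leviCivitaFun Y x (X x) - leviCivitaFun X x (Y x)) w = _
  rw [inner_sub_left, h1, h2]
  have h3 : (fun y ↦ inner ℝ (Y y) (X y)) = (fun y ↦ inner ℝ (X y) (Y y)) :=
    funext fun _ ↦ real_inner_comm _ _
  simp only [koszul, mlieBracket_swap (V := Y) (W := X), h3, Pi.neg_apply, inner_neg_left,
    extend_apply_self]
  ring

/-! ### Curvature, covariant derivative of an endomorphism field, trace -/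

/-- The expression `∇_X ∇_Y Z - ∇_Y ∇_X Z - ∇_{[X, Y]} Z` for vector fields, at the point `x`. -/
def curvatureField (X Y Z : Π x : M, TangentSpace I x) (x : M) : TangentSpace I x :=
  leviCivita I M (fun y ↦ leviCivita I M Z y (Y y)) x (X x)
    - leviCivita I M (fun y ↦ leviCivita I M Z y (X y)) x (Y x)
    - leviCivita I M Z x (mlieBracket I X Y x)

/-- The Riemann curvature tensor `Rm(u, v)w`, with the sign for which `⟨Rm(v, u)u, v⟩` is the
sectional curvature of the plane of orthonormal vectors `u` and `v`. By tensoriality the vectors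
may be extended to any vector fields that are smooth near `x`; `extend` is one such extension. -/
def Rm {x : M} (u v w : TangentSpace I x) : TangentSpace I x :=
  curvatureField (extend E u) (extend E v) (extend E w) x

/-- The tensor `(∇_u J) v = ∇_u (J V) - J (∇_u V)`, where `V` is any vector field that is smooth
near `x` with the value `v` at `x`. -/
def covDerivEnd (J : Π x : M, TangentSpace I x →L[ℝ] TangentSpace I x) {x : M}
    (u v : TangentSpace I x) : TangentSpace I x :=
  leviCivita I M (fun y ↦ J y (extend E v y)) x u - J x (leviCivita I M (extend E v) x u)

/-- The trace of the bilinear form with quadratic form `Y ↦ ⟨Rm(Y, u)u, Y⟩` on a subspace `W` of a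
tangent space, computed in an orthonormal basis of `W`. -/
def curvatureTraceOn {x : M} (W : Submodule ℝ (TangentSpace I x)) (u : TangentSpace I x) : ℝ :=
  haveI := finiteDimensional_tangentSpace (I := I) x
  ∑ i, inner ℝ (Rm (stdOrthonormalBasis ℝ W i : TangentSpace I x) u u)
    (stdOrthonormalBasis ℝ W i : TangentSpace I x)

/-! ### Almost Hermitian structures -/

/-- `J` is a smooth almost complex structure compatible with the Riemannian metric of `M`, and `Ω`
is the associated two-form `Ω(X, Y) = ⟨X, J Y⟩`. The form `Ω` is not required to be closed, so that
the symplectic case, where `Ω` is a symplectic form, is included. -/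
structure IsAlmostHermitian (J : Π x : M, TangentSpace I x →L[ℝ] TangentSpace I x)
    (Ω : Π x : M, TangentSpace I x →L[ℝ] TangentSpace I x →L[ℝ] ℝ) : Prop where
  smooth : ContMDiff I (I.prod 𝓘(ℝ, E →L[ℝ] E)) ∞
    (fun x ↦ TotalSpace.mk' (E →L[ℝ] E) (E := fun x : M ↦ TangentSpace I x →L[ℝ] TangentSpace I x)
      x (J x))
  sq_eq_neg : ∀ (x : M) (X : TangentSpace I x), J x (J x X) = -X
  isometry : ∀ (x : M) (X Y : TangentSpace I x), inner ℝ (J x X) (J x Y) = inner ℝ X Y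
  compatible : ∀ (x : M) (X Y : TangentSpace I x), Ω x X Y = inner ℝ X (J x Y)

end AlmostHermitian

end

/-! This is the Bonnet–Synge–Myers argument, run with normal fields adapted to `J`. Completeness
joins two points at distance `ℓ > 0` by a minimizing unit speed curve `γ` with velocity `X`. For a
normal field `V` vanishing at both ends, minimality makes the index `∫ |DV|² - ⟨Rm(V, X)X, V⟩`
nonnegative. Insert `V = sin(πt/ℓ) eᵢ` for unit normal fields `e₁, …, eₘ` and add up. Since `⟨eᵢ,
Deᵢ⟩ = 0`, a pointwise bound `∑ ⟨Rm(eᵢ, X)X, eᵢ⟩ - ∑ |Deᵢ|² ≥ k²` forces `k² ≤ m (π/ℓ)²`; this is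
`sq_le_of_frame`.

The term `|N(X)|²` in the hypotheses pays for `∑ |Deᵢ|²`. In the first part the only field is `e =
JX`, and `De = (∇_X J)X = N(X)` because `X` is parallel along a geodesic. In the second part the
fields start as an orthonormal basis of `{X, JX}ᗮ` and solve `De = -⟨e, N(X)⟩ JX`, which is parallel
transport corrected so as to stay orthogonal to `JX`. They remain an orthonormal basis of the
complement, and Bessel's inequality gives `∑ |Deᵢ|² = ∑ ⟨eᵢ, N(X)⟩² ≤ |N(X)|²`; here `m = 2n - 2`.

Neither the exponential map nor a smooth global variation is used. Minimizing curves come from a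
metric Hopf–Rinow theorem (`HasApproxBetween.exists_minimizing`). In a chart such a curve is
Lipschitz and minimizes the energy, so the du Bois-Reymond lemma yields the geodesic equation
(`IsMetricOn.exists_velocity`).

The second variation is done chart by chart. On each interval of a partition, `u` is displaced to `u
+ sV - (s²/2) Γ(V, V)`, and the energy of the displaced curve bounds the distance of its end points
(`eventually_dist_varPoint_le`). At a partition point the displacements in the two adjacent charts
differ only by `o(s²)`, by the transformation law of the Christoffel symbols
(`isLittleO_dist_osculating`). The triangle inequality then gives `ℓ ≤ ℓ + (s²/2)(index + ε)`, hence
`sum_indexForm_nonneg`. -/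

noncomputable section
set_option maxSynthPendingDepth 3
set_option linter.unusedSectionVars false

/-! ### Minimizing curves in complete locally compact length spaces -/

namespace LengthSpace

open Set Filter Metric Topology

/-- The distance of `X` is approximated by chains: every point `y` at distance at least `r` from `x`
can be reached through a point at distance exactly `r` from `x` with arbitrarily small loss. -/
def HasApproxBetween (X : Type*) [MetricSpace X] : Prop :=
  ∀ (x y : X) (r ε : ℝ), 0 ≤ r → r ≤ dist x y → 0 < ε →
    ∃ z, dist x z = r ∧ dist z y ≤ dist x y - r + ε

variable {X : Type*} [MetricSpace X]

/-- Stop at distance exactly `R` on the way from `p` to `x`: the remaining distance is at most `δ`,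
up to a loss of `δ`. This drives both halves of the continuity argument for compactness of balls. -/
theorem HasApproxBetween.exists_near (h : HasApproxBetween X) {p x : X} {R δ : ℝ} (hR : 0 ≤ R)
    (hδ : 0 < δ) (hx : dist p x ≤ R + δ) :
    ∃ z ∈ closedBall p R, dist x z ≤ 2 * δ := by
  by_cases hp : dist p x ≤ R
  · exact ⟨x, by simpa [dist_comm] using hp, by simp [hδ.le]⟩
  · obtain ⟨z, hz, hz'⟩ := h p x R δ hR (not_le.1 hp).le hδ
    refine ⟨z, by simp [dist_comm, hz], ?_⟩
    rw [dist_comm]; linarith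

/-- A finite net of a slightly smaller compact ball is also a net, with worse constants, of the ball
of radius `R`; total boundedness and completeness do the rest. -/
theorem HasApproxBetween.isCompact_closedBall_of_lt [CompleteSpace X] (h : HasApproxBetween X)
    {p : X} {R : ℝ} (hR : 0 < R) (hc : ∀ r, 0 ≤ r → r < R → IsCompact (closedBall p r)) :
    IsCompact (closedBall p R) := by
  refine TotallyBounded.isCompact_of_isClosed ?_ isClosed_closedBall
  rw [Metric.totallyBounded_iff]
  intro ε hε
  set δ := min (ε / 4) (R / 2) with hδdef
  have hδ : 0 < δ := lt_min (by linarith) (by linarith)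
  have hδR : δ ≤ R / 2 := min_le_right _ _
  have hδε : δ ≤ ε / 4 := min_le_left _ _
  obtain ⟨t, -, ht, hcov⟩ :=
    (hc (R - δ) (by linarith) (by linarith)).finite_cover_balls (e := ε / 4) (by linarith)
  refine ⟨t, ht, fun x hx ↦ ?_⟩
  rw [mem_closedBall, dist_comm] at hx
  obtain ⟨z, hz, hxz⟩ := h.exists_near (R := R - δ) (by linarith) hδ (by linarith : dist p x ≤ _)
  have := hcov hz
  simp only [mem_iUnion, mem_ball, exists_prop] at this ⊢
  obtain ⟨y, hy, hzy⟩ := this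
  exact ⟨y, hy, (dist_triangle x z y).trans_lt (by linarith)⟩

/-- A compact neighbourhood of the ball contains a whole thickening of it, and the slightly larger
ball lies in this thickening. -/
theorem HasApproxBetween.exists_isCompact_closedBall_add [LocallyCompactSpace X]
    (h : HasApproxBetween X) {p : X} {R : ℝ} (hR : 0 ≤ R) (hc : IsCompact (closedBall p R)) :
    ∃ δ > 0, IsCompact (closedBall p (R + δ)) := by
  obtain ⟨K, hK, hsub⟩ := exists_compact_superset hc
  obtain ⟨δ, hδ, hthick⟩ := hc.exists_cthickening_subset_open isOpen_interior hsub
  refine ⟨δ / 2, by linarith, hK.of_isClosed_subset isClosed_closedBall fun x hx ↦ ?_⟩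
  rw [mem_closedBall, dist_comm] at hx
  obtain ⟨z, hz, hxz⟩ := h.exists_near hR (half_pos hδ) hx
  exact interior_subset (hthick (mem_cthickening_of_dist_le x z δ _ hz (by linarith)))

/-- The metric Hopf–Rinow theorem: closed balls are compact. -/
theorem HasApproxBetween.isCompact_closedBall [CompleteSpace X] [LocallyCompactSpace X]
    (h : HasApproxBetween X) (p : X) (r : ℝ) : IsCompact (closedBall p r) := by
  have key : ∀ r : ℝ, 0 ≤ r → IsCompact (closedBall p r) := by
    by_contra! hcon
    obtain ⟨r₀, hr₀, hnc⟩ := hcon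
    -- The compact radii form an interval starting at `0`. If it is bounded, its supremum belongs to
    -- it and can still be enlarged, which is absurd.
    set S := {r : ℝ | 0 ≤ r ∧ IsCompact (closedBall p r)} with hS
    have hdown : ∀ r ∈ S, ∀ r', 0 ≤ r' → r' ≤ r → r' ∈ S := fun r hr r' h0 hle ↦
      ⟨h0, hr.2.of_isClosed_subset isClosed_closedBall (closedBall_subset_closedBall hle)⟩
    have h0 : (0 : ℝ) ∈ S := ⟨le_rfl, by simp [closedBall_zero]⟩
    have hbdd : BddAbove S := ⟨r₀, fun r hr ↦ by
      by_contra! hlt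
      exact hnc (hdown r hr r₀ hr₀ hlt.le).2⟩
    have hlt : ∀ r, 0 ≤ r → r < sSup S → r ∈ S := fun r hr hlt ↦ by
      obtain ⟨r', hr', hrr'⟩ := exists_lt_of_lt_csSup ⟨0, h0⟩ hlt
      exact hdown r' hr' r hr hrr'.le
    have hsup0 : 0 ≤ sSup S := le_csSup hbdd h0
    have hsup : IsCompact (closedBall p (sSup S)) := by
      rcases hsup0.eq_or_lt with h' | h'
      · rw [← h']; exact h0.2
      · exact h.isCompact_closedBall_of_lt h' fun r hr hr' ↦ (hlt r hr hr').2
    obtain ⟨δ, hδ, hcδ⟩ := h.exists_isCompact_closedBall_add hsup0 hsup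
    have := le_csSup hbdd (show sSup S + δ ∈ S from ⟨by linarith, hcδ⟩)
    linarith
  rcases le_or_gt 0 r with hr | hr
  · exact key r hr
  · simp [closedBall_eq_empty.2 hr]

/-- Compactness of balls removes the loss `ε`: take a limit of approximate intermediate points. -/
theorem HasApproxBetween.exists_between [CompleteSpace X] [LocallyCompactSpace X]
    (h : HasApproxBetween X) (x y : X) {r : ℝ} (hr : 0 ≤ r) (hr' : r ≤ dist x y) :
    ∃ z, dist x z = r ∧ dist z y = dist x y - r := by
  have hpos : ∀ n : ℕ, (0 : ℝ) < 1 / (n + 1) := fun n ↦ by positivity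
  choose z hz hz' using fun n : ℕ ↦ h x y r (1 / (n + 1)) hr hr' (hpos n)
  obtain ⟨w, -, φ, hφ, hlim⟩ := (h.isCompact_closedBall x r).tendsto_subseq
    (fun n ↦ (by simp [dist_comm, hz n] : z n ∈ closedBall x r))
  have h1 : dist x w = r := by
    refine tendsto_nhds_unique (tendsto_const_nhds.dist hlim) ?_
    simp [hz]
  have h2 : dist w y ≤ dist x y - r := by
    have hl : Tendsto (fun n ↦ dist x y - r + 1 / ((φ n : ℝ) + 1)) atTop (𝓝 (dist x y - r + 0)) :=
      tendsto_const_nhds.add (tendsto_one_div_add_atTop_nhds_zero_nat.comp hφ.tendsto_atTop)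
    simpa using le_of_tendsto_of_tendsto' (hlim.dist tendsto_const_nhds) hl fun n ↦ hz' (φ n)
  exact ⟨w, h1, le_antisymm h2 (by linarith [dist_triangle x w y])⟩

/-- Iterate a single map that moves each point by the fixed step `dist p q / (N + 1)` straight
towards `q`. The distance to `q` then decreases linearly and reaches `0` after `N + 1` steps. -/
theorem HasApproxBetween.exists_chain [CompleteSpace X] [LocallyCompactSpace X]
    (h : HasApproxBetween X) (p q : X) (N : ℕ) :
    ∃ c : ℕ → X, c 0 = p ∧ c (N + 1) = q ∧
      ∀ i j, i ≤ N + 1 → j ≤ N + 1 →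
        dist (c i) (c j) ≤ |(i : ℝ) - j| * (dist p q / (N + 1)) := by
  set s := dist p q / (N + 1) with hs
  have hN : (0 : ℝ) < N + 1 := by positivity
  have hs0 : 0 ≤ s := by positivity
  have hsN : (N + 1) * s = dist p q := by rw [hs]; field_simp
  have hstep : ∀ x : X, ∃ z, s ≤ dist x q → dist x z = s ∧ dist z q = dist x q - s := fun x ↦ by
    by_cases hx : s ≤ dist x q
    · obtain ⟨z, hz⟩ := h.exists_between x q hs0 hx
      exact ⟨z, fun _ ↦ hz⟩
    · exact ⟨x, fun h' ↦ absurd h' hx⟩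
  choose f hf using hstep
  set c : ℕ → X := fun n ↦ f^[n] p with hc
  have hc0 : c 0 = p := rfl
  have hcs : ∀ n, c (n + 1) = f (c n) := fun n ↦ Function.iterate_succ_apply' f n p
  have hdist : ∀ n ≤ N + 1, dist (c n) q = (N + 1 - n) * s := by
    intro n
    induction n with
    | zero => intro _; simp [hc0, hsN]
    | succ n ih =>
      intro hn
      have hn' : (n : ℝ) ≤ N := by exact_mod_cast Nat.le_of_succ_le_succ hn
      have ih' := ih (by omega)
      have : s ≤ dist (c n) q := by rw [ih']; nlinarith
      rw [hcs, (hf _ this).2, ih']; push_cast; ring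
  have hsucc : ∀ n ≤ N, dist (c n) (c (n + 1)) = s := fun n hn ↦ by
    have hn' : (n : ℝ) ≤ N := by exact_mod_cast hn
    have : s ≤ dist (c n) q := by rw [hdist n (by omega)]; nlinarith
    rw [hcs, (hf _ this).1]
  have hle : ∀ i k, i + k ≤ N + 1 → dist (c i) (c (i + k)) ≤ k * s := by
    intro i k
    induction k with
    | zero => simp
    | succ k ih =>
      intro hk
      have := dist_triangle (c i) (c (i + k)) (c (i + k + 1))
      rw [hsucc (i + k) (by omega)] at this
      have ih' := ih (by omega)
      rw [← add_assoc]; push_cast; linarith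
  have hle' : ∀ i j, i ≤ j → j ≤ N + 1 → dist (c i) (c j) ≤ |(i : ℝ) - j| * s := by
    intro i j hij hj
    obtain ⟨k, rfl⟩ := Nat.exists_eq_add_of_le hij
    have : |(i : ℝ) - ((i + k : ℕ) : ℝ)| = k := by
      push_cast; rw [sub_add_cancel_left, abs_neg, Nat.abs_cast]
    rw [this]; exact hle i k hj
  refine ⟨c, hc0, ?_, fun i j hi hj ↦ ?_⟩
  · have := hdist (N + 1) le_rfl
    push_cast at this
    rw [sub_self, zero_mul, dist_eq_zero] at this
    exact this
  · rcases le_total i j with hij | hij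
    · exact hle' i j hij hj
    · rw [dist_comm, abs_sub_comm]; exact hle' j i hij hi

/-- Any two points are joined by a curve parametrized isometrically by an interval. -/
theorem HasApproxBetween.exists_minimizing [CompleteSpace X] [LocallyCompactSpace X]
    (h : HasApproxBetween X) (p q : X) :
    ∃ γ : ℝ → X, γ 0 = p ∧ γ (dist p q) = q ∧
      ∀ s ∈ Icc 0 (dist p q), ∀ t ∈ Icc 0 (dist p q), dist (γ s) (γ t) = |s - t| := by
  rcases eq_or_ne p q with rfl | hpq
  · refine ⟨fun _ ↦ p, rfl, rfl, fun s hs t ht ↦ ?_⟩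
    simp only [dist_self, Icc_self, mem_singleton_iff] at hs ht
    simp [hs, ht]
  set ℓ := dist p q with hℓ
  have hℓ0 : 0 < ℓ := dist_pos.2 hpq
  choose c hc0 hc1 hc using h.exists_chain p q
  -- Time `t` is rounded down to a vertex of the `N`-th chain; rounding costs at most one step, of
  -- length `ℓ / (N + 1)`.
  set idx : ℕ → ℝ → ℕ := fun N t ↦ ⌊t / ℓ * (N + 1)⌋₊ with hidx
  have hidx_le : ∀ N, ∀ t ∈ Icc 0 ℓ, idx N t ≤ N + 1 := fun N t ht ↦ by
    refine Nat.floor_le_of_le ?_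
    push_cast
    have : t / ℓ ≤ 1 := (div_le_one hℓ0).2 ht.2
    nlinarith [(by positivity : (0 : ℝ) < N + 1)]
  have hbound : ∀ N, ∀ s ∈ Icc 0 ℓ, ∀ t ∈ Icc 0 ℓ,
      dist (c N (idx N s)) (c N (idx N t)) ≤ |s - t| + ℓ * (1 / ((N : ℝ) + 1)) := by
    intro N s hs t ht
    refine (hc N _ _ (hidx_le N s hs) (hidx_le N t ht)).trans ?_
    have hN : (0 : ℝ) < N + 1 := by positivity
    have h1 : |((idx N s : ℝ)) - idx N t| ≤ |s / ℓ * (N + 1) - t / ℓ * (N + 1)| + 1 := by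
      have a1 := Nat.floor_le (a := s / ℓ * (N + 1)) (by have := hs.1; positivity)
      have a2 := Nat.lt_floor_add_one (s / ℓ * (N + 1))
      have b1 := Nat.floor_le (a := t / ℓ * (N + 1)) (by have := ht.1; positivity)
      have b2 := Nat.lt_floor_add_one (t / ℓ * (N + 1))
      have c1 := le_abs_self (s / ℓ * (N + 1) - t / ℓ * (N + 1))
      have c2 := neg_abs_le (s / ℓ * (N + 1) - t / ℓ * (N + 1))
      rw [abs_le]
      constructor <;> simp only [hidx] <;> linarith
    have h2 : |s / ℓ * (N + 1) - t / ℓ * (N + 1)| = |s - t| * ((N + 1) / ℓ) := by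
      rw [show s / ℓ * ((N : ℝ) + 1) - t / ℓ * (N + 1) = (s - t) * ((N + 1) / ℓ) by ring, abs_mul,
        abs_of_pos (a := ((N : ℝ) + 1) / ℓ) (by positivity)]
    calc _ ≤ (|s - t| * ((N + 1) / ℓ) + 1) * (ℓ / (N + 1)) := by
          rw [← h2]; gcongr
      _ = _ := by field_simp
  -- Along an ultrafilter the chains converge at all times at once, so no diagonal subsequence and
  -- no Arzelà–Ascoli theorem is required.
  set u : Filter ℕ := ↑(Ultrafilter.of (atTop : Filter ℕ)) with hu
  have hu_le : u ≤ atTop := Ultrafilter.of_le _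
  have hex : ∀ t : ℝ, ∃ y, t ∈ Icc 0 ℓ → Tendsto (fun N ↦ c N (idx N t)) u (𝓝 y) := by
    intro t
    by_cases ht : t ∈ Icc 0 ℓ
    · have hmem : ∀ N, c N (idx N t) ∈ closedBall p (ℓ + ℓ) := fun N ↦ by
        have h0 := hbound N 0 ⟨le_rfl, hℓ0.le⟩ t ht
        have hz : idx N 0 = 0 := by simp [hidx]
        have hN : ℓ * (1 / ((N : ℝ) + 1)) ≤ ℓ * 1 := by
          gcongr; rw [div_le_one (by positivity)]; linarith [N.cast_nonneg (α := ℝ)]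
        rw [hz, hc0, zero_sub, abs_neg, abs_of_nonneg ht.1] at h0
        rw [mem_closedBall, dist_comm]; linarith [ht.2]
      obtain ⟨y, -, hy⟩ := (h.isCompact_closedBall p (ℓ + ℓ)).ultrafilter_le_nhds
        ((Ultrafilter.of (atTop : Filter ℕ)).map fun N ↦ c N (idx N t))
        (by
          rw [le_principal_iff, Ultrafilter.mem_coe, Ultrafilter.mem_map]
          exact Filter.univ_mem' hmem)
      exact ⟨y, fun _ ↦ hy⟩
    · exact ⟨p, fun h' ↦ absurd h' ht⟩
  choose γ hγ using hex
  have hone : Tendsto (fun N : ℕ ↦ (1 : ℝ) / ((N : ℝ) + 1)) u (𝓝 0) :=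
    tendsto_one_div_add_atTop_nhds_zero_nat.mono_left hu_le
  have hle : ∀ s ∈ Icc 0 ℓ, ∀ t ∈ Icc 0 ℓ, dist (γ s) (γ t) ≤ |s - t| := by
    intro s hs t ht
    have hl : Tendsto (fun N : ℕ ↦ |s - t| + ℓ * ((1 : ℝ) / ((N : ℝ) + 1))) u
        (𝓝 (|s - t| + ℓ * 0)) := tendsto_const_nhds.add (tendsto_const_nhds.mul hone)
    simpa using le_of_tendsto_of_tendsto' ((hγ s hs).dist (hγ t ht)) hl
      fun N ↦ hbound N s hs t ht
  have hγ0 : γ 0 = p := by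
    refine tendsto_nhds_unique (hγ 0 ⟨le_rfl, hℓ0.le⟩) ?_
    simp [hidx, hc0]
  have hγ1 : γ ℓ = q := by
    refine tendsto_nhds_unique (hγ ℓ ⟨hℓ0.le, le_rfl⟩) ?_
    have : ∀ N, idx N ℓ = N + 1 := fun N ↦ by
      simp only [hidx, div_self hℓ0.ne', one_mul]
      exact_mod_cast Nat.floor_natCast (R := ℝ) (N + 1)
    simp [this, hc1]
  -- The limit curve is 1-Lipschitz and its ends are at distance `ℓ`, so no shortcut between `s` and
  -- `t` is possible.
  have hge : ∀ s ∈ Icc 0 ℓ, ∀ t ∈ Icc 0 ℓ, s ≤ t → t - s ≤ dist (γ s) (γ t) := by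
    intro s hs t ht hst
    have h0 : (0 : ℝ) ∈ Icc 0 ℓ := ⟨le_rfl, hℓ0.le⟩
    have h1 : ℓ ∈ Icc 0 ℓ := ⟨hℓ0.le, le_rfl⟩
    have a := hle 0 h0 s hs
    have b := hle t ht ℓ h1
    rw [hγ0, zero_sub, abs_neg, abs_of_nonneg hs.1] at a
    rw [hγ1, abs_sub_comm, abs_of_nonneg (by linarith [ht.2])] at b
    have := dist_triangle4 p (γ s) (γ t) q
    linarith
  refine ⟨γ, hγ0, hγ1, fun s hs t ht ↦ le_antisymm (hle s hs t ht) ?_⟩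
  rcases le_total s t with hst | hst
  · rw [abs_sub_comm, abs_of_nonneg (by linarith)]; exact hge s hs t ht hst
  · rw [abs_of_nonneg (by linarith), dist_comm]; exact hge t ht s hs hst

end LengthSpace

/-! ### Riemannian metrics on open subsets of a vector space -/

namespace LocalMetric

open Set Filter Topology

variable {E : Type*} [NormedAddCommGroup E] [NormedSpace ℝ E]

/-- `g` is a smooth Riemannian metric on the open set `U`. -/
structure IsMetricOn (g : E → E →L[ℝ] E →L[ℝ] ℝ) (U : Set E) : Prop where
  isOpen : IsOpen U
  contDiffOn : ContDiffOn ℝ ∞ g U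
  symm : ∀ z ∈ U, ∀ a b, g z a b = g z b a
  pos : ∀ z ∈ U, ∀ a, a ≠ 0 → 0 < g z a a

/-- The Christoffel symbols of the first kind. -/
def christoffelFirst (g : E → E →L[ℝ] E →L[ℝ] ℝ) (z : E) : E →L[ℝ] E →L[ℝ] E →L[ℝ] ℝ :=
  (1 / 2 : ℝ) • (fderiv ℝ g z + (fderiv ℝ g z).flip
    - (ContinuousLinearMap.flipₗᵢ ℝ E E ℝ : (E →L[ℝ] E →L[ℝ] ℝ) →L[ℝ] (E →L[ℝ] E →L[ℝ] ℝ)) ∘L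
      (fderiv ℝ g z).flip)

/-- The Christoffel symbols of the metric `g`. -/
def christoffel (g : E → E →L[ℝ] E →L[ℝ] ℝ) (z : E) : E →L[ℝ] E →L[ℝ] E :=
  ContinuousLinearMap.compL ℝ E (E →L[ℝ] ℝ) E (g z).inverse ∘L christoffelFirst g z

/-- The curvature tensor of the metric `g`. -/
def curvature (g : E → E →L[ℝ] E →L[ℝ] ℝ) (z a b c : E) : E :=
  fderiv ℝ (christoffel g) z a b c - fderiv ℝ (christoffel g) z b a c
    + christoffel g z a (christoffel g z b c) - christoffel g z b (christoffel g z a c)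

theorem christoffelFirst_apply (g : E → E →L[ℝ] E →L[ℝ] ℝ) (z a b c : E) :
    christoffelFirst g z a b c =
      (1 / 2) * (fderiv ℝ g z a b c + fderiv ℝ g z b a c - fderiv ℝ g z c a b) := by
  simp [christoffelFirst]

namespace IsMetricOn

variable {g : E → E →L[ℝ] E →L[ℝ] ℝ} {U : Set E} {z : E}

theorem mono (hg : IsMetricOn g U) {V : Set E} (hV : IsOpen V) (hVU : V ⊆ U) : IsMetricOn g V :=
  ⟨hV, hg.contDiffOn.mono hVU, fun z hz ↦ hg.symm z (hVU hz), fun z hz ↦ hg.pos z (hVU hz)⟩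

theorem nonneg (hg : IsMetricOn g U) (hz : z ∈ U) (a : E) : 0 ≤ g z a a := by
  rcases eq_or_ne a 0 with rfl | ha
  · simp
  · exact (hg.pos z hz a ha).le

theorem contDiffAt (hg : IsMetricOn g U) (hz : z ∈ U) : ContDiffAt ℝ ∞ g z :=
  hg.contDiffOn.contDiffAt (hg.isOpen.mem_nhds hz)

theorem contDiffAt_fderiv (hg : IsMetricOn g U) (hz : z ∈ U) : ContDiffAt ℝ ∞ (fderiv ℝ g) z :=
  (hg.contDiffAt hz).fderiv_right (by simp)

theorem hasFDerivAt (hg : IsMetricOn g U) (hz : z ∈ U) : HasFDerivAt g (fderiv ℝ g z) z :=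
  ((hg.contDiffAt hz).differentiableAt (by simp)).hasFDerivAt

theorem hasFDerivAt_fderiv (hg : IsMetricOn g U) (hz : z ∈ U) :
    HasFDerivAt (fderiv ℝ g) (fderiv ℝ (fderiv ℝ g) z) z :=
  ((hg.contDiffAt_fderiv hz).differentiableAt (by simp)).hasFDerivAt

theorem hasFDerivAt_apply (hg : IsMetricOn g U) (hz : z ∈ U) (a b : E) :
    HasFDerivAt (fun y ↦ g y a b) (((fderiv ℝ g z).flip a).flip b) z := by
  have := ((hg.hasFDerivAt hz).clm_apply (hasFDerivAt_const a z)).clm_apply (hasFDerivAt_const b z)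
  exact this.congr_fderiv (by ext c; simp)

theorem hasFDerivAt_fderiv_apply (hg : IsMetricOn g U) (hz : z ∈ U) (c a b : E) :
    HasFDerivAt (fun y ↦ fderiv ℝ g y c a b)
      ((((fderiv ℝ (fderiv ℝ g) z).flip c).flip a).flip b) z := by
  have := (((hg.hasFDerivAt_fderiv hz).clm_apply (hasFDerivAt_const c z)).clm_apply
    (hasFDerivAt_const a z)).clm_apply (hasFDerivAt_const b z)
  exact this.congr_fderiv (by ext c; simp)

theorem fderiv_symm (hg : IsMetricOn g U) (hz : z ∈ U) (c a b : E) :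
    fderiv ℝ g z c a b = fderiv ℝ g z c b a := by
  have h : (fun y ↦ g y a b) =ᶠ[𝓝 z] fun y ↦ g y b a :=
    mem_of_superset (hg.isOpen.mem_nhds hz) fun y hy ↦ hg.symm y hy a b
  have := ((hg.hasFDerivAt_apply hz a b).congr_of_eventuallyEq h.symm).unique
    (hg.hasFDerivAt_apply hz b a)
  simpa using DFunLike.congr_fun this c

theorem fderiv_fderiv_symm (hg : IsMetricOn g U) (hz : z ∈ U) (d c a b : E) :
    fderiv ℝ (fderiv ℝ g) z d c a b = fderiv ℝ (fderiv ℝ g) z d c b a := by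
  have h : (fun y ↦ fderiv ℝ g y c a b) =ᶠ[𝓝 z] fun y ↦ fderiv ℝ g y c b a :=
    mem_of_superset (hg.isOpen.mem_nhds hz) fun y hy ↦ hg.fderiv_symm hy c a b
  have := ((hg.hasFDerivAt_fderiv_apply hz c a b).congr_of_eventuallyEq h.symm).unique
    (hg.hasFDerivAt_fderiv_apply hz c b a)
  simpa using DFunLike.congr_fun this d

theorem fderiv_fderiv_comm (hg : IsMetricOn g U) (hz : z ∈ U) (d c : E) :
    fderiv ℝ (fderiv ℝ g) z d c = fderiv ℝ (fderiv ℝ g) z c d :=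
  (hg.contDiffAt hz).isSymmSndFDerivAt (by simp [minSmoothness_of_isRCLikeNormedField]; exact WithTop.coe_le_coe.2 le_top) d c

variable [FiniteDimensional ℝ E]

/-- Positivity gives injectivity, and `E` and its dual have the same finite dimension. -/
theorem isInvertible (hg : IsMetricOn g U) (hz : z ∈ U) : (g z).IsInvertible := by
  have hinj : Function.Injective (g z) := by
    rw [injective_iff_map_eq_zero]
    intro a ha
    by_contra hne
    have := hg.pos z hz a hne
    simp [ha] at this
  have hfr : finrank ℝ E = finrank ℝ (E →L[ℝ] ℝ) := by
    rw [← (LinearMap.toContinuousLinearMap (𝕜 := ℝ) (E := E) (F' := ℝ)).finrank_eq]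
    exact (Subspace.dual_finrank_eq).symm
  exact ⟨(LinearEquiv.ofInjectiveOfFinrankEq (g z : E →ₗ[ℝ] (E →L[ℝ] ℝ)) hinj
    hfr).toContinuousLinearEquiv, by ext; rfl⟩

theorem apply_inverse (hg : IsMetricOn g U) (hz : z ∈ U) (ξ : E →L[ℝ] ℝ) :
    g z ((g z).inverse ξ) = ξ :=
  (hg.isInvertible hz).self_apply_inverse ξ

theorem inverse_apply (hg : IsMetricOn g U) (hz : z ∈ U) (a : E) :
    (g z).inverse (g z a) = a :=
  (hg.isInvertible hz).inverse_apply_self a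

theorem ext_left (hg : IsMetricOn g U) (hz : z ∈ U) {a b : E} (h : ∀ c, g z a c = g z b c) :
    a = b := by
  rw [← hg.inverse_apply hz a, ← hg.inverse_apply hz b, ContinuousLinearMap.ext h]

theorem apply_christoffel (hg : IsMetricOn g U) (hz : z ∈ U) (a b c : E) :
    g z (christoffel g z a b) c =
      (1 / 2) * (fderiv ℝ g z a b c + fderiv ℝ g z b a c - fderiv ℝ g z c a b) := by
  rw [← christoffelFirst_apply]
  simp [christoffel, hg.apply_inverse hz]

theorem christoffel_symm (hg : IsMetricOn g U) (hz : z ∈ U) (a b : E) :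
    christoffel g z a b = christoffel g z b a := by
  refine hg.ext_left hz fun c ↦ ?_
  rw [hg.apply_christoffel hz, hg.apply_christoffel hz, hg.fderiv_symm hz c a b]
  ring

theorem contDiffAt_inverse (hg : IsMetricOn g U) (hz : z ∈ U) :
    ContDiffAt ℝ ∞ (fun y ↦ (g y).inverse) z := by
  have : CompleteSpace E := FiniteDimensional.complete ℝ E
  obtain ⟨e, he⟩ := hg.isInvertible hz
  have h := contDiffAt_map_inverse (n := ∞) e
  rw [he] at h
  exact h.comp z (hg.contDiffAt hz)

theorem contDiffAt_christoffel (hg : IsMetricOn g U) (hz : z ∈ U) :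
    ContDiffAt ℝ ∞ (christoffel g) z := by
  have h1 : ContDiffAt ℝ ∞ (christoffelFirst g) z := by
    have hD := hg.contDiffAt_fderiv hz
    have hf : ContDiffAt ℝ ∞ (fun y ↦ (fderiv ℝ g y).flip) z :=
      (ContinuousLinearMap.flipₗᵢ ℝ E E (E →L[ℝ] ℝ)).contDiff.contDiffAt.comp z hD
    exact contDiffAt_const (c := (1 / 2 : ℝ)) |>.smul ((hD.add hf).sub (contDiffAt_const.clm_comp hf))
  exact ((ContinuousLinearMap.compL ℝ E (E →L[ℝ] ℝ) E).contDiff.contDiffAt.comp z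
    (hg.contDiffAt_inverse hz)).clm_comp h1

theorem hasFDerivAt_christoffel (hg : IsMetricOn g U) (hz : z ∈ U) :
    HasFDerivAt (christoffel g) (fderiv ℝ (christoffel g) z) z :=
  ((hg.contDiffAt_christoffel hz).differentiableAt (by simp)).hasFDerivAt

/-- Differentiate the identity `apply_christoffel` by the product rule. Lowering the index first
avoids any derivative of the inverse of `g`. -/
theorem apply_fderiv_christoffel (hg : IsMetricOn g U) (hz : z ∈ U) (a b c d : E) :
    g z (fderiv ℝ (christoffel g) z a b c) d =
      (1 / 2) * (fderiv ℝ (fderiv ℝ g) z a b c d + fderiv ℝ (fderiv ℝ g) z a c b d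
        - fderiv ℝ (fderiv ℝ g) z a d b c) - fderiv ℝ g z a (christoffel g z b c) d := by
  have h1 : HasFDerivAt (fun y ↦ g y (christoffel g y b c) d) _ z :=
    ((hg.hasFDerivAt hz).clm_apply (((hg.hasFDerivAt_christoffel hz).clm_apply
      (hasFDerivAt_const b z)).clm_apply (hasFDerivAt_const c z))).clm_apply (hasFDerivAt_const d z)
  have h2 : HasFDerivAt (fun y ↦ (1 / 2 : ℝ) * (fderiv ℝ g y b c d + fderiv ℝ g y c b d
      - fderiv ℝ g y d b c)) _ z :=
    (((hg.hasFDerivAt_fderiv_apply hz b c d).add (hg.hasFDerivAt_fderiv_apply hz c b d)).sub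
      (hg.hasFDerivAt_fderiv_apply hz d b c)).const_mul (1 / 2 : ℝ)
  have h : (fun y ↦ g y (christoffel g y b c) d) =ᶠ[𝓝 z] fun y ↦ (1 / 2 : ℝ) *
      (fderiv ℝ g y b c d + fderiv ℝ g y c b d - fderiv ℝ g y d b c) :=
    mem_of_superset (hg.isOpen.mem_nhds hz) fun y hy ↦ hg.apply_christoffel hy b c d
  have := DFunLike.congr_fun ((h1.congr_of_eventuallyEq h.symm).unique h2) a
  simp at this
  linarith

/-- The second derivative at `s = 0` of `½ g(∂ₜα, ∂ₜα)` for the variation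
`α = u + s V - ½ s² Γ(V, V)`, where `p = u'` and `V' = q`. -/
theorem second_variation_identity (hg : IsMetricOn g U) (hz : z ∈ U) (p V q : E) :
    (1 / 2) * fderiv ℝ (fderiv ℝ g) z V V p p
      - (1 / 2) * fderiv ℝ g z (christoffel g z V V) p p + 2 * fderiv ℝ g z V p q + g z q q
      - g z p (fderiv ℝ (christoffel g) z p V V + christoffel g z q V + christoffel g z V q)
    = g z (q + christoffel g z p V) (q + christoffel g z p V)
      - g z (curvature g z V p p) V := by
  have hs := hg.symm z hz
  have hD := hg.fderiv_symm hz
  have hDD := hg.fderiv_fderiv_symm hz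
  have hK := hg.apply_christoffel hz
  have hdK := hg.apply_fderiv_christoffel hz
  have hKA := hK p p (christoffel g z V V)
  have hKB := hK V V (christoffel g z p p)
  have hKC := hK p V (christoffel g z p V)
  simp only [curvature, map_add, map_sub, add_apply, sub_apply]
  rw [hs p (fderiv ℝ (christoffel g) z p V V), hs p (christoffel g z q V),
    hs p (christoffel g z V q), hs q (christoffel g z p V), hdK, hdK, hdK, hK q V p, hK V q p,
    hK p V q, hK V (christoffel g z p p) V, hK p (christoffel g z V p) V,
    hg.christoffel_symm hz V p, hg.fderiv_fderiv_comm hz V p]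
  -- What remains is an identity between values of `g` and of its first two derivatives. With these
  -- treated as opaque functions it is a linear combination of their symmetries and of three
  -- instances of the defining relation of the Christoffel symbols.
  generalize christoffel g z p p = A at *
  generalize christoffel g z V V = B at *
  generalize christoffel g z p V = C at *
  obtain ⟨G, hG⟩ : ∃ G : E → E → ℝ, ∀ a b, g z a b = G a b := ⟨_, fun _ _ ↦ rfl⟩
  obtain ⟨D, hD'⟩ : ∃ D : E → E → E → ℝ, ∀ a b c, fderiv ℝ g z a b c = D a b c :=
    ⟨_, fun _ _ _ ↦ rfl⟩
  obtain ⟨D₂, hD₂⟩ : ∃ D₂ : E → E → E → E → ℝ, ∀ a b c d,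
    fderiv ℝ (fderiv ℝ g) z a b c d = D₂ a b c d := ⟨_, fun _ _ _ _ ↦ rfl⟩
  simp only [hG, hD', hD₂] at hs hD hDD hKA hKB hKC ⊢
  linear_combination -hKA + hKB + hs A B - hKC - hD p p B + hD V V A - hD q V p
    - hD V q p + (1 / 2) * hD p q V + (1 / 2) * hD V A V + (1 / 2) * hD p C V
    - hDD p V V p - (1 / 2) * hDD p V p V

end IsMetricOn

end LocalMetric

/-! ### Regularity of minimizing curves -/

namespace LocalMetric

open Set Filter Topology MeasureTheory intervalIntegral
open scoped NNReal

section duBoisReymond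

variable {F : Type*} [NormedAddCommGroup F]

theorem intervalIntegrable_of_bound {f : ℝ → F} (hf : StronglyMeasurable f) {C : ℝ}
    (hC : ∀ t, ‖f t‖ ≤ C) (a b : ℝ) : IntervalIntegrable f volume a b := by
  rw [intervalIntegrable_iff, uIoc]
  exact Integrable.of_bound hf.aestronglyMeasurable C (Eventually.of_forall hC)

theorem lipschitzWith_integral [NormedSpace ℝ F] {f : ℝ → F} (hf : StronglyMeasurable f) {C : ℝ≥0}
    (hC : ∀ t, ‖f t‖ ≤ C) (a : ℝ) : LipschitzWith C fun t ↦ ∫ s in a..t, f s := by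
  refine LipschitzWith.of_dist_le_mul fun t s ↦ ?_
  rw [dist_eq_norm, integral_interval_sub_left (intervalIntegrable_of_bound hf hC _ _)
    (intervalIntegrable_of_bound hf hC _ _), Real.dist_eq]
  exact norm_integral_le_of_norm_le_const fun x _ ↦ hC x

/-- The du Bois-Reymond lemma. -/
theorem ae_eq_const_add_integral {a b : ℝ} (hab : a ≤ b) {P Q : ℝ → ℝ} (hP : Measurable P)
    (hQ : Measurable Q) {C : ℝ≥0} (hPC : ∀ t, |P t| ≤ C) (hQC : ∀ t, |Q t| ≤ C)
    (h : ∀ (η : ℝ → ℝ) (K : ℝ≥0), LipschitzWith K η → η a = 0 → η b = 0 →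
      ∫ t in a..b, (Q t * η t + P t * deriv η t) = 0) :
    ∃ c, ∀ᵐ t, t ∈ Icc a b → P t = c + ∫ s in a..t, Q s := by
  rcases hab.eq_or_lt with rfl | hlt
  · refine ⟨0, ?_⟩
    have : ∀ᵐ t : ℝ, t ≠ a := by simp [ae_iff]
    filter_upwards [this] with t ht ht'
    exact absurd (by simpa using ht') ht
  set q : ℝ → ℝ := fun t ↦ ∫ s in a..t, Q s with hq
  have hqL : LipschitzWith C q := lipschitzWith_integral hQ.stronglyMeasurable hQC a
  have hqc : Continuous q := hqL.continuous
  -- truncate `q` outside `[a, b]` to keep it bounded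
  set q' : ℝ → ℝ := fun t ↦ q (projIcc a b hab t) with hq'
  have hq'c : Continuous q' := hqc.comp (continuous_subtype_val.comp continuous_projIcc)
  have hq'eq : ∀ t ∈ Icc a b, q' t = q t := fun t ht ↦ by simp [hq', projIcc_of_mem hab ht]
  have hq'b : ∀ t, |q' t| ≤ C * (b - a) := fun t ↦ by
    have hm := (projIcc a b hab t).2
    have := hqL.dist_le_mul (projIcc a b hab t) a
    simp only [hq, integral_same, Real.dist_eq, sub_zero] at this
    refine this.trans ?_
    rw [abs_of_nonneg (by linarith [hm.1])]
    gcongr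
    linarith [hm.2]
  set m : ℝ → ℝ := fun t ↦ P t - q' t with hm
  have hmm : Measurable m := hP.sub hq'c.measurable
  -- The mean of `m`, so that the primitive `η` of `m - c` vanishes at both ends and is an
  -- admissible test function.
  set c : ℝ := (∫ t in a..b, m t) / (b - a) with hc
  have hba : 0 < b - a := sub_pos.2 hlt
  obtain ⟨C', hC'⟩ : ∃ C' : ℝ≥0, ∀ t, |m t - c| ≤ C' := by
    refine ⟨(C + C * (b - a) + |c|).toNNReal, fun t ↦ ?_⟩
    rw [Real.coe_toNNReal _ (by have := C.2; positivity)]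
    refine (abs_sub _ _).trans (add_le_add ((abs_sub _ _).trans (add_le_add (hPC t) (hq'b t))) le_rfl)
  have hmc : Measurable fun t ↦ m t - c := hmm.sub_const c
  set η : ℝ → ℝ := fun t ↦ ∫ s in a..t, (m s - c) with hη
  have hηL : LipschitzWith C' η := lipschitzWith_integral hmc.stronglyMeasurable hC' a
  have hmi : IntervalIntegrable (fun t ↦ m t - c) volume a b :=
    intervalIntegrable_of_bound hmc.stronglyMeasurable hC' a b
  have hmi' : IntervalIntegrable m volume a b := by
    simpa using hmi.add (intervalIntegrable_const (c := c))
  have hηa : η a = 0 := by simp [hη]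
  have hηb : η b = 0 := by
    simp only [hη]
    rw [integral_sub hmi' intervalIntegrable_const, intervalIntegral.integral_const, smul_eq_mul, hc]
    field_simp
    ring
  have hQi : IntervalIntegrable Q volume a b :=
    intervalIntegrable_of_bound hQ.stronglyMeasurable hQC a b
  have hPi : IntervalIntegrable P volume a b :=
    intervalIntegrable_of_bound hP.stronglyMeasurable hPC a b
  have hdη : ∀ᵐ t, t ∈ uIcc a b → deriv η t = m t - c := by
    filter_upwards [hmi.ae_hasDerivAt_integral] with t ht ht'
    exact (ht ht' a (by simp)).deriv
  have hdq : ∀ᵐ t, t ∈ uIcc a b → deriv q t = Q t := by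
    filter_upwards [hQi.ae_hasDerivAt_integral] with t ht ht'
    exact (ht ht' a (by simp)).deriv
  have hηac := (hηL.lipschitzOnWith (s := uIcc a b)).absolutelyContinuousOnInterval
  have hqac := (hqL.lipschitzOnWith (s := uIcc a b)).absolutelyContinuousOnInterval
  have hparts := hqac.integral_mul_deriv_eq_deriv_mul hηac
  rw [hηa, hηb, mul_zero, mul_zero, sub_zero, zero_sub] at hparts
  have h1 := h η C' hηL hηa hηb
  have hdηi : IntervalIntegrable (deriv η) volume a b := hηac.intervalIntegrable_deriv
  have hQη : IntervalIntegrable (fun t ↦ Q t * η t) volume a b :=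
    hQi.mul_continuousOn hηL.continuous.continuousOn
  have hPη : IntervalIntegrable (fun t ↦ P t * deriv η t) volume a b := by
    refine intervalIntegrable_of_bound (C := C * C')
      (hP.mul (measurable_deriv η)).stronglyMeasurable (fun t ↦ ?_) a b
    rw [Pi.mul_apply, norm_mul]
    exact mul_le_mul (hPC t) (norm_deriv_le_of_lipschitz hηL) (norm_nonneg _) C.2
  have hqη : IntervalIntegrable (fun t ↦ q t * deriv η t) volume a b :=
    hdηi.continuousOn_mul hqc.continuousOn
  rw [integral_add hQη hPη] at h1
  have h2 : ∫ t in a..b, Q t * η t = ∫ t in a..b, deriv q t * η t := by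
    refine integral_congr_ae ?_
    filter_upwards [hdq] with t ht ht'
    rw [ht (uIoc_subset_uIcc ht')]
  -- Integrating `Q η` by parts turns the hypothesis into `∫ (P - q) η' = 0`. Since `η' = m - c`
  -- almost everywhere and `m - c` has mean zero, this is the integral of a square.
  have h3 : ∫ t in a..b, (m t - c) * (m t - c) = 0 := by
    have e1 : ∫ t in a..b, (P t * deriv η t - q t * deriv η t) = 0 := by
      rw [integral_sub hPη hqη]; linarith
    have e2 : ∫ t in a..b, c * (m t - c) = 0 := by
      rw [intervalIntegral.integral_const_mul]
      change c * η b = 0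
      rw [hηb, mul_zero]
    have e3 : ∫ t in a..b, (m t - c) * (m t - c) =
        ∫ t in a..b, ((P t * deriv η t - q t * deriv η t) - c * (m t - c)) := by
      refine integral_congr_ae ?_
      filter_upwards [hdη] with t ht ht'
      have ht'' := uIoc_subset_uIcc ht'
      rw [ht ht'', ← hq'eq t (by rwa [uIcc_of_le hab] at ht'')]
      simp only [hm]; ring
    rw [e3, integral_sub (hPη.sub hqη) (hmi.const_mul c), e1, e2, sub_zero]
  have hsq : IntervalIntegrable (fun t ↦ (m t - c) * (m t - c)) volume a b := by
    refine intervalIntegrable_of_bound (C := C' * C') (hmc.mul hmc).stronglyMeasurable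
      (fun t ↦ ?_) a b
    rw [Pi.mul_apply, norm_mul]
    exact mul_le_mul (hC' t) (hC' t) (norm_nonneg _) C'.2
  rw [integral_of_le hab, setIntegral_eq_zero_iff_of_nonneg_ae
    (Eventually.of_forall fun t ↦ mul_self_nonneg _) (by
      rw [intervalIntegrable_iff, uIoc_of_le hab] at hsq; exact hsq)] at h3
  refine ⟨c, ?_⟩
  rw [Filter.EventuallyEq, ae_restrict_iff' measurableSet_Ioc] at h3
  have hne : ∀ᵐ t : ℝ, t ≠ a := by simp [ae_iff]
  filter_upwards [h3, hne] with t ht hta htI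
  have := ht ⟨lt_of_le_of_ne htI.1 (Ne.symm hta), htI.2⟩
  have h0 : m t - c = 0 := by simpa using this
  simp only [hm, hq'eq t htI] at h0
  simp only [hq] at h0
  linarith

end duBoisReymond

end LocalMetric

/-! ### Euler–Lagrange equation and the geodesic equation for energy minimizers -/

namespace LocalMetric

open Set Filter Topology MeasureTheory intervalIntegral
open scoped NNReal

variable {E : Type*} [NormedAddCommGroup E] [NormedSpace ℝ E]
  {g : E → E →L[ℝ] E →L[ℝ] ℝ} {U : Set E}

theorem aestronglyMeasurable_apply₂ {α : Type*} [MeasurableSpace α] {μ : Measure α}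
    {B : α → E →L[ℝ] E →L[ℝ] ℝ} {v w : α → E} (hB : AEStronglyMeasurable B μ)
    (hv : AEStronglyMeasurable v μ) (hw : AEStronglyMeasurable w μ) :
    AEStronglyMeasurable (fun t ↦ B t (v t) (w t)) μ :=
  (ContinuousLinearMap.id ℝ (E →L[ℝ] ℝ)).aestronglyMeasurable_comp₂
    ((ContinuousLinearMap.id ℝ (E →L[ℝ] E →L[ℝ] ℝ)).aestronglyMeasurable_comp₂ hB hv) hw

theorem stronglyMeasurable_apply₂ {B : ℝ → E →L[ℝ] E →L[ℝ] ℝ} {v w : ℝ → E}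
    (hB : StronglyMeasurable B) (hv : StronglyMeasurable v) (hw : StronglyMeasurable w) :
    StronglyMeasurable (fun t ↦ B t (v t) (w t)) :=
  isBoundedBilinearMap_apply.continuous.comp_stronglyMeasurable
    ((isBoundedBilinearMap_apply.continuous.comp_stronglyMeasurable (hB.prodMk hv)).prodMk hw)

theorem norm_apply₂_le {B : E →L[ℝ] E →L[ℝ] ℝ} {v w : E} {c₀ c₁ c₂ : ℝ} (hB : ‖B‖ ≤ c₀)
    (hv : ‖v‖ ≤ c₁) (hw : ‖w‖ ≤ c₂) : ‖B v w‖ ≤ c₀ * c₁ * c₂ := by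
  have h0 : 0 ≤ c₀ := (norm_nonneg _).trans hB
  have h1 : 0 ≤ c₁ := (norm_nonneg _).trans hv
  calc ‖B v w‖ ≤ ‖B‖ * ‖v‖ * ‖w‖ := B.le_opNorm₂ v w
    _ ≤ _ := by gcongr

variable [FiniteDimensional ℝ E]

/-- The weak form of the Euler-Lagrange equation for a Lipschitz curve minimizing the energy. -/
theorem IsMetricOn.weak_eulerLagrange (hg : IsMetricOn g U) {u : ℝ → E} {K : ℝ≥0}
    (hu : LipschitzWith K u) {a b : ℝ} (hab : a ≤ b) {C : Set E} (hC : IsCompact C) (hCU : C ⊆ U)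
    (huC : ∀ t, u t ∈ C)
    (hmin : ∀ (w : ℝ → E) (K' : ℝ≥0), LipschitzWith K' w → w a = u a → w b = u b →
      (∀ t ∈ Icc a b, w t ∈ U) →
      ∫ t in a..b, g (u t) (deriv u t) (deriv u t) ≤ ∫ t in a..b, g (w t) (deriv w t) (deriv w t))
    (e : E) {η : ℝ → ℝ} {K' : ℝ≥0} (hη : LipschitzWith K' η) (hηa : η a = 0) (hηb : η b = 0) :
    ∫ t in a..b, (fderiv ℝ g (u t) e (deriv u t) (deriv u t) * η t
      + 2 * g (u t) (deriv u t) e * deriv η t) = 0 := by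
  obtain ⟨r, hr, hrU⟩ := hC.exists_cthickening_subset_open hg.isOpen hCU
  set C' := Metric.cthickening r C with hC'
  have hC'c : IsCompact C' := hC.cthickening
  obtain ⟨c₀, hc₀⟩ := hC'c.exists_bound_of_continuousOn (f := g)
    (hg.contDiffOn.continuousOn.mono hrU)
  obtain ⟨c₁, hc₁⟩ := hC'c.exists_bound_of_continuousOn (f := fderiv ℝ g)
    (fun z hz ↦ (hg.contDiffAt_fderiv (hrU hz)).continuousAt.continuousWithinAt)
  obtain ⟨M, hM⟩ := (isCompact_Icc (a := a) (b := b)).exists_bound_of_continuousOn (f := η)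
    hη.continuous.continuousOn
  have hM0 : 0 ≤ M := (norm_nonneg _).trans (hM a ⟨le_rfl, hab⟩)
  set x : ℝ → ℝ → E := fun s t ↦ u t + s • η t • e with hx
  set y : ℝ → ℝ → E := fun s t ↦ deriv u t + s • deriv η t • e with hy
  -- For `|s| < δ` the displacement `s η e` is shorter than the radius `r` of the thickening, so the
  -- varied curve stays in a fixed compact subset of `U`, where `g` and its derivative are bounded.
  set δ := r / (M * ‖e‖ + 1) with hδ
  have hδ0 : 0 < δ := by positivity
  have hxC : ∀ s, |s| < δ → ∀ t ∈ Icc a b, x s t ∈ C' := by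
    intro s hs t ht
    refine Metric.mem_cthickening_of_dist_le _ (u t) r C (huC t) ?_
    rw [dist_eq_norm, hx, add_sub_cancel_left, norm_smul, norm_smul, Real.norm_eq_abs]
    have h1 : ‖η t‖ * ‖e‖ ≤ M * ‖e‖ + 1 := by nlinarith [hM t ht, norm_nonneg e]
    calc |s| * (‖η t‖ * ‖e‖) ≤ δ * (M * ‖e‖ + 1) := by gcongr
      _ = r := by rw [hδ]; field_simp
  have hyb : ∀ s, |s| < δ → ∀ t, ‖y s t‖ ≤ K + δ * (K' * ‖e‖) := by
    intro s hs t
    refine (norm_add_le _ _).trans (add_le_add (norm_deriv_le_of_lipschitz hu) ?_)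
    rw [norm_smul, norm_smul, Real.norm_eq_abs]
    gcongr
    exact norm_deriv_le_of_lipschitz hη
  have hηe : ∀ t, ‖deriv η t • e‖ ≤ K' * ‖e‖ := fun t ↦ by
    rw [norm_smul]; gcongr; exact norm_deriv_le_of_lipschitz hη
  set μ : Measure ℝ := volume.restrict (Ioc a b) with hμ
  have hmem : ∀ᵐ t ∂μ, t ∈ Icc a b := by
    filter_upwards [ae_restrict_mem measurableSet_Ioc] with t ht using Ioc_subset_Icc_self ht
  set F : ℝ → ℝ → ℝ := fun s t ↦ g (x s t) (y s t) (y s t) with hF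
  set F' : ℝ → ℝ → ℝ := fun s t ↦ fderiv ℝ g (x s t) (η t • e) (y s t) (y s t)
    + g (x s t) (deriv η t • e) (y s t) + g (x s t) (y s t) (deriv η t • e) with hF'
  have hxcont : ∀ s, Continuous (x s) := fun s ↦
    hu.continuous.add ((hη.continuous.smul continuous_const).const_smul s)
  have hym : ∀ s, AEStronglyMeasurable (y s) μ := fun s ↦
    ((stronglyMeasurable_deriv u).add
      (((stronglyMeasurable_deriv η).smul_const e).const_smul s)).aestronglyMeasurable
  have hgm : ∀ s, |s| < δ → AEStronglyMeasurable (fun t ↦ g (x s t)) μ := fun s hs ↦ by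
    refine (ContinuousOn.aestronglyMeasurable (s := Icc a b) ?_ measurableSet_Icc).mono_set
      Ioc_subset_Icc_self
    exact hg.contDiffOn.continuousOn.comp (hxcont s).continuousOn fun t ht ↦ hrU (hxC s hs t ht)
  have hball : Metric.ball (0 : ℝ) δ ∈ 𝓝 (0 : ℝ) := Metric.ball_mem_nhds _ hδ0
  have habs : ∀ s ∈ Metric.ball (0 : ℝ) δ, |s| < δ := fun s hs ↦ by simpa using hs
  have h0δ : |(0 : ℝ)| < δ := by simpa using hδ0
  have hFm : ∀ s, |s| < δ → AEStronglyMeasurable (F s) μ := fun s hs ↦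
    aestronglyMeasurable_apply₂ (hgm s hs) (hym s) (hym s)
  have hF'm : AEStronglyMeasurable (F' 0) μ := by
    have hD : AEStronglyMeasurable (fun t ↦ fderiv ℝ g (x 0 t) (η t • e)) μ := by
      refine (ContinuousOn.aestronglyMeasurable (s := Icc a b) ?_ measurableSet_Icc).mono_set
        Ioc_subset_Icc_self
      refine ContinuousOn.clm_apply ?_ (hη.continuous.smul continuous_const).continuousOn
      intro t ht
      exact ContinuousAt.continuousWithinAt (ContinuousAt.comp (f := x 0)
        (hg.contDiffAt_fderiv (hrU (hxC 0 h0δ t ht))).continuousAt (hxcont 0).continuousAt)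
    have hηm : AEStronglyMeasurable (fun t ↦ deriv η t • e) μ :=
      ((stronglyMeasurable_deriv η).smul_const e).aestronglyMeasurable
    exact ((aestronglyMeasurable_apply₂ hD (hym 0) (hym 0)).add
      (aestronglyMeasurable_apply₂ (hgm 0 h0δ) hηm (hym 0))).add
      (aestronglyMeasurable_apply₂ (hgm 0 h0δ) (hym 0) hηm)
  set Y := K + δ * (K' * ‖e‖)
  -- Differentiation in `s` under the integral; all factors are bounded uniformly on the thickening,
  -- so a constant dominates.
  have key := hasDerivAt_integral_of_dominated_loc_of_deriv_le (μ := μ) (F := F) (F' := F')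
    (x₀ := 0) (bound := fun _ ↦ (c₁ * (M * ‖e‖)) * Y * Y + c₀ * (K' * ‖e‖) * Y
      + c₀ * Y * (K' * ‖e‖)) hball
    (by filter_upwards [hball] with s hs using hFm s (habs s hs))
    (Integrable.of_bound (hFm 0 h0δ) (c₀ * Y * Y) (by
      filter_upwards [hmem] with t ht
      exact norm_apply₂_le (hc₀ _ (hxC 0 h0δ t ht)) (hyb 0 h0δ t) (hyb 0 h0δ t)))
    hF'm
    (by
      filter_upwards [hmem] with t ht s hs
      have hs' := habs s hs
      have hB : ‖fderiv ℝ g (x s t) (η t • e)‖ ≤ c₁ * (M * ‖e‖) := by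
        refine (ContinuousLinearMap.le_opNorm _ _).trans ?_
        have h1 := hc₁ _ (hxC s hs' t ht)
        have h2 : ‖η t • e‖ ≤ M * ‖e‖ := by rw [norm_smul]; gcongr; exact hM t ht
        have h3 : 0 ≤ c₁ := (norm_nonneg _).trans h1
        gcongr
      refine (norm_add_le _ _).trans (add_le_add ((norm_add_le _ _).trans (add_le_add ?_ ?_)) ?_)
      · exact norm_apply₂_le hB (hyb s hs' t) (hyb s hs' t)
      · exact norm_apply₂_le (hc₀ _ (hxC s hs' t ht)) (hηe t) (hyb s hs' t)
      · exact norm_apply₂_le (hc₀ _ (hxC s hs' t ht)) (hyb s hs' t) (hηe t))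
    (integrable_const _)
    (by
      filter_upwards [hmem] with t ht s hs
      have hs' := habs s hs
      have hxd : HasDerivAt (fun s ↦ x s t) (η t • e) s := by
        exact (((hasDerivAt_id s).smul_const (η t • e)).const_add (u t)).congr_deriv (one_smul _ _)
      have hyd : HasDerivAt (fun s ↦ y s t) (deriv η t • e) s := by
        exact (((hasDerivAt_id s).smul_const (deriv η t • e)).const_add (deriv u t)).congr_deriv
          (one_smul _ _)
      have hgd := (hg.hasFDerivAt (hrU (hxC s hs' t ht))).comp_hasDerivAt s hxd
      refine ((hgd.clm_apply hyd).clm_apply hyd).congr_deriv ?_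
      simp [hF'])
  have hIs : ∀ s, |s| < δ → ∫ t, F s t ∂μ =
      ∫ t in a..b, g (x s t) (deriv (x s) t) (deriv (x s) t) := by
    intro s hs
    rw [integral_of_le hab]
    refine MeasureTheory.integral_congr_ae ?_
    filter_upwards [ae_restrict_of_ae hu.ae_differentiableAt,
      ae_restrict_of_ae hη.ae_differentiableAt] with t h1 h2
    have : deriv (x s) t = y s t :=
      (h1.hasDerivAt.add ((h2.hasDerivAt.smul_const e).const_smul s)).deriv
    simp only [hF, this]
  have hlocmin : IsLocalMin (fun s ↦ ∫ t, F s t ∂μ) 0 := by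
    filter_upwards [hball] with s hs
    have hs' := habs s hs
    rw [hIs s hs', hIs 0 h0δ]
    have hx0 : x 0 = u := by funext t; simp [hx]
    rw [hx0]
    have hL : LipschitzWith (K + (‖s‖₊ * (K' * ‖e‖₊))) (x s) := by
      refine hu.add ?_
      have h1 : LipschitzWith (K' * ‖e‖₊) fun t ↦ η t • e := by
        refine LipschitzWith.of_dist_le_mul fun t t' ↦ ?_
        rw [dist_eq_norm, ← sub_smul, norm_smul, ← dist_eq_norm]
        have := hη.dist_le_mul t t'
        push_cast
        nlinarith [norm_nonneg e]
      refine LipschitzWith.of_dist_le_mul fun t t' ↦ ?_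
      rw [dist_eq_norm, ← smul_sub, norm_smul, ← dist_eq_norm]
      have := h1.dist_le_mul t t'
      push_cast at this ⊢
      rw [mul_assoc]
      gcongr
    exact hmin _ _ hL (by simp [hx, hηa]) (by simp [hx, hηb]) fun t ht ↦ hrU (hxC s hs' t ht)
  have h0 := hlocmin.hasDerivAt_eq_zero key.2
  rw [integral_of_le hab, ← h0]
  refine MeasureTheory.integral_congr_ae ?_
  filter_upwards with t
  have hx0 : x 0 t = u t := by simp [hx]
  have hy0 : y 0 t = deriv u t := by simp [hy]
  simp only [hF', hx0, hy0, map_smul, smul_apply, smul_eq_mul,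
    hg.symm (u t) (hCU (huC t)) e (deriv u t)]
  ring

theorem IsMetricOn.intervalIntegrable_energy (hg : IsMetricOn g U) {w : ℝ → E} {K : ℝ≥0}
    {a b : ℝ} (hab : a ≤ b) (hw : LipschitzWith K w) (hwU : ∀ t ∈ Icc a b, w t ∈ U) :
    IntervalIntegrable (fun t ↦ g (w t) (deriv w t) (deriv w t)) volume a b := by
  have hgc : ContinuousOn (fun t ↦ g (w t)) (Icc a b) :=
    hg.contDiffOn.continuousOn.comp hw.continuous.continuousOn hwU
  obtain ⟨c₀, hc₀⟩ := isCompact_Icc.exists_bound_of_continuousOn hgc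
  rw [intervalIntegrable_iff, uIoc_of_le hab]
  have hd := (stronglyMeasurable_deriv w).aestronglyMeasurable (μ := volume.restrict (Ioc a b))
  refine Integrable.of_bound (C := c₀ * K * K) (aestronglyMeasurable_apply₂
    ((hgc.aestronglyMeasurable measurableSet_Icc).mono_set Ioc_subset_Icc_self) hd hd) ?_
  filter_upwards [ae_restrict_mem measurableSet_Ioc] with t ht
  exact norm_apply₂_le (hc₀ t (Ioc_subset_Icc_self ht)) (norm_deriv_le_of_lipschitz hw)
    (norm_deriv_le_of_lipschitz hw)

/-- A Lipschitz curve of speed at most one which minimizes the energy is a `C²` geodesic. -/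
theorem IsMetricOn.exists_velocity (hg : IsMetricOn g U) {u : ℝ → E} {K : ℝ≥0}
    (hu : LipschitzWith K u) {a b : ℝ} (hab : a < b) {C : Set E} (hC : IsCompact C) (hCU : C ⊆ U)
    (huC : ∀ t, u t ∈ C)
    (hspeed : ∀ᵐ t, t ∈ Icc a b → g (u t) (deriv u t) (deriv u t) ≤ 1)
    (hmin : ∀ (w : ℝ → E) (K' : ℝ≥0), LipschitzWith K' w → w a = u a → w b = u b →
      (∀ t ∈ Icc a b, w t ∈ U) →
      b - a ≤ ∫ t in a..b, (1 + g (w t) (deriv w t) (deriv w t)) / 2) :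
    ∃ v : ℝ → E, ∀ t ∈ Icc a b, HasDerivWithinAt u (v t) (Icc a b) t ∧
      HasDerivWithinAt v (-christoffel g (u t) (v t) (v t)) (Icc a b) t ∧
      g (u t) (v t) (v t) = 1 := by
  have hE : CompleteSpace E := FiniteDimensional.complete ℝ E
  have huU : ∀ t, u t ∈ U := fun t ↦ hCU (huC t)
  have hhalf : ∀ (w : ℝ → E) (K' : ℝ≥0), LipschitzWith K' w → (∀ t ∈ Icc a b, w t ∈ U) →
      ∫ t in a..b, (1 + g (w t) (deriv w t) (deriv w t)) / 2 =
        (b - a) / 2 + (∫ t in a..b, g (w t) (deriv w t) (deriv w t)) / 2 := by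
    intro w K' hw hwU
    rw [intervalIntegral.integral_div, integral_add intervalIntegrable_const
      (hg.intervalIntegrable_energy hab.le hw hwU), intervalIntegral.integral_const, smul_eq_mul]
    ring
  have hEu : ∫ t in a..b, g (u t) (deriv u t) (deriv u t) ≤ b - a := by
    have : ∫ t in a..b, g (u t) (deriv u t) (deriv u t) ≤ ∫ t in a..b, (1 : ℝ) := by
      refine integral_mono_ae_restrict hab.le
        (hg.intervalIntegrable_energy hab.le hu fun t _ ↦ huU t) intervalIntegrable_const ?_
      rw [Filter.EventuallyLE, ae_restrict_iff' measurableSet_Icc]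
      exact hspeed
    simpa using this
  -- Competitors have `∫ (1 + |w'|²)/2 ≥ b - a`, that is, energy at least `b - a`, while `u` has
  -- energy at most `b - a` because its speed is at most one. So `u` minimizes the energy.
  have hEL := hg.weak_eulerLagrange hu hab.le hC hCU huC (fun w K' hw hwa hwb hwU ↦ by
    have h1 := hmin w K' hw hwa hwb hwU
    rw [hhalf w K' hw hwU] at h1
    linarith)
  obtain ⟨c₀, hc₀⟩ := hC.exists_bound_of_continuousOn (f := g) (hg.contDiffOn.continuousOn.mono hCU)
  obtain ⟨c₁, hc₁⟩ := hC.exists_bound_of_continuousOn (f := fderiv ℝ g)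
    (fun z hz ↦ (hg.contDiffAt_fderiv (hCU hz)).continuousAt.continuousWithinAt)
  have hgu : Continuous fun t ↦ g (u t) := continuous_iff_continuousAt.2 fun t ↦
    ContinuousAt.comp (f := u) (hg.contDiffAt (huU t)).continuousAt hu.continuous.continuousAt
  have hDu : Continuous fun t ↦ fderiv ℝ g (u t) := continuous_iff_continuousAt.2 fun t ↦
    ContinuousAt.comp (f := u) (hg.contDiffAt_fderiv (huU t)).continuousAt
      hu.continuous.continuousAt
  have hdu := stronglyMeasurable_deriv u
  have hdub : ∀ t, ‖deriv u t‖ ≤ K := fun t ↦ norm_deriv_le_of_lipschitz hu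
  have hc1 : 0 ≤ c₁ := (norm_nonneg _).trans (hc₁ _ (huC a))
  have hc0 : 0 ≤ c₀ := (norm_nonneg _).trans (hc₀ _ (huC a))
  -- the momentum
  have hmom : ∀ e : E, ∃ c : ℝ, ∀ᵐ t, t ∈ Icc a b → 2 * g (u t) (deriv u t) e =
      c + ∫ s in a..t, fderiv ℝ g (u s) e (deriv u s) (deriv u s) := by
    intro e
    have hPm : StronglyMeasurable fun t ↦ 2 * g (u t) (deriv u t) e :=
      (stronglyMeasurable_apply₂ hgu.stronglyMeasurable hdu stronglyMeasurable_const).const_mul 2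
    have hQm : StronglyMeasurable fun t ↦ fderiv ℝ g (u t) e (deriv u t) (deriv u t) :=
      stronglyMeasurable_apply₂ (hDu.clm_apply continuous_const).stronglyMeasurable hdu hdu
    have hP0 : ∀ t, |2 * g (u t) (deriv u t) e| ≤ 2 * (c₀ * K * ‖e‖) := fun t ↦ by
      rw [abs_mul, abs_two]
      exact mul_le_mul_of_nonneg_left (norm_apply₂_le (hc₀ _ (huC t)) (hdub t) le_rfl) (by simp)
    have hQ0 : ∀ t, |fderiv ℝ g (u t) e (deriv u t) (deriv u t)| ≤ (c₁ * ‖e‖) * K * K := fun t ↦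
      norm_apply₂_le ((ContinuousLinearMap.le_opNorm _ _).trans
        (mul_le_mul_of_nonneg_right (hc₁ _ (huC t)) (norm_nonneg e))) (hdub t) (hdub t)
    have hK0 : (0 : ℝ) ≤ K := K.2
    set B : ℝ≥0 := (2 * (c₀ * K * ‖e‖) + (c₁ * ‖e‖) * K * K).toNNReal with hB
    have hBval : (B : ℝ) = 2 * (c₀ * K * ‖e‖) + (c₁ * ‖e‖) * K * K :=
      Real.coe_toNNReal _ (by positivity)
    have n1 : 0 ≤ 2 * (c₀ * K * ‖e‖) := by positivity
    have n2 : 0 ≤ (c₁ * ‖e‖) * K * K := by positivity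
    exact ae_eq_const_add_integral hab.le hPm.measurable hQm.measurable (C := B)
      (fun t ↦ (hP0 t).trans (by rw [hBval]; linarith))
      (fun t ↦ (hQ0 t).trans (by rw [hBval]; linarith))
      (fun η K' hη hηa hηb ↦ hEL e hη hηa hηb)
  choose c hc using hmom
  set β := Module.finBasis ℝ E
  set φ : Fin (finrank ℝ E) → (E →L[ℝ] ℝ) := fun i ↦
    LinearMap.toContinuousLinearMap (β.coord i) with hφ
  have hQint : ∀ (e : E) (x y : ℝ), IntervalIntegrable
      (fun s ↦ fderiv ℝ g (u s) e (deriv u s) (deriv u s)) volume x y := fun e x y ↦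
    intervalIntegrable_of_bound (stronglyMeasurable_apply₂
      (hDu.clm_apply continuous_const).stronglyMeasurable hdu hdu) (C := (c₁ * ‖e‖) * K * K)
      (fun t ↦ norm_apply₂_le ((ContinuousLinearMap.le_opNorm _ _).trans
        (mul_le_mul_of_nonneg_right (hc₁ _ (huC t)) (norm_nonneg e))) (hdub t) (hdub t)) x y
  set f : Fin (finrank ℝ E) → ℝ → ℝ := fun i t ↦
    (1 / 2) * (c (β i) + ∫ s in a..t, fderiv ℝ g (u s) (β i) (deriv u s) (deriv u s)) with hf
  have hfc : ∀ i, Continuous (f i) := fun i ↦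
    continuous_const.mul (continuous_const.add (continuous_primitive (hQint (β i)) a))
  set ξ : ℝ → (E →L[ℝ] ℝ) := fun t ↦ ∑ i, f i t • φ i with hξ
  have hξc : Continuous ξ := continuous_finsetSum _ fun i _ ↦ (hfc i).smul continuous_const
  have hξβ : ∀ t i, ξ t (β i) = f i t := fun t i ↦ by
    simp [hξ, hφ, Finsupp.single_apply]
  -- The momentum of `u` agrees almost everywhere with the continuous covector `ξ`. Raising the
  -- index yields a continuous representative of `deriv u`, so `u` is `C¹`.
  set v : ℝ → E := fun t ↦ (g (u t)).inverse (ξ t) with hv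
  have hgv : ∀ t, g (u t) (v t) = ξ t := fun t ↦ hg.apply_inverse (huU t) _
  have hinvc : Continuous fun t ↦ (g (u t)).inverse := continuous_iff_continuousAt.2 fun t ↦
    ContinuousAt.comp (f := u) (hg.contDiffAt_inverse (huU t)).continuousAt
      hu.continuous.continuousAt
  have hvc : Continuous v := hinvc.clm_apply hξc
  have hduv : ∀ᵐ t, t ∈ Icc a b → deriv u t = v t := by
    have := ae_all_iff.2 fun i ↦ hc (β i)
    filter_upwards [this] with t ht htI
    refine hg.ext_left (huU t) fun w ↦ ?_
    rw [hgv]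
    have : (g (u t) (deriv u t) : E →ₗ[ℝ] ℝ) = (ξ t : E →ₗ[ℝ] ℝ) := by
      refine β.ext fun i ↦ ?_
      have h1 := ht i htI
      simp only [ContinuousLinearMap.coe_coe, hξβ, hf]
      linarith
    exact LinearMap.congr_fun this w
  have hprim : ∀ t, HasDerivAt (fun t ↦ ∫ s in a..t, v s) (v t) t := fun t ↦
    integral_hasDerivAt_right (hvc.intervalIntegrable _ _)
      (hvc.stronglyMeasurableAtFilter _ _) hvc.continuousAt
  have huint : ∀ t ∈ Icc a b, u t = u a + ∫ s in a..t, v s := by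
    have hac1 : AbsolutelyContinuousOnInterval u a b :=
      (hu.lipschitzOnWith (s := uIcc a b)).absolutelyContinuousOnInterval
    have hac2 : AbsolutelyContinuousOnInterval (fun t ↦ ∫ s in a..t, v s) a b := by
      refine ContDiffOn.absolutelyContinuousOnInterval ?_
      refine ContDiff.contDiffOn (contDiff_one_iff_deriv.2 ⟨fun t ↦ (hprim t).differentiableAt, ?_⟩)
      rwa [show deriv (fun t ↦ ∫ s in a..t, v s) = v from funext fun t ↦ (hprim t).deriv]
    obtain ⟨C₂, hC₂⟩ := (hac1.sub hac2).const_of_ae_hasDerivAt_zero (by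
      filter_upwards [hduv, hu.ae_differentiableAt] with t h1 h2 ht
      rw [uIcc_of_le hab.le] at ht
      refine (h2.hasDerivAt.sub (hprim t)).congr_deriv ?_
      rw [h1 ht, sub_self])
    intro t ht
    have e1 := hC₂ t (by rwa [uIcc_of_le hab.le])
    have e2 := hC₂ a (by simp)
    simp only [Pi.sub_apply, integral_same, sub_zero] at e1 e2
    rw [e2, ← e1, sub_add_cancel]
  have hud : ∀ t ∈ Icc a b, HasDerivWithinAt u (v t) (Icc a b) t := fun t ht ↦
    (((hprim t).const_add (u a)).hasDerivWithinAt).congr huint (huint t ht)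
  have hQv : ∀ e, ∀ t ∈ Icc a b, ∫ s in a..t, fderiv ℝ g (u s) e (deriv u s) (deriv u s) =
      ∫ s in a..t, fderiv ℝ g (u s) e (v s) (v s) := by
    intro e t ht
    refine integral_congr_ae ?_
    filter_upwards [hduv] with s hs hs'
    rw [uIoc_of_le ht.1] at hs'
    rw [hs ⟨hs'.1.le, hs'.2.trans ht.2⟩]
  have hfd : ∀ i, ∀ t ∈ Icc a b,
      HasDerivWithinAt (f i) ((1 / 2) * fderiv ℝ g (u t) (β i) (v t) (v t)) (Icc a b) t := by
    intro i t ht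
    have hcont : Continuous fun s ↦ fderiv ℝ g (u s) (β i) (v s) (v s) :=
      ((hDu.clm_apply continuous_const).clm_apply hvc).clm_apply hvc
    have h1 : HasDerivAt (fun t ↦ (1 / 2 : ℝ) * (c (β i) +
        ∫ s in a..t, fderiv ℝ g (u s) (β i) (v s) (v s))) _ t :=
      ((integral_hasDerivAt_right (hcont.intervalIntegrable _ _)
        (hcont.stronglyMeasurableAtFilter _ _) hcont.continuousAt).const_add _).const_mul _
    exact h1.hasDerivWithinAt.congr (fun s hs ↦ by simp only [hf, hQv (β i) s hs])
      (by simp only [hf, hQv (β i) t ht])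
  have hξd : ∀ t ∈ Icc a b, HasDerivWithinAt ξ
      (∑ i, ((1 / 2) * fderiv ℝ g (u t) (β i) (v t) (v t)) • φ i) (Icc a b) t := fun t ht ↦
    HasDerivWithinAt.fun_sum fun i _ ↦ (hfd i t ht).smul_const (φ i)
  have hvd : ∀ t ∈ Icc a b,
      HasDerivWithinAt v (-christoffel g (u t) (v t) (v t)) (Icc a b) t := by
    intro t ht
    have hinv : HasDerivWithinAt (fun t ↦ (g (u t)).inverse) _ (Icc a b) t :=
      ((hg.contDiffAt_inverse (huU t)).differentiableAt
        (by simp)).hasFDerivAt.comp_hasDerivWithinAt t (hud t ht)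
    -- Only differentiability of `v` is taken from this formula; the value of the derivative is read
    -- off by differentiating `g(u) v = ξ`.
    obtain ⟨v', hv'⟩ : ∃ v', HasDerivWithinAt v v' (Icc a b) t := ⟨_, hinv.clm_apply (hξd t ht)⟩
    have h1 : HasDerivWithinAt (fun t ↦ g (u t) (v t)) _ (Icc a b) t :=
      ((hg.hasFDerivAt (huU t)).comp_hasDerivWithinAt t (hud t ht)).clm_apply hv'
    have h2 := (hξd t ht).congr (fun s _ ↦ hgv s) (hgv t)
    have heq := (uniqueDiffOn_Icc hab t ht).eq_deriv _ h1 h2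
    have hval : v' = -christoffel g (u t) (v t) (v t) := by
      refine hg.ext_left (huU t) fun w ↦ ?_
      have h3 : fderiv ℝ g (u t) (v t) (v t) w + g (u t) v' w =
          (1 / 2) * fderiv ℝ g (u t) w (v t) (v t) := by
        have := DFunLike.congr_fun heq w
        simp only [add_apply] at this
        rw [Function.comp_apply] at this
        rw [this]
        have hw : fderiv ℝ g (u t) w (v t) (v t) =
            ∑ i, β.repr w i * fderiv ℝ g (u t) (β i) (v t) (v t) := by
          conv_lhs => rw [← β.sum_repr w, map_sum]
          simp
        rw [hw, Finset.mul_sum]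
        simp [hφ]
        exact Finset.sum_congr rfl fun i _ ↦ by ring
      rw [map_neg, neg_apply, hg.apply_christoffel (huU t)]
      linarith
    rwa [hval] at hv'
  have hcontE : Continuous fun t ↦ g (u t) (v t) (v t) := (hgu.clm_apply hvc).clm_apply hvc
  have hEv : ∫ t in a..b, g (u t) (deriv u t) (deriv u t) = ∫ t in a..b, g (u t) (v t) (v t) := by
    refine integral_congr_ae ?_
    filter_upwards [hduv] with s hs hs'
    rw [uIoc_of_le hab.le] at hs'
    rw [hs (Ioc_subset_Icc_self hs')]
  have hle1 : ∀ᵐ t, t ∈ Ioc a b → 0 ≤ 1 - g (u t) (v t) (v t) := by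
    filter_upwards [hspeed, hduv] with t h1 h2 ht
    have ht' := Ioc_subset_Icc_self ht
    have := h1 ht'
    rw [h2 ht'] at this
    linarith
  -- With `u` itself as competitor the energy is at least `b - a`. As the speed is at most one, the
  -- defect has zero integral and, being continuous, vanishes everywhere.
  have hint0 : ∫ t in a..b, (1 - g (u t) (v t) (v t)) = 0 := by
    have h1 := hmin u K hu rfl rfl fun t _ ↦ huU t
    rw [hhalf u K hu fun t _ ↦ huU t] at h1
    have h2 : ∫ t in a..b, (1 - g (u t) (v t) (v t)) =
        (b - a) - ∫ t in a..b, g (u t) (deriv u t) (deriv u t) := by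
      rw [integral_sub intervalIntegrable_const (hcontE.intervalIntegrable _ _), hEv]
      simp
    rw [h2]; linarith
  have hone : ∀ t ∈ Icc a b, g (u t) (v t) (v t) = 1 := by
    have hintOn : IntegrableOn (fun t ↦ 1 - g (u t) (v t) (v t)) (Ioc a b) :=
      (continuous_const.sub hcontE).integrableOn_Ioc
    rw [integral_of_le hab.le, setIntegral_eq_zero_iff_of_nonneg_ae
      (by rw [Filter.EventuallyLE, ae_restrict_iff' measurableSet_Ioc]; exact hle1)
      hintOn] at hint0
    have h1 : (fun t ↦ 1 - g (u t) (v t) (v t)) =ᵐ[volume.restrict (Icc a b)] 0 := by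
      rwa [← restrict_Ioc_eq_restrict_Icc]
    have h3 := Measure.eqOn_Icc_of_ae_eq volume hab.ne h1
      (continuous_const.sub hcontE).continuousOn continuousOn_const
    intro t ht
    have := h3 ht
    simp only [Pi.zero_apply] at this
    linarith
  exact ⟨v, fun t ht ↦ ⟨hud t ht, hvd t ht, hone t ht⟩⟩

end LocalMetric

/-! ### The second variation of the energy -/

namespace LocalMetric

open Set Filter Topology MeasureTheory intervalIntegral
open scoped NNReal

/-- A one-sided Taylor estimate: an upper bound for the second derivative is integrated twice, with
no continuity assumed of it. -/
theorem le_taylor_two_of_deriv_le {f f₁ f₂ : ℝ → ℝ} {δ M : ℝ}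
    (hf : ∀ s ∈ Icc 0 δ, HasDerivAt f (f₁ s) s) (hf₁ : ∀ s ∈ Icc 0 δ, HasDerivAt f₁ (f₂ s) s)
    (hM : ∀ s ∈ Icc 0 δ, f₂ s ≤ M) {s : ℝ} (hs : s ∈ Icc 0 δ) :
    f s ≤ f 0 + s * f₁ 0 + s ^ 2 / 2 * M := by
  have h1 : ∀ s ∈ Icc 0 δ, f₁ s ≤ f₁ 0 + M * s := by
    intro s hs
    refine image_le_of_deriv_right_le_deriv_boundary (f := f₁) (f' := f₂)
      (B := fun s ↦ f₁ 0 + M * s) (B' := fun _ ↦ M)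
      (fun s hs ↦ (hf₁ s hs).continuousAt.continuousWithinAt)
      (fun s hs ↦ (hf₁ s (Ico_subset_Icc_self hs)).hasDerivWithinAt) (by simp) (by fun_prop)
      (fun s _ ↦ ?_) (fun s hs ↦ hM s (Ico_subset_Icc_self hs)) hs
    simpa using (((hasDerivAt_id s).const_mul M).const_add (f₁ 0)).hasDerivWithinAt
  refine image_le_of_deriv_right_le_deriv_boundary (f := f) (f' := f₁)
      (B := fun s ↦ f 0 + s * f₁ 0 + s ^ 2 / 2 * M) (B' := fun s ↦ f₁ 0 + M * s)
      (fun s hs ↦ (hf s hs).continuousAt.continuousWithinAt)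
      (fun s hs ↦ (hf s (Ico_subset_Icc_self hs)).hasDerivWithinAt) (by simp) (by fun_prop)
      (fun s _ ↦ ?_) (fun s hs ↦ h1 s (Ico_subset_Icc_self hs)) hs
  have := ((((hasDerivAt_id s).mul_const (f₁ 0)).const_add (f 0)).add
    ((((hasDerivAt_id s).pow 2).div_const 2).mul_const M)).hasDerivWithinAt (s := Ici s)
  refine this.congr_deriv ?_
  simp
  ring

variable {E : Type*} [NormedAddCommGroup E] [NormedSpace ℝ E]
  {g : E → E →L[ℝ] E →L[ℝ] ℝ} {U : Set E}

/-- The point reached from `z` in time `s` by the geodesic with initial velocity `V`, up to second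
order in `s`. -/
def osculating (g : E → E →L[ℝ] E →L[ℝ] ℝ) (z V : E) (s : ℝ) : E :=
  z + s • V + (s ^ 2 / 2) • -christoffel g z V V

/-- The integrand of the index form along a curve with velocity `v` at `z`, for a field with value
`V` and derivative `V'`. -/
def indexForm (g : E → E →L[ℝ] E →L[ℝ] ℝ) (z v V V' : E) : ℝ :=
  g z (V' + christoffel g z v V) (V' + christoffel g z v V) - g z (curvature g z V v v) V

theorem osculating_zero (g : E → E →L[ℝ] E →L[ℝ] ℝ) (z V : E) : osculating g z V 0 = z := by
  simp [osculating]

variable [FiniteDimensional ℝ E]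

theorem IsMetricOn.continuousOn_indexForm (hg : IsMetricOn g U) {S : Set ℝ} {u v V V' : ℝ → E}
    (huU : ∀ t ∈ S, u t ∈ U) (hu : ContinuousOn u S) (hv : ContinuousOn v S)
    (hV : ContinuousOn V S) (hV' : ContinuousOn V' S) :
    ContinuousOn (fun t ↦ indexForm g (u t) (v t) (V t) (V' t)) S := by
  have hgc : ContinuousOn (fun t ↦ g (u t)) S := fun t ht ↦
    ContinuousAt.comp_continuousWithinAt (hg.contDiffAt (huU t ht)).continuousAt (hu t ht)
  have hΓ : ContinuousOn (fun t ↦ christoffel g (u t)) S := fun t ht ↦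
    ContinuousAt.comp_continuousWithinAt (hg.contDiffAt_christoffel (huU t ht)).continuousAt
      (hu t ht)
  have hDΓ : ContinuousOn (fun t ↦ fderiv ℝ (christoffel g) (u t)) S := fun t ht ↦
    ContinuousAt.comp_continuousWithinAt (((hg.contDiffAt_christoffel (huU t ht)).fderiv_right
      (m := 0) (by simp)).continuousAt) (hu t ht)
  have hDt := hV'.add ((hΓ.clm_apply hv).clm_apply hV)
  unfold indexForm curvature
  refine ((hgc.clm_apply hDt).clm_apply hDt).sub ((hgc.clm_apply ?_).clm_apply hV)
  exact ((((hDΓ.clm_apply hV).clm_apply hv).clm_apply hv).sub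
    (((hDΓ.clm_apply hv).clm_apply hV).clm_apply hv)).add
    ((hΓ.clm_apply hV).clm_apply ((hΓ.clm_apply hv).clm_apply hv)) |>.sub
    ((hΓ.clm_apply hv).clm_apply ((hΓ.clm_apply hV).clm_apply hv))

/-- The energy of the variation of a unit speed geodesic in the direction of an orthogonal field,
to second order. -/
theorem IsMetricOn.eventually_energy_le (hg : IsMetricOn g U) {a b : ℝ} (hab : a < b)
    {u v V V' : ℝ → E} (huU : ∀ t ∈ Icc a b, u t ∈ U)
    (hu : ∀ t ∈ Icc a b, HasDerivWithinAt u (v t) (Icc a b) t)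
    (hv : ∀ t ∈ Icc a b, HasDerivWithinAt v (-christoffel g (u t) (v t) (v t)) (Icc a b) t)
    (hone : ∀ t ∈ Icc a b, g (u t) (v t) (v t) = 1)
    (hV : ∀ t ∈ Icc a b, HasDerivWithinAt V (V' t) (Icc a b) t)
    (hV' : ContinuousOn V' (Icc a b)) (hperp : ∀ t ∈ Icc a b, g (u t) (v t) (V t) = 0)
    {ε : ℝ} (hε : 0 < ε) :
    ∀ᶠ s in 𝓝[>] (0 : ℝ), (∀ t ∈ Icc a b, osculating g (u t) (V t) s ∈ U) ∧
      (∃ K, LipschitzOnWith K (fun t ↦ osculating g (u t) (V t) s) (Icc a b)) ∧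
      ∫ t in a..b, (1 + g (osculating g (u t) (V t) s)
          (deriv (fun t ↦ osculating g (u t) (V t) s) t)
          (deriv (fun t ↦ osculating g (u t) (V t) s) t)) / 2 ≤
        (b - a) + s ^ 2 / 2 * ((∫ t in a..b, indexForm g (u t) (v t) (V t) (V' t)) + ε) := by
  set W : ℝ → E := fun t ↦ -christoffel g (u t) (V t) (V t) with hW
  set W' : ℝ → E := fun t ↦ -(fderiv ℝ (christoffel g) (u t) (v t) (V t) (V t)
    + christoffel g (u t) (V' t) (V t) + christoffel g (u t) (V t) (V' t)) with hW'
  have huc : ContinuousOn u (Icc a b) := fun t ht ↦ (hu t ht).continuousWithinAt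
  have hvc : ContinuousOn v (Icc a b) := fun t ht ↦ (hv t ht).continuousWithinAt
  have hVc : ContinuousOn V (Icc a b) := fun t ht ↦ (hV t ht).continuousWithinAt
  have hWd : ∀ t ∈ Icc a b, HasDerivWithinAt W (W' t) (Icc a b) t := by
    intro t ht
    have h1 := (hg.hasFDerivAt_christoffel (huU t ht)).comp_hasDerivWithinAt t (hu t ht)
    refine ((h1.clm_apply (hV t ht)).clm_apply (hV t ht)).neg.congr_deriv ?_
    simp [hW']
  have hΓc : ContinuousOn (fun t ↦ christoffel g (u t)) (Icc a b) := fun t ht ↦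
    ContinuousAt.comp_continuousWithinAt (hg.contDiffAt_christoffel (huU t ht)).continuousAt
      (huc t ht)
  have hDΓc : ContinuousOn (fun t ↦ fderiv ℝ (christoffel g) (u t)) (Icc a b) := fun t ht ↦
    ContinuousAt.comp_continuousWithinAt (((hg.contDiffAt_christoffel (huU t ht)).fderiv_right
      (m := 0) (by simp)).continuousAt) (huc t ht)
  have hWc : ContinuousOn W (Icc a b) := fun t ht ↦ (hWd t ht).continuousWithinAt
  have hW'c : ContinuousOn W' (Icc a b) :=
    ((((hDΓc.clm_apply hvc).clm_apply hVc).clm_apply hVc).add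
      ((hΓc.clm_apply hV').clm_apply hVc)).add ((hΓc.clm_apply hVc).clm_apply hV') |>.neg
  -- Here `x` is the variation, `y` its derivative in `t`, and `x₁`, `y₁` are the derivatives of
  -- `x`, `y` in `s`. Then `Φ₁` and `Φ₂` are the first and second `s`-derivatives of `g(y, y)`.
  set x : ℝ → ℝ → E := fun s t ↦ u t + s • V t + (s ^ 2 / 2) • W t with hx
  set y : ℝ → ℝ → E := fun s t ↦ v t + s • V' t + (s ^ 2 / 2) • W' t with hy
  set x₁ : ℝ → ℝ → E := fun s t ↦ V t + s • W t with hx₁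
  set y₁ : ℝ → ℝ → E := fun s t ↦ V' t + s • W' t with hy₁
  have hosc : ∀ s t, osculating g (u t) (V t) s = x s t := fun s t ↦ rfl
  have hxt : ∀ s, ∀ t ∈ Icc a b, HasDerivWithinAt (x s) (y s t) (Icc a b) t := fun s t ht ↦
    ((hu t ht).add ((hV t ht).const_smul s)).add ((hWd t ht).const_smul (s ^ 2 / 2))
  set Φ₁ : ℝ → ℝ → ℝ := fun s t ↦ fderiv ℝ g (x s t) (x₁ s t) (y s t) (y s t)
    + g (x s t) (y₁ s t) (y s t) + g (x s t) (y s t) (y₁ s t) with hΦ₁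
  set Φ₂ : ℝ → ℝ → ℝ := fun s t ↦ fderiv ℝ (fderiv ℝ g) (x s t) (x₁ s t) (x₁ s t) (y s t) (y s t)
    + fderiv ℝ g (x s t) (W t) (y s t) (y s t)
    + fderiv ℝ g (x s t) (x₁ s t) (y₁ s t) (y s t) + fderiv ℝ g (x s t) (x₁ s t) (y s t) (y₁ s t)
    + (fderiv ℝ g (x s t) (x₁ s t) (y₁ s t) (y s t) + g (x s t) (W' t) (y s t)
      + g (x s t) (y₁ s t) (y₁ s t))
    + (fderiv ℝ g (x s t) (x₁ s t) (y s t) (y₁ s t) + g (x s t) (y₁ s t) (y₁ s t)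
      + g (x s t) (y s t) (W' t)) with hΦ₂
  set ι : ℝ → ℝ := fun t ↦ indexForm g (u t) (v t) (V t) (V' t) with hι
  have hιc : ContinuousOn ι (Icc a b) := hg.continuousOn_indexForm huU huc hvc hVc hV'
  -- A pointwise slack that integrates to `ε`.
  set ε' := ε / (b - a) with hε'
  have hba : 0 < b - a := sub_pos.2 hab
  have hε'0 : 0 < ε' := by positivity
  have hx0 : ∀ t, x 0 t = u t := fun t ↦ by simp [hx]
  have hy0 : ∀ t, y 0 t = v t := fun t ↦ by simp [hy]
  have hx₁0 : ∀ t, x₁ 0 t = V t := fun t ↦ by simp [hx₁]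
  have hy₁0 : ∀ t, y₁ 0 t = V' t := fun t ↦ by simp [hy₁]
  -- The factor two is there because `second_variation_identity` concerns half the squared speed.
  have hΦ₂0 : ∀ t ∈ Icc a b, Φ₂ 0 t = 2 * ι t := by
    intro t ht
    have hz := huU t ht
    have key := hg.second_variation_identity hz (v t) (V t) (V' t)
    simp only [hΦ₂, hι, indexForm, hx0, hy0, hx₁0, hy₁0]
    rw [← key, hg.fderiv_symm hz _ (V' t) (v t), hg.symm _ hz (W' t) (v t)]
    simp only [hW, hW', map_neg, neg_apply]
    ring
  -- The first variation vanishes pointwise, without integration by parts: it is twice the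
  -- derivative of `g(v, V) = 0` along the geodesic.
  have hΦ₁0 : ∀ t ∈ Icc a b, Φ₁ 0 t = 0 := by
    intro t ht
    have hz := huU t ht
    have h1 : HasDerivWithinAt (fun t ↦ g (u t) (v t) (V t)) _ (Icc a b) t :=
      (((hg.hasFDerivAt hz).comp_hasDerivWithinAt t (hu t ht)).clm_apply (hv t ht)).clm_apply
        (hV t ht)
    have h2 : HasDerivWithinAt (fun t ↦ g (u t) (v t) (V t)) 0 (Icc a b) t :=
      (hasDerivWithinAt_const t (Icc a b) (0 : ℝ)).congr hperp (hperp t ht)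
    have h3 := (uniqueDiffOn_Icc hab t ht).eq_deriv _ h1 h2
    simp only [add_apply, Function.comp_apply, map_neg, neg_apply,
      hg.apply_christoffel hz] at h3
    simp only [hΦ₁, hx0, hy0, hx₁0, hy₁0]
    rw [hg.symm _ hz (V' t) (v t)]
    linarith
  -- Compactness of `[a, b]` makes the bound on `Φ₂`, which is clear at `s = 0`, hold for small `s`
  -- uniformly in `t`.
  have hev : ∀ᶠ s in 𝓝 (0 : ℝ), ∀ t : Icc a b, t ∈ univ →
      (x s t ∈ U ∧ Φ₂ s t < 2 * ι t + 2 * ε') := by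
    refine isCompact_univ.eventually_forall_of_forall_eventually fun t _ ↦ ?_
    have cu : Continuous fun p : ℝ × Icc a b ↦ u p.2 := by
      have := continuousOn_iff_continuous_domRestrict.1 huc
      exact this.comp continuous_snd
    have cv : Continuous fun p : ℝ × Icc a b ↦ v p.2 := by
      have := continuousOn_iff_continuous_domRestrict.1 hvc
      exact this.comp continuous_snd
    have cV : Continuous fun p : ℝ × Icc a b ↦ V p.2 := by
      have := continuousOn_iff_continuous_domRestrict.1 hVc
      exact this.comp continuous_snd
    have cV' : Continuous fun p : ℝ × Icc a b ↦ V' p.2 := by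
      have := continuousOn_iff_continuous_domRestrict.1 hV'
      exact this.comp continuous_snd
    have cW : Continuous fun p : ℝ × Icc a b ↦ W p.2 := by
      have := continuousOn_iff_continuous_domRestrict.1 hWc
      exact this.comp continuous_snd
    have cW' : Continuous fun p : ℝ × Icc a b ↦ W' p.2 := by
      have := continuousOn_iff_continuous_domRestrict.1 hW'c
      exact this.comp continuous_snd
    have cι : Continuous fun p : ℝ × Icc a b ↦ ι p.2 := by
      have := continuousOn_iff_continuous_domRestrict.1 hιc
      exact this.comp continuous_snd
    have cx : Continuous fun p : ℝ × Icc a b ↦ x p.1 p.2 :=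
      (cu.add (continuous_fst.smul cV)).add (((continuous_fst.pow 2).div_const 2).smul cW)
    have cy : Continuous fun p : ℝ × Icc a b ↦ y p.1 p.2 :=
      (cv.add (continuous_fst.smul cV')).add (((continuous_fst.pow 2).div_const 2).smul cW')
    have cx₁ : Continuous fun p : ℝ × Icc a b ↦ x₁ p.1 p.2 := cV.add (continuous_fst.smul cW)
    have cy₁ : Continuous fun p : ℝ × Icc a b ↦ y₁ p.1 p.2 := cV'.add (continuous_fst.smul cW')
    have hzU : x 0 t ∈ U := by rw [hx0]; exact huU t t.2
    have Cg : ContinuousAt (fun p : ℝ × Icc a b ↦ g (x p.1 p.2)) (0, t) :=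
      ContinuousAt.comp (f := fun p : ℝ × Icc a b ↦ x p.1 p.2)
        (hg.contDiffAt hzU).continuousAt cx.continuousAt
    have CD : ContinuousAt (fun p : ℝ × Icc a b ↦ fderiv ℝ g (x p.1 p.2)) (0, t) :=
      ContinuousAt.comp (f := fun p : ℝ × Icc a b ↦ x p.1 p.2)
        (hg.contDiffAt_fderiv hzU).continuousAt cx.continuousAt
    have CDD : ContinuousAt (fun p : ℝ × Icc a b ↦ fderiv ℝ (fderiv ℝ g) (x p.1 p.2)) (0, t) :=
      ContinuousAt.comp (f := fun p : ℝ × Icc a b ↦ x p.1 p.2)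
        ((hg.contDiffAt_fderiv hzU).fderiv_right (m := 0) (by simp)).continuousAt cx.continuousAt
    have ay := cy.continuousAt (x := (0, t))
    have ax₁ := cx₁.continuousAt (x := (0, t))
    have ay₁ := cy₁.continuousAt (x := (0, t))
    have aW := cW.continuousAt (x := (0, t))
    have aW' := cW'.continuousAt (x := (0, t))
    have CΦ : ContinuousAt (fun p : ℝ × Icc a b ↦ Φ₂ p.1 p.2) (0, t) := by
      have t1 := (((CDD.clm_apply ax₁).clm_apply ax₁).clm_apply ay).clm_apply ay
      have t2 := ((CD.clm_apply aW).clm_apply ay).clm_apply ay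
      have t3 := ((CD.clm_apply ax₁).clm_apply ay₁).clm_apply ay
      have t4 := ((CD.clm_apply ax₁).clm_apply ay).clm_apply ay₁
      have t5 := (Cg.clm_apply aW').clm_apply ay
      have t6 := (Cg.clm_apply ay₁).clm_apply ay₁
      have t7 := (Cg.clm_apply ay).clm_apply aW'
      exact ((((t1.add t2).add t3).add t4).add ((t3.add t5).add t6)).add ((t4.add t6).add t7)
    refine (cx.continuousAt.eventually (hg.isOpen.mem_nhds hzU)).and ?_
    have hlt : Φ₂ 0 t < 2 * ι t + 2 * ε' := by rw [hΦ₂0 t t.2]; linarith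
    exact CΦ.eventually_lt ((cι.continuousAt.const_mul 2).add_const (2 * ε')) hlt
  obtain ⟨δ, hδ, hball⟩ := Metric.eventually_nhds_iff.1 hev
  have hgood : ∀ s, 0 < s → s < δ → ∀ t ∈ Icc a b,
      x s t ∈ U ∧ g (x s t) (y s t) (y s t) ≤ 1 + s ^ 2 / 2 * (2 * ι t + 2 * ε') := by
    intro s hs0 hsδ t ht
    have hin : ∀ r ∈ Icc 0 s, x r t ∈ U ∧ Φ₂ r t < 2 * ι t + 2 * ε' := fun r hr ↦
      hball (y := r) (by rw [Real.dist_eq, sub_zero, abs_of_nonneg hr.1]; linarith [hr.2])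
        ⟨t, ht⟩ (mem_univ _)
    refine ⟨(hin s ⟨hs0.le, le_rfl⟩).1, ?_⟩
    have dx : ∀ r, HasDerivAt (fun r ↦ x r t) (x₁ r t) r := fun r ↦ by
      refine ((((hasDerivAt_id r).smul_const (V t)).const_add (u t)).add
        ((((hasDerivAt_id r).pow 2).div_const 2).smul_const (W t))).congr_deriv ?_
      simp [hx₁]
    have dy : ∀ r, HasDerivAt (fun r ↦ y r t) (y₁ r t) r := fun r ↦ by
      refine ((((hasDerivAt_id r).smul_const (V' t)).const_add (v t)).add
        ((((hasDerivAt_id r).pow 2).div_const 2).smul_const (W' t))).congr_deriv ?_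
      simp [hy₁]
    have dx₁ : ∀ r, HasDerivAt (fun r ↦ x₁ r t) (W t) r := fun r ↦
      (((hasDerivAt_id r).smul_const (W t)).const_add (V t)).congr_deriv (one_smul _ _)
    have dy₁ : ∀ r, HasDerivAt (fun r ↦ y₁ r t) (W' t) r := fun r ↦
      (((hasDerivAt_id r).smul_const (W' t)).const_add (V' t)).congr_deriv (one_smul _ _)
    have dg : ∀ r ∈ Icc 0 s, HasDerivAt (fun r ↦ g (x r t)) (fderiv ℝ g (x r t) (x₁ r t)) r :=
      fun r hr ↦ (hg.hasFDerivAt (hin r hr).1).comp_hasDerivAt r (dx r)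
    have dD : ∀ r ∈ Icc 0 s, HasDerivAt (fun r ↦ fderiv ℝ g (x r t))
        (fderiv ℝ (fderiv ℝ g) (x r t) (x₁ r t)) r :=
      fun r hr ↦ (hg.hasFDerivAt_fderiv (hin r hr).1).comp_hasDerivAt r (dx r)
    have h1 : ∀ r ∈ Icc 0 s, HasDerivAt (fun r ↦ g (x r t) (y r t) (y r t)) (Φ₁ r t) r := by
      intro r hr
      refine (((dg r hr).clm_apply (dy r)).clm_apply (dy r)).congr_deriv ?_
      simp [hΦ₁]
    have h2 : ∀ r ∈ Icc 0 s, HasDerivAt (fun r ↦ Φ₁ r t) (Φ₂ r t) r := by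
      intro r hr
      refine ((((((dD r hr).clm_apply (dx₁ r)).clm_apply (dy r)).clm_apply (dy r)).add
        (((dg r hr).clm_apply (dy₁ r)).clm_apply (dy r))).add
        (((dg r hr).clm_apply (dy r)).clm_apply (dy₁ r))).congr_deriv ?_
      simp only [hΦ₂, add_apply]
    have h3 := le_taylor_two_of_deriv_le h1 h2 (fun r hr ↦ (hin r hr).2.le) ⟨hs0.le, le_rfl⟩
    simpa only [hx0, hy0, hone t ht, hΦ₁0 t ht, mul_zero, add_zero] using h3
  filter_upwards [Ioo_mem_nhdsGT hδ] with s hs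
  have hgs := hgood s hs.1 hs.2
  have hyc : ContinuousOn (y s) (Icc a b) :=
    (hvc.add (hV'.const_smul s)).add (hW'c.const_smul (s ^ 2 / 2))
  obtain ⟨c, hc⟩ := isCompact_Icc.exists_bound_of_continuousOn hyc
  have hLip : LipschitzOnWith c.toNNReal (x s) (Icc a b) := by
    refine (convex_Icc a b).lipschitzOnWith_of_nnnorm_hasDerivWithin_le (f' := y s) (hxt s) ?_
    intro t ht
    rw [← NNReal.coe_le_coe, coe_nnnorm]
    exact (hc t ht).trans (Real.le_coe_toNNReal c)
  refine ⟨fun t ht ↦ (hgs t ht).1, ⟨_, hLip⟩, ?_⟩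
  have hxcont : ContinuousOn (x s) (Icc a b) := fun t ht ↦ (hxt s t ht).continuousWithinAt
  have hgx : ContinuousOn (fun t ↦ g (x s t)) (Icc a b) := fun t ht ↦
    ContinuousAt.comp_continuousWithinAt (hg.contDiffAt (hgs t ht).1).continuousAt (hxcont t ht)
  have hEc : ContinuousOn (fun t ↦ (1 + g (x s t) (y s t) (y s t)) / 2) (Icc a b) :=
    (continuousOn_const.add ((hgx.clm_apply hyc).clm_apply hyc)).div_const 2
  have hBc : ContinuousOn (fun t ↦ 1 + s ^ 2 / 2 * (ι t + ε')) (Icc a b) :=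
    continuousOn_const.add (continuousOn_const.mul (hιc.add continuousOn_const))
  have hιi : IntervalIntegrable ι volume a b := hιc.intervalIntegrable_of_Icc hab.le
  calc ∫ t in a..b, (1 + g (osculating g (u t) (V t) s)
          (deriv (fun t ↦ osculating g (u t) (V t) s) t)
          (deriv (fun t ↦ osculating g (u t) (V t) s) t)) / 2
      = ∫ t in a..b, (1 + g (x s t) (y s t) (y s t)) / 2 := by
        refine integral_congr_ae ?_
        -- The two-sided `deriv` is controlled only at interior points, hence the exclusion of `b`.
        filter_upwards [compl_mem_ae_iff.2 (measure_singleton b)] with t hne ht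
        rw [uIoc_of_le hab.le] at ht
        replace ht : t ∈ Ioo a b := ⟨ht.1, lt_of_le_of_ne ht.2 hne⟩
        have hd : deriv (fun t ↦ osculating g (u t) (V t) s) t = y s t :=
          ((hxt s t (Ioo_subset_Icc_self ht)).hasDerivAt (Icc_mem_nhds ht.1 ht.2)).deriv
        rw [hd]; rfl
    _ ≤ ∫ t in a..b, (1 + s ^ 2 / 2 * (ι t + ε')) := by
        refine integral_mono_on hab.le (hEc.intervalIntegrable_of_Icc hab.le)
          (hBc.intervalIntegrable_of_Icc hab.le) fun t ht ↦ ?_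
        have := (hgs t ht).2
        linarith
    _ = (b - a) + s ^ 2 / 2 * ((∫ t in a..b, ι t) + ε) := by
        rw [integral_add intervalIntegrable_const
          ((hιi.add intervalIntegrable_const).const_mul _), intervalIntegral.integral_const_mul,
          integral_add hιi intervalIntegrable_const]
        simp only [intervalIntegral.integral_const, smul_eq_mul, mul_one, hε']
        field_simp

end LocalMetric

/-! ### Riemannian manifolds in charts -/

namespace ChartCoordinates

open Set Filter Topology LocalMetric

variable {E : Type*} [NormedAddCommGroup E] [NormedSpace ℝ E]
  {M : Type*} [TopologicalSpace M] [ChartedSpace E M] [IsManifold 𝓘(ℝ, E) ∞ M]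

/-- The coordinate frame of the chart at `x₀`. -/
def frame (x₀ x : M) : E →L[ℝ] TangentSpace 𝓘(ℝ, E) x :=
  (trivializationAt E (TangentSpace 𝓘(ℝ, E)) x₀).symmL ℝ x

/-- The coordinates of a tangent vector in the chart at `x₀`. -/
def coord (x₀ x : M) : TangentSpace 𝓘(ℝ, E) x →L[ℝ] E :=
  (trivializationAt E (TangentSpace 𝓘(ℝ, E)) x₀).continuousLinearMapAt ℝ x

variable (E) in
/-- The chart at `x₀`. -/
abbrev chart (x₀ : M) : PartialEquiv M E := extChartAt 𝓘(ℝ, E) x₀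

theorem mem_baseSet {x₀ x : M} (hx : x ∈ (chart E x₀).source) :
    x ∈ (trivializationAt E (TangentSpace 𝓘(ℝ, E)) x₀).baseSet := by
  rw [extChartAt_source] at hx
  simpa using hx

theorem coord_frame {x₀ x : M} (hx : x ∈ (chart E x₀).source) (a : E) :
    coord x₀ x (frame x₀ x a) = a :=
  Trivialization.continuousLinearMapAt_symmL _ (mem_baseSet hx) a

theorem frame_coord {x₀ x : M} (hx : x ∈ (chart E x₀).source) (v : TangentSpace 𝓘(ℝ, E) x) :
    frame x₀ x (coord x₀ x v) = v :=
  Trivialization.symmL_continuousLinearMapAt _ (mem_baseSet hx) v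

theorem coord_eq_mfderiv {x₀ x : M} (hx : x ∈ (chart E x₀).source) :
    coord (E := E) x₀ x = mfderiv 𝓘(ℝ, E) 𝓘(ℝ, E) (chart E x₀) x :=
  TangentBundle.continuousLinearMapAt_trivializationAt (by rwa [extChartAt_source] at hx)

theorem frame_eq_mfderiv {x₀ x : M} (hx : x ∈ (chart E x₀).source) :
    frame (E := E) x₀ x = mfderiv 𝓘(ℝ, E) 𝓘(ℝ, E) (chart E x₀).symm (chart E x₀ x) := by
  have := TangentBundle.symmL_trivializationAt (I := 𝓘(ℝ, E)) (x₀ := x₀) (x := x)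
    (by rwa [extChartAt_source] at hx)
  rw [modelWithCornersSelf_coe, range_id, mfderivWithin_univ] at this
  exact this

theorem isOpen_target (x₀ : M) : IsOpen (chart E x₀).target := isOpen_extChartAt_target x₀

theorem isOpen_source (x₀ : M) : IsOpen (chart E x₀).source := isOpen_extChartAt_source x₀

theorem hasMFDerivAt_chart {x₀ x : M} (hx : x ∈ (chart E x₀).source) :
    HasMFDerivAt 𝓘(ℝ, E) 𝓘(ℝ, E) (chart E x₀) x (coord (E := E) x₀ x) := by
  rw [coord_eq_mfderiv hx]
  exact (mdifferentiableAt_extChartAt (by rwa [extChartAt_source] at hx)).hasMFDerivAt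

theorem contMDiffAt_chart {x₀ x : M} (hx : x ∈ (chart E x₀).source) :
    ContMDiffAt 𝓘(ℝ, E) 𝓘(ℝ, E) ∞ (chart E x₀) x :=
  contMDiffAt_extChartAt' (by rwa [extChartAt_source] at hx)

theorem contMDiffAt_chart_symm {x₀ : M} {z : E} (hz : z ∈ (chart E x₀).target) :
    ContMDiffAt 𝓘(ℝ, E) 𝓘(ℝ, E) ∞ (chart E x₀).symm z :=
  (contMDiffOn_extChartAt_symm x₀).contMDiffAt ((isOpen_target x₀).mem_nhds hz)

theorem hasMFDerivAt_chart_symm {x₀ : M} {z : E} (hz : z ∈ (chart E x₀).target) :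
    HasMFDerivAt 𝓘(ℝ, E) 𝓘(ℝ, E) (chart E x₀).symm z (frame (E := E) x₀ ((chart E x₀).symm z)) := by
  have h := ((contMDiffAt_chart_symm hz).mdifferentiableAt (by simp)).hasMFDerivAt
  rw [frame_eq_mfderiv ((chart E x₀).map_target hz)]
  have key : ∀ y, y = z → HasMFDerivAt 𝓘(ℝ, E) 𝓘(ℝ, E) (chart E x₀).symm z
      (mfderiv 𝓘(ℝ, E) 𝓘(ℝ, E) (chart E x₀).symm y : E →L[ℝ] E) := by
    rintro y rfl
    exact h
  exact key _ ((chart E x₀).right_inv hz)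

theorem contMDiffOn_frame (x₀ : M) (a : E) :
    ContMDiffOn 𝓘(ℝ, E) (𝓘(ℝ, E).prod 𝓘(ℝ, E)) ∞ (T% fun x : M ↦ frame x₀ x a)
      (chart E x₀).source := by
  rw [Trivialization.contMDiffOn_section_iff (trivializationAt E (TangentSpace 𝓘(ℝ, E)) x₀)
    (isOpen_source x₀) fun x hx ↦ mem_baseSet hx]
  refine (contMDiffOn_const (c := a)).congr fun x hx ↦ ?_
  have := coord_frame hx a
  rwa [coord, Trivialization.continuousLinearMapAt_apply,
    Trivialization.linearMapAt_apply, if_pos (mem_baseSet hx)] at this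

variable [RiemannianBundle (fun x : M ↦ TangentSpace 𝓘(ℝ, E) x)] [FiniteDimensional ℝ E]

/-- The Riemannian metric in the chart at `x₀`. -/
def metric (x₀ : M) (z : E) : E →L[ℝ] E →L[ℝ] ℝ :=
  LinearMap.toContinuousBilinearMap (LinearMap.mk₂ ℝ
    (fun a b ↦ inner ℝ (frame x₀ ((chart E x₀).symm z) a) (frame x₀ ((chart E x₀).symm z) b))
    (by intros; simp [inner_add_left]) (by intros; simp [real_inner_smul_left])
    (by intros; simp [inner_add_right]) (by intros; simp [real_inner_smul_right]))

theorem metric_apply (x₀ : M) (z a b : E) : metric x₀ z a b =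
    inner ℝ (frame x₀ ((chart E x₀).symm z) a) (frame x₀ ((chart E x₀).symm z) b) := rfl

theorem metric_chart {x₀ x : M} (hx : x ∈ (chart E x₀).source) (a b : E) :
    metric x₀ (chart E x₀ x) a b = inner ℝ (frame x₀ x a) (frame x₀ x b) := by
  rw [metric_apply, (chart E x₀).left_inv hx]

theorem metric_coord {x₀ x : M} (hx : x ∈ (chart E x₀).source)
    (v w : TangentSpace 𝓘(ℝ, E) x) :
    metric x₀ (chart E x₀ x) (coord x₀ x v) (coord x₀ x w) = inner ℝ v w := by
  rw [metric_chart hx, frame_coord hx, frame_coord hx]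

variable [IsContMDiffRiemannianBundle 𝓘(ℝ, E) ∞ E (fun x : M ↦ TangentSpace 𝓘(ℝ, E) x)]

theorem isMetricOn_metric (x₀ : M) : IsMetricOn (metric x₀) (chart E x₀).target where
  isOpen := isOpen_target x₀
  contDiffOn := by
    refine contDiffOn_clm_apply.2 fun a ↦ contDiffOn_clm_apply.2 fun b ↦ ?_
    rw [← contMDiffOn_iff_contDiffOn]
    have := ContMDiffOn.inner_bundle (E := fun x : M ↦ TangentSpace 𝓘(ℝ, E) x)
      (contMDiffOn_frame x₀ a) (contMDiffOn_frame x₀ b)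
    exact this.comp (contMDiffOn_extChartAt_symm x₀) fun z hz ↦ (chart E x₀).map_target hz
  symm z _ a b := by rw [metric_apply, metric_apply, real_inner_comm]
  pos z hz a ha := by
    rw [metric_apply, real_inner_self_eq_norm_sq]
    have : frame x₀ ((chart E x₀).symm z) a ≠ 0 := fun h ↦ ha (by
      rw [← coord_frame ((chart E x₀).map_target hz) a, h, map_zero])
    positivity

/-- The change of coordinates from the chart at `x₀` to the chart at `x₁`. -/
def transition (x₀ x₁ : M) (z : E) : E := chart E x₁ ((chart E x₀).symm z)

theorem contDiffAt_transition {x₀ x₁ : M} {z : E} (hz : z ∈ (chart E x₀).target)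
    (hz' : (chart E x₀).symm z ∈ (chart E x₁).source) :
    ContDiffAt ℝ ∞ (transition x₀ x₁) z := by
  rw [← contMDiffAt_iff_contDiffAt]
  exact (contMDiffAt_chart hz').comp z (contMDiffAt_chart_symm hz)

theorem hasFDerivAt_transition {x₀ x₁ : M} {z : E} (hz : z ∈ (chart E x₀).target)
    (hz' : (chart E x₀).symm z ∈ (chart E x₁).source) :
    HasFDerivAt (transition x₀ x₁)
      (coord x₁ ((chart E x₀).symm z) ∘L frame x₀ ((chart E x₀).symm z)) z := by
  have := (hasMFDerivAt_chart hz').comp z (hasMFDerivAt_chart_symm hz)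
  exact this.hasFDerivAt

/-- Both sides are the inner product of the same tangent vectors, written in two charts: transition
maps are isometries of the coordinate metrics. -/
theorem metric_transition {x₀ x₁ : M} {z : E} (hz : z ∈ (chart E x₀).target)
    (hz' : (chart E x₀).symm z ∈ (chart E x₁).source) (a b : E) :
    metric x₁ (transition x₀ x₁ z) (fderiv ℝ (transition x₀ x₁) z a)
      (fderiv ℝ (transition x₀ x₁) z b) = metric x₀ z a b := by
  rw [(hasFDerivAt_transition hz hz').fderiv]
  exact metric_coord hz' _ _

end ChartCoordinates

/-! ### Pointwise comparison of the metric with the norm of `E` -/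

namespace LocalMetric

open Set Filter Topology

variable {E : Type*} [NormedAddCommGroup E] [NormedSpace ℝ E] [FiniteDimensional ℝ E]
  {g : E → E →L[ℝ] E →L[ℝ] ℝ} {U : Set E} {z : E}

/-- The minimum of the quadratic form on the compact unit sphere, extended by homogeneity. The
sphere is empty when `E` is trivial. -/
theorem IsMetricOn.exists_pos_le (hg : IsMetricOn g U) (hz : z ∈ U) :
    ∃ c, 0 < c ∧ ∀ a, c * ‖a‖ ^ 2 ≤ g z a a := by
  have : ProperSpace E := FiniteDimensional.proper ℝ E
  have hc : ContinuousOn (fun a ↦ g z a a) (Metric.sphere (0 : E) 1) :=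
    (((g z).continuous).clm_apply continuous_id).continuousOn
  have key : ∃ c, 0 < c ∧ ∀ a ∈ Metric.sphere (0 : E) 1, c ≤ g z a a := by
    rcases (Metric.sphere (0 : E) 1).eq_empty_or_nonempty with he | hne
    · exact ⟨1, one_pos, by simp [he]⟩
    · obtain ⟨a, ha, hmin⟩ := (isCompact_sphere (0 : E) 1).exists_isMinOn hne hc
      refine ⟨g z a a, hg.pos z hz a ?_, fun b hb ↦ hmin hb⟩
      rintro rfl
      simp at ha
  obtain ⟨c, hc0, hc⟩ := key
  refine ⟨c, hc0, fun a ↦ ?_⟩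
  rcases eq_or_ne a 0 with rfl | ha
  · simp
  have hn : ‖a‖ ≠ 0 := norm_ne_zero_iff.2 ha
  have := hc (‖a‖⁻¹ • a) (by simp [norm_smul, hn])
  simp only [map_smul, smul_apply, smul_eq_mul] at this
  have h2 : ‖a‖ ^ 2 * c ≤ ‖a‖ ^ 2 * (‖a‖⁻¹ * (‖a‖⁻¹ * g z a a)) := by gcongr
  have h3 : ‖a‖ ^ 2 * (‖a‖⁻¹ * (‖a‖⁻¹ * g z a a)) = g z a a := by field_simp
  linarith

theorem apply_self_le_add (A B : E →L[ℝ] E →L[ℝ] ℝ) {κ : ℝ} (h : ‖A - B‖ ≤ κ) (a : E) :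
    A a a ≤ B a a + κ * ‖a‖ ^ 2 := by
  have h1 : (A - B) a a ≤ ‖A - B‖ * ‖a‖ * ‖a‖ := (le_abs_self _).trans ((A - B).le_opNorm₂ a a)
  have h2 : ‖A - B‖ * ‖a‖ * ‖a‖ ≤ κ * ‖a‖ * ‖a‖ := by gcongr
  simp only [sub_apply] at h1
  nlinarith

end LocalMetric

/-! ### Riemannian distance and coordinate metric near a point -/

namespace ChartCoordinates

open Set Filter Topology LocalMetric Manifold MeasureTheory

variable {E : Type*} [NormedAddCommGroup E] [NormedSpace ℝ E] [FiniteDimensional ℝ E]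
  {M : Type*} [MetricSpace M] [ChartedSpace E M] [IsManifold 𝓘(ℝ, E) ∞ M]
  [RiemannianBundle (fun x : M ↦ TangentSpace 𝓘(ℝ, E) x)]
  [IsContMDiffRiemannianBundle 𝓘(ℝ, E) ∞ E (fun x : M ↦ TangentSpace 𝓘(ℝ, E) x)]

theorem norm_frame_sq (x₀ : M) (z a : E) :
    ‖frame x₀ ((chart E x₀).symm z) a‖ ^ 2 = metric x₀ z a a := by
  rw [metric_apply, real_inner_self_eq_norm_sq]

variable [IsRiemannianManifold 𝓘(ℝ, E) M]

/-- Near a point, the distance is at most the length of the segment in a chart. -/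
theorem eventually_dist_sq_le {x₀ : M} {z : E} (hz : z ∈ (chart E x₀).target) {ε : ℝ}
    (hε : 0 < ε) : ∀ᶠ p : E × E in 𝓝 (z, z),
      dist ((chart E x₀).symm p.1) ((chart E x₀).symm p.2) ^ 2 ≤
        metric x₀ z (p.2 - p.1) (p.2 - p.1) + ε * ‖p.2 - p.1‖ ^ 2 := by
  have hg := isMetricOn_metric (E := E) x₀
  have h1 : ∀ᶠ y in 𝓝 z, y ∈ (chart E x₀).target ∧ ‖metric x₀ y - metric x₀ z‖ < ε := by
    refine ((isOpen_target x₀).eventually_mem hz).and ?_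
    have := (hg.contDiffAt hz).continuousAt.eventually (Metric.ball_mem_nhds _ hε)
    simpa only [Metric.mem_ball, dist_eq_norm] using this
  obtain ⟨r, hr, hball⟩ := Metric.eventually_nhds_iff_ball.1 h1
  have h2 : ∀ᶠ p : E × E in 𝓝 (z, z), p.1 ∈ Metric.ball z r ∧ p.2 ∈ Metric.ball z r :=
    (Metric.isOpen_ball.eventually_mem (Metric.mem_ball_self hr)).prod_nhds
      (Metric.isOpen_ball.eventually_mem (Metric.mem_ball_self hr))
  filter_upwards [h2] with p hp
  set δ := p.2 - p.1 with hδ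
  set η : ℝ → E := fun t ↦ p.1 + t • δ with hη
  have hηb : ∀ t ∈ Icc (0 : ℝ) 1, η t ∈ Metric.ball z r := fun t ht ↦
    (convex_ball z r).add_smul_sub_mem hp.1 hp.2 ht
  have hηd : ∀ t, HasMFDerivAt 𝓘(ℝ, ℝ) 𝓘(ℝ, E) η t (ContinuousLinearMap.toSpanSingleton ℝ δ) :=
    fun t ↦ by
      have : HasDerivAt η δ t := by
        simpa only [one_smul, id] using ((hasDerivAt_id t).smul_const δ).const_add p.1
      exact this.hasFDerivAt.hasMFDerivAt
  -- The image of the coordinate segment is a competitor for the Riemannian distance, and its speed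
  -- is computed by a metric close to the one at `z`.
  set γ : ℝ → M := fun t ↦ (chart E x₀).symm (η t) with hγ
  have hγd : ∀ t ∈ Icc (0 : ℝ) 1, mfderiv 𝓘(ℝ, ℝ) 𝓘(ℝ, E) γ t 1 = frame x₀ (γ t) δ := by
    intro t ht
    have := ((hasMFDerivAt_chart_symm (hball _ (hηb t ht)).1).comp t (hηd t)).mfderiv
    change mfderiv 𝓘(ℝ, ℝ) 𝓘(ℝ, E) ((chart E x₀).symm ∘ η) t 1 = _
    rw [this]
    have e : (ContinuousLinearMap.toSpanSingleton ℝ δ) (1 : ℝ) = δ := by simp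
    exact congrArg (frame (E := E) x₀ (γ t)) e
  have hγs : ContMDiffOn 𝓘(ℝ, ℝ) 𝓘(ℝ, E) 1 γ (Icc 0 1) := by
    intro t ht
    have h3 : ContMDiffAt 𝓘(ℝ, ℝ) 𝓘(ℝ, E) 1 η t := by
      rw [contMDiffAt_iff_contDiffAt]
      exact (contDiff_const.add (contDiff_id.smul contDiff_const)).contDiffAt
    exact (((contMDiffAt_chart_symm (hball _ (hηb t ht)).1).of_le (by simp)).comp t
      h3).contMDiffWithinAt
  have hle := riemannianEDist_le_pathELength (I := 𝓘(ℝ, E)) hγs (x := (chart E x₀).symm p.1)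
    (y := (chart E x₀).symm p.2) (by simp [hγ, hη]) (by simp [hγ, hη, hδ]) zero_le_one
  rw [← IsRiemannianManifold.out, pathELength_eq_lintegral_mfderiv_Icc] at hle
  set c := Real.sqrt (metric x₀ z δ δ + ε * ‖δ‖ ^ 2) with hc
  have hnn : 0 ≤ metric x₀ z δ δ + ε * ‖δ‖ ^ 2 := by
    have := hg.nonneg hz δ
    positivity
  have hb : ∫⁻ t in Icc (0 : ℝ) 1, ‖mfderiv 𝓘(ℝ, ℝ) 𝓘(ℝ, E) γ t 1‖ₑ ≤ ENNReal.ofReal c := by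
    have : ∫⁻ t in Icc (0 : ℝ) 1, ‖mfderiv 𝓘(ℝ, ℝ) 𝓘(ℝ, E) γ t 1‖ₑ ≤
        ∫⁻ t in Icc (0 : ℝ) 1, ENNReal.ofReal c := by
      refine setLIntegral_mono' measurableSet_Icc fun t ht ↦ ?_
      rw [hγd t ht, ← ofReal_norm]
      refine ENNReal.ofReal_le_ofReal (Real.le_sqrt_of_sq_le ?_)
      rw [norm_frame_sq]
      exact apply_self_le_add _ _ (hball _ (hηb t ht)).2.le δ
    simpa using this
  have h4 := hle.trans hb
  rw [edist_dist, ENNReal.ofReal_le_ofReal_iff (Real.sqrt_nonneg _)] at h4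
  calc dist ((chart E x₀).symm p.1) ((chart E x₀).symm p.2) ^ 2 ≤ c ^ 2 := by gcongr
    _ = _ := Real.sq_sqrt hnn

/-- Near a point, the length of the segment in a chart is at most a multiple of the distance. -/
theorem eventually_norm_frame_le {x₀ : M} {z : E} (hz : z ∈ (chart E x₀).target) {ε : ℝ}
    (hε : 0 < ε) : ∀ᶠ p : E × E in 𝓝 (z, z),
      ‖frame x₀ ((chart E x₀).symm z) (p.2 - p.1)‖ ≤
        (1 + ε) * dist ((chart E x₀).symm p.1) ((chart E x₀).symm p.2) := by
  have hg := isMetricOn_metric (E := E) x₀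
  obtain ⟨c, hc0, hc⟩ := hg.exists_pos_le hz
  -- If the metric changes by less than `κ`, the quadratic form at `z` is at most `(1 + ε)²` times
  -- the nearby one.
  set κ := c * (1 - 1 / (1 + ε) ^ 2) with hκ
  have hε2 : 1 < (1 + ε) ^ 2 := by nlinarith
  have hκ0 : 0 < κ := by
    have : 1 / (1 + ε) ^ 2 < 1 := by rw [div_lt_one (by positivity)]; exact hε2
    have : 0 < 1 - 1 / (1 + ε) ^ 2 := by linarith
    positivity
  have h1 : ∀ᶠ y in 𝓝 z, y ∈ (chart E x₀).target ∧ ‖metric x₀ y - metric x₀ z‖ < κ := by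
    refine ((isOpen_target x₀).eventually_mem hz).and ?_
    have := (hg.contDiffAt hz).continuousAt.eventually (Metric.ball_mem_nhds _ hκ0)
    simpa only [Metric.mem_ball, dist_eq_norm] using this
  have hψc : ContinuousAt (chart E x₀).symm z := (contMDiffAt_chart_symm hz).continuousAt
  have hxs : (chart E x₀).symm z ∈ (chart E x₀).source := (chart E x₀).map_target hz
  have hS : ∀ᶠ x in 𝓝 ((chart E x₀).symm z), x ∈ (chart E x₀).source ∧
      ‖metric x₀ (chart E x₀ x) - metric x₀ z‖ < κ := by
    refine ((isOpen_source x₀).eventually_mem hxs).and ?_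
    have hcont : Tendsto (chart E x₀) (𝓝 ((chart E x₀).symm z)) (𝓝 z) := by
      have := (contMDiffAt_chart (E := E) hxs).continuousAt
      rwa [ContinuousAt, (chart E x₀).right_inv hz] at this
    filter_upwards [hcont h1] with x hx using hx.2
  obtain ⟨ρ, hρ, hball⟩ := Metric.eventually_nhds_iff_ball.1 hS
  -- With both points within `ρ / 3` of the centre, any curve between them shorter than `2ρ / 3`
  -- stays in the ball of radius `ρ`, hence in the chart.
  have h2 : ∀ᶠ y in 𝓝 z, y ∈ (chart E x₀).target ∧
      dist ((chart E x₀).symm y) ((chart E x₀).symm z) < ρ / 3 :=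
    ((isOpen_target x₀).eventually_mem hz).and
      (hψc.eventually (Metric.ball_mem_nhds _ (by positivity : 0 < ρ / 3)))
  have h3 : ∀ᶠ p : E × E in 𝓝 (z, z), (p.1 ∈ (chart E x₀).target ∧
      dist ((chart E x₀).symm p.1) ((chart E x₀).symm z) < ρ / 3) ∧
      (p.2 ∈ (chart E x₀).target ∧ dist ((chart E x₀).symm p.2) ((chart E x₀).symm z) < ρ / 3) :=
    h2.prod_nhds h2
  filter_upwards [h3] with p hp
  set δ := p.2 - p.1 with hδ
  set x := (chart E x₀).symm z with hx
  set y₁ := (chart E x₀).symm p.1 with hy₁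
  set y₂ := (chart E x₀).symm p.2 with hy₂
  have hd : dist y₁ y₂ < 2 * ρ / 3 := by
    have := dist_triangle_right y₁ y₂ x
    linarith [hp.1.2, hp.2.2]
  have hframe : ∀ y ∈ Metric.ball x ρ, ∀ w : TangentSpace 𝓘(ℝ, E) y,
      ‖frame x₀ x (coord x₀ y w)‖ ≤ (1 + ε) * ‖w‖ := by
    intro y hy w
    obtain ⟨hys, hyκ⟩ := hball y hy
    refine le_of_sq_le_sq ?_ (by positivity)
    rw [norm_frame_sq, mul_pow, ← real_inner_self_eq_norm_sq w, ← metric_coord hys]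
    set a := coord x₀ y w
    have e1 := apply_self_le_add (metric x₀ z) (metric x₀ (chart E x₀ y))
      (κ := κ) (by rw [norm_sub_rev]; exact hyκ.le) a
    have e2 := hc a
    have e3 : κ * ‖a‖ ^ 2 ≤ (1 - 1 / (1 + ε) ^ 2) * metric x₀ z a a := by
      have : 0 ≤ 1 - 1 / (1 + ε) ^ 2 := by
        by_contra hcon
        have : κ < 0 := mul_neg_of_pos_of_neg hc0 (not_le.1 hcon)
        linarith
      calc κ * ‖a‖ ^ 2 = (1 - 1 / (1 + ε) ^ 2) * (c * ‖a‖ ^ 2) := by rw [hκ]; ring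
        _ ≤ _ := by gcongr
    have e4 : 1 / (1 + ε) ^ 2 * metric x₀ z a a ≤ metric x₀ (chart E x₀ y) a a := by linarith
    rw [div_mul_eq_mul_div, one_mul, div_le_iff₀ (by positivity)] at e4
    linarith
  refine le_of_forall_gt_imp_ge_of_dense fun b hb ↦ ?_
  obtain ⟨L, hL1, hL2⟩ : ∃ L, dist y₁ y₂ < L ∧ L < min (2 * ρ / 3) (b / (1 + ε)) := by
    refine exists_between (lt_min hd ?_)
    rw [lt_div_iff₀ (by positivity)]
    linarith
  have hLρ := hL2.trans_le (min_le_left _ _)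
  have hLb := hL2.trans_le (min_le_right _ _)
  rw [lt_div_iff₀ (by positivity)] at hLb
  have hL0 : 0 < L := dist_nonneg.trans_lt hL1
  have hr : riemannianEDist 𝓘(ℝ, E) y₁ y₂ < ENNReal.ofReal L := by
    rw [← IsRiemannianManifold.out, edist_dist]
    exact (ENNReal.ofReal_lt_ofReal_iff hL0).2 hL1
  obtain ⟨γ, hγ0, hγ1, hγs, hγL, -⟩ :=
    exists_lt_locally_constant_of_riemannianEDist_lt hr zero_lt_one
  have hγball : ∀ t ∈ Icc (0 : ℝ) 1, γ t ∈ Metric.ball x ρ := by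
    intro t ht
    have e1 := riemannianEDist_le_pathELength (I := 𝓘(ℝ, E)) (hγs.contMDiffOn (s := Icc 0 t))
      hγ0 rfl ht.1
    have e2 := (e1.trans (pathELength_mono le_rfl ht.2)).trans_lt hγL
    rw [← IsRiemannianManifold.out, edist_dist, ENNReal.ofReal_lt_ofReal_iff hL0] at e2
    have := dist_triangle_left (γ t) x y₁
    rw [Metric.mem_ball]
    linarith [hp.1.2]
  -- The linear functional `g_z(δ, ·)` calibrates: it grows by `|δ|²` along the curve, while by
  -- Cauchy–Schwarz its derivative is at most `|δ| (1 + ε)` times the speed.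
  set f : ℝ → ℝ := fun t ↦ metric x₀ z δ (chart E x₀ (γ t)) with hf
  have hηs : ContDiffOn ℝ 1 (fun t ↦ chart E x₀ (γ t)) (Icc 0 1) := by
    rw [← contMDiffOn_iff_contDiffOn]
    intro t ht
    exact (((contMDiffAt_chart (hball _ (hγball t ht)).1).of_le (by simp)).comp t
      (hγs t)).contMDiffWithinAt
  have hfs : ContDiffOn ℝ 1 f (Icc 0 1) := (metric x₀ z δ).contDiff.comp_contDiffOn hηs
  have hfd : ∀ t ∈ Icc (0 : ℝ) 1, derivWithin f (Icc 0 1) t =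
      metric x₀ z δ (coord x₀ (γ t) (mfderiv 𝓘(ℝ, ℝ) 𝓘(ℝ, E) γ t 1)) := by
    intro t ht
    have e1 := ((hasMFDerivAt_chart (E := E) (hball _ (hγball t ht)).1).comp t
      (hγs.mdifferentiable one_ne_zero t).hasMFDerivAt).hasFDerivAt
    have e2 := ((metric x₀ z δ).hasFDerivAt.comp t e1).hasDerivAt
    exact e2.hasDerivWithinAt.derivWithin (uniqueDiffOn_Icc zero_lt_one t ht)
  have hintble := enorm_sub_le_lintegral_derivWithin_Icc_of_contDiffOn_Icc hfs zero_le_one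
  set N := ‖frame x₀ x δ‖ with hN
  have hf10 : f 1 - f 0 = N ^ 2 := by
    rw [hN, norm_frame_sq]
    simp only [hf, hγ0, hγ1, hy₁, hy₂, (chart E x₀).right_inv hp.1.1,
      (chart E x₀).right_inv hp.2.1]
    rw [← map_sub]
  have hbound : ∫⁻ t in Icc (0 : ℝ) 1, ‖derivWithin f (Icc 0 1) t‖ₑ ≤
      ENNReal.ofReal (N * (1 + ε)) * pathELength 𝓘(ℝ, E) γ 0 1 := by
    rw [pathELength_eq_lintegral_mfderiv_Icc, ← lintegral_const_mul' _ _ ENNReal.ofReal_ne_top]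
    refine setLIntegral_mono' measurableSet_Icc fun t ht ↦ ?_
    rw [hfd t ht, ← ofReal_norm, ← ofReal_norm,
      ← ENNReal.ofReal_mul (by positivity)]
    refine ENNReal.ofReal_le_ofReal ?_
    rw [metric_apply, Real.norm_eq_abs]
    refine (abs_real_inner_le_norm _ _).trans ?_
    rw [mul_assoc]
    gcongr
    exact hframe _ (hγball t ht) _
  have hfin : ENNReal.ofReal (N ^ 2) ≤ ENNReal.ofReal (N * (1 + ε) * L) := by
    rw [ENNReal.ofReal_mul (by positivity)]
    calc ENNReal.ofReal (N ^ 2) = ‖f 1 - f 0‖ₑ := by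
          rw [hf10, Real.enorm_eq_ofReal (by positivity)]
      _ ≤ _ := hintble
      _ ≤ _ := hbound
      _ ≤ _ := by gcongr
  rw [ENNReal.ofReal_le_ofReal_iff (by positivity)] at hfin
  have hN0 : 0 ≤ N := norm_nonneg _
  rcases hN0.eq_or_lt with h0 | h0
  · rw [← h0]; nlinarith
  · have : N ≤ (1 + ε) * L := by
      refine le_of_mul_le_mul_left ?_ h0
      nlinarith
    linarith

end ChartCoordinates

/-! ### Bi-Lipschitz charts, energy and distance -/

namespace ChartCoordinates

open Set Filter Topology LocalMetric Manifold MeasureTheory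
open scoped NNReal

variable {E : Type*} [NormedAddCommGroup E] [NormedSpace ℝ E] [FiniteDimensional ℝ E]
  {M : Type*} [MetricSpace M] [ChartedSpace E M] [IsManifold 𝓘(ℝ, E) ∞ M]
  [RiemannianBundle (fun x : M ↦ TangentSpace 𝓘(ℝ, E) x)]
  [IsContMDiffRiemannianBundle 𝓘(ℝ, E) ∞ E (fun x : M ↦ TangentSpace 𝓘(ℝ, E) x)]
  [IsRiemannianManifold 𝓘(ℝ, E) M]

/-- Charts are locally Lipschitz in both directions. -/
theorem exists_ball_dist_comparable {x₀ : M} {z : E} (hz : z ∈ (chart E x₀).target) :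
    ∃ r > 0, ∃ C : ℝ≥0, Metric.ball z r ⊆ (chart E x₀).target ∧
      ∀ y ∈ Metric.ball z r, ∀ y' ∈ Metric.ball z r,
        dist ((chart E x₀).symm y) ((chart E x₀).symm y') ≤ C * dist y y' ∧
        dist y y' ≤ C * dist ((chart E x₀).symm y) ((chart E x₀).symm y') := by
  have hg := isMetricOn_metric (E := E) x₀
  obtain ⟨c, hc0, hc⟩ := hg.exists_pos_le hz
  have h := (((isOpen_target x₀).eventually_mem hz).prod_nhds
    ((isOpen_target x₀).eventually_mem hz)).and
    ((eventually_dist_sq_le hz one_pos).and (eventually_norm_frame_le hz one_pos))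
  obtain ⟨r, hr, hball⟩ := Metric.eventually_nhds_iff_ball.1 h
  have hS : ∀ y ∈ Metric.ball z r, ∀ y' ∈ Metric.ball z r, _ := fun y hy y' hy' ↦
    hball (y, y') (by rw [Metric.mem_ball, Prod.dist_eq]; exact max_lt hy hy')
  set C : ℝ := Real.sqrt (‖metric x₀ z‖ + 1) + Real.sqrt (4 / c) with hC
  have hCn : 0 ≤ C := by positivity
  refine ⟨r, hr, C.toNNReal, fun y hy ↦ (hS y hy y hy).1.1, ?_⟩
  intro y hy y' hy'
  rw [Real.coe_toNNReal C hCn]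
  obtain ⟨-, h1, h2⟩ := hS y hy y' hy'
  simp only at h1 h2
  rw [← dist_eq_norm, dist_comm y' y] at h1
  set d := dist ((chart E x₀).symm y) ((chart E x₀).symm y') with hd
  constructor
  · have e1 : d ^ 2 ≤ (‖metric x₀ z‖ + 1) * dist y y' ^ 2 := by
      have : metric x₀ z (y' - y) (y' - y) ≤ ‖metric x₀ z‖ * dist y y' ^ 2 := by
        rw [dist_comm, dist_eq_norm, sq, ← mul_assoc]
        exact (le_abs_self _).trans ((metric x₀ z).le_opNorm₂ _ _)
      linarith
    have e2 : d ≤ Real.sqrt (‖metric x₀ z‖ + 1) * dist y y' := by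
      refine le_of_sq_le_sq ?_ (by positivity)
      rwa [mul_pow, Real.sq_sqrt (by positivity)]
    refine e2.trans ?_
    gcongr
    exact le_add_of_nonneg_right (Real.sqrt_nonneg _)
  · have e1 : c * dist y y' ^ 2 ≤ 4 * d ^ 2 := by
      have e3 := hc (y' - y)
      rw [← norm_frame_sq, ← dist_eq_norm, dist_comm] at e3
      have : ‖frame x₀ ((chart E x₀).symm z) (y' - y)‖ ^ 2 ≤ ((1 + 1) * d) ^ 2 := by gcongr
      nlinarith
    have e2 : dist y y' ≤ Real.sqrt (4 / c) * d := by
      refine le_of_sq_le_sq ?_ (by positivity)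
      rw [mul_pow, Real.sq_sqrt (by positivity), div_mul_eq_mul_div, le_div_iff₀ hc0]
      linarith
    refine e2.trans ?_
    gcongr
    exact le_add_of_nonneg_left (Real.sqrt_nonneg _)

theorem _root_.HasDerivAt.tendsto_div_nhdsGT {F : Type*} [NormedAddCommGroup F]
    [NormedSpace ℝ F] {w : ℝ → F} {w' : F} {t : ℝ} (h : HasDerivAt w w' t) :
    Tendsto (fun s ↦ (s - t)⁻¹ • (w s - w t)) (𝓝[>] t) (𝓝 w') :=
  (hasDerivAt_iff_tendsto_slope.1 h).mono_left (nhdsWithin_mono t fun _ hs ↦ ne_of_gt hs)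

/-- By the triangle inequality the distance from `p` grows no faster than the speed `σ`, and `σ ≤ (1
+ σ²)/2`. Using this form of the bound removes the square root and leads straight to the energy. -/
theorem deriv_dist_le {x₀ : M} {w : ℝ → E} {w' : E} {t : ℝ}
    (hw : HasDerivAt w w' t) (hwt : w t ∈ (chart E x₀).target) (p : M) {f' : ℝ}
    (hf : HasDerivAt (fun s ↦ dist p ((chart E x₀).symm (w s))) f' t) :
    f' ≤ (1 + metric x₀ (w t) w' w') / 2 := by
  refine le_of_forall_pos_le_add fun ε hε ↦ ?_
  obtain ⟨κ, hκ, hκε⟩ : ∃ κ > 0, κ * ‖w'‖ ^ 2 / 2 ≤ ε := by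
    refine ⟨2 * ε / (‖w'‖ ^ 2 + 1), by positivity, ?_⟩
    rw [div_mul_eq_mul_div, div_div, div_le_iff₀ (by positivity)]
    nlinarith [sq_nonneg ‖w'‖]
  set q : ℝ → E := fun s ↦ (s - t)⁻¹ • (w s - w t) with hq
  have hqt : Tendsto q (𝓝[>] t) (𝓝 w') := hw.tendsto_div_nhdsGT
  have hlim : Tendsto (fun s ↦ (1 + (metric x₀ (w t) (q s) (q s) + κ * ‖q s‖ ^ 2)) / 2) (𝓝[>] t)
      (𝓝 ((1 + (metric x₀ (w t) w' w' + κ * ‖w'‖ ^ 2)) / 2)) := by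
    have h1 : Continuous fun a : E ↦ (1 + (metric x₀ (w t) a a + κ * ‖a‖ ^ 2)) / 2 := by
      have : Continuous fun a : E ↦ metric x₀ (w t) a a :=
        ((metric x₀ (w t)).continuous).clm_apply continuous_id
      fun_prop
    exact (h1.tendsto w').comp hqt
  have hle : f' ≤ (1 + (metric x₀ (w t) w' w' + κ * ‖w'‖ ^ 2)) / 2 := by
    refine le_of_tendsto_of_tendsto hf.tendsto_div_nhdsGT hlim ?_
    have hev' := (continuousAt_const.prodMk_nhds hw.continuousAt).eventually
      (f := fun s ↦ (w t, w s)) (eventually_dist_sq_le hwt hκ)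
    filter_upwards [hev'.filter_mono nhdsWithin_le_nhds, self_mem_nhdsWithin] with s hs hst
    have hst' : 0 < s - t := sub_pos.2 hst
    set d := dist ((chart E x₀).symm (w t)) ((chart E x₀).symm (w s)) with hd
    have e1 : dist p ((chart E x₀).symm (w s)) - dist p ((chart E x₀).symm (w t)) ≤ d := by
      have := dist_triangle p ((chart E x₀).symm (w t)) ((chart E x₀).symm (w s))
      linarith
    have hΔ : w s - w t = (s - t) • q s := by
      rw [hq, smul_smul, mul_inv_cancel₀ hst'.ne', one_smul]
    rw [hΔ, norm_smul] at hs
    simp only [map_smul, smul_apply, smul_eq_mul, Real.norm_eq_abs, mul_pow, sq_abs] at hs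
    have e2 : ((s - t)⁻¹ * d) ^ 2 ≤ metric x₀ (w t) (q s) (q s) + κ * ‖q s‖ ^ 2 := by
      rw [mul_pow, inv_pow, inv_mul_le_iff₀ (by positivity)]
      linarith
    have e3 : (s - t)⁻¹ • (dist p ((chart E x₀).symm (w s)) - dist p ((chart E x₀).symm (w t))) ≤
        (s - t)⁻¹ * d := by
      rw [smul_eq_mul]; gcongr
    nlinarith [sq_nonneg ((s - t)⁻¹ * d - 1)]
  linarith

/-- The distance from the starting point along the curve is Lipschitz, hence the integral of its
derivative, to which `deriv_dist_le` applies almost everywhere. -/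
theorem dist_le_energy_of_lipschitzWith {x₀ : M} {z : E} {r : ℝ} {C : ℝ≥0}
    (hr : Metric.ball z r ⊆ (chart E x₀).target)
    (hC : ∀ y ∈ Metric.ball z r, ∀ y' ∈ Metric.ball z r,
        dist ((chart E x₀).symm y) ((chart E x₀).symm y') ≤ C * dist y y')
    {a b : ℝ} (hab : a ≤ b) {w : ℝ → E} {K : ℝ≥0} (hw : LipschitzWith K w)
    (hwr : ∀ t ∈ Icc a b, w t ∈ Metric.ball z r) :
    dist ((chart E x₀).symm (w a)) ((chart E x₀).symm (w b)) ≤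
      ∫ t in a..b, (1 + metric x₀ (w t) (deriv w t) (deriv w t)) / 2 := by
  have hg := isMetricOn_metric (E := E) x₀
  set p := (chart E x₀).symm (w a) with hp
  set f : ℝ → ℝ := fun s ↦ dist p ((chart E x₀).symm (w s)) with hf
  have hfL : LipschitzOnWith (C * K) f (uIcc a b) := by
    rw [uIcc_of_le hab]
    refine LipschitzOnWith.of_dist_le_mul fun s hs t ht ↦ ?_
    calc dist (f s) (f t) ≤ dist ((chart E x₀).symm (w s)) ((chart E x₀).symm (w t)) :=
          dist_dist_dist_le_right _ _ _
      _ ≤ C * dist (w s) (w t) := hC _ (hwr s hs) _ (hwr t ht)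
      _ ≤ C * (K * dist s t) := by gcongr; exact hw.dist_le_mul s t
      _ = _ := by push_cast; ring
  have hac := hfL.absolutelyContinuousOnInterval
  have hfint := hac.integral_deriv_eq_sub
  have hintble := hg.intervalIntegrable_energy hab hw fun t ht ↦ hr (hwr t ht)
  have hfa : f a = 0 := by simp [hf, hp]
  change f b ≤ _
  rw [← sub_zero (f b), ← hfa, ← hfint]
  refine intervalIntegral.integral_mono_ae_restrict hab hac.intervalIntegrable_deriv
    ((intervalIntegrable_const.add hintble).div_const 2) ?_
  rw [EventuallyLE, ae_restrict_iff' measurableSet_Icc]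
  filter_upwards [hac.ae_differentiableAt, hw.ae_differentiableAt_real] with t h1 h2 ht
  exact deriv_dist_le h2.hasDerivAt (hr (hwr t ht)) p
    (h1 (by rwa [uIcc_of_le hab])).hasDerivAt

/-- Freezing a curve outside `[a, b]` makes it globally Lipschitz, as the variational lemmas
require. -/
theorem lipschitzWith_comp_projIcc {a b : ℝ} (hab : a ≤ b) {w : ℝ → E} {K : ℝ≥0}
    (hw : LipschitzOnWith K w (Icc a b)) : LipschitzWith K fun t ↦ w (projIcc a b hab t) := by
  refine LipschitzWith.of_dist_le_mul fun s t ↦ ?_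
  refine (hw.dist_le_mul _ (projIcc a b hab s).2 _ (projIcc a b hab t).2).trans ?_
  gcongr
  have := (LipschitzWith.projIcc hab).dist_le_mul s t
  rwa [NNReal.coe_one, one_mul] at this

theorem deriv_comp_projIcc {a b : ℝ} (hab : a ≤ b) {w : ℝ → E} {t : ℝ} (ht : t ∈ Ioo a b) :
    deriv (fun t ↦ w (projIcc a b hab t)) t = deriv w t := by
  refine Filter.EventuallyEq.deriv_eq ?_
  filter_upwards [Icc_mem_nhds ht.1 ht.2] with s hs
  rw [projIcc_of_mem hab hs]

/-- The distance between the end points of a Lipschitz curve in a chart is at most its energy. -/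
theorem dist_le_energy {x₀ : M} {z : E} {r : ℝ} {C : ℝ≥0}
    (hr : Metric.ball z r ⊆ (chart E x₀).target)
    (hC : ∀ y ∈ Metric.ball z r, ∀ y' ∈ Metric.ball z r,
        dist ((chart E x₀).symm y) ((chart E x₀).symm y') ≤ C * dist y y')
    {a b : ℝ} (hab : a ≤ b) {w : ℝ → E} {K : ℝ≥0} (hw : LipschitzOnWith K w (Icc a b))
    (hwr : ∀ t ∈ Icc a b, w t ∈ Metric.ball z r) :
    dist ((chart E x₀).symm (w a)) ((chart E x₀).symm (w b)) ≤
      ∫ t in a..b, (1 + metric x₀ (w t) (deriv w t) (deriv w t)) / 2 := by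
  have h := dist_le_energy_of_lipschitzWith hr hC hab (lipschitzWith_comp_projIcc hab hw)
    fun t _ ↦ hwr _ (projIcc a b hab t).2
  simp only [projIcc_left, projIcc_right] at h
  refine h.trans_eq (intervalIntegral.integral_congr_ae ?_)
  filter_upwards [compl_mem_ae_iff.2 (measure_singleton b)] with t hne ht
  rw [uIoc_of_le hab] at ht
  have ht' : t ∈ Ioo a b := ⟨ht.1, lt_of_le_of_ne ht.2 hne⟩
  rw [deriv_comp_projIcc hab ht', projIcc_of_mem hab (Ioo_subset_Icc_self ht')]

/-- By `eventually_norm_frame_le` the difference quotients of a 1-Lipschitz curve have length at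
most `1 + ε`; pass to the limit. Right-hand quotients suffice. -/
theorem metric_deriv_le_one {x₀ : M} {u : ℝ → E} {u' : E} {t : ℝ}
    (hu : HasDerivAt u u' t) (hut : u t ∈ (chart E x₀).target)
    (hiso : ∀ᶠ s in 𝓝[>] t, dist ((chart E x₀).symm (u t)) ((chart E x₀).symm (u s)) ≤ s - t) :
    metric x₀ (u t) u' u' ≤ 1 := by
  set q : ℝ → E := fun s ↦ (s - t)⁻¹ • (u s - u t) with hq
  have hqt : Tendsto q (𝓝[>] t) (𝓝 u') := hu.tendsto_div_nhdsGT
  have hlim : Tendsto (fun s ↦ metric x₀ (u t) (q s) (q s)) (𝓝[>] t) (𝓝 (metric x₀ (u t) u' u')) := by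
    have : Continuous fun a : E ↦ metric x₀ (u t) a a :=
      ((metric x₀ (u t)).continuous).clm_apply continuous_id
    exact (this.tendsto u').comp hqt
  have hle : ∀ ε > 0, metric x₀ (u t) u' u' ≤ (1 + ε) ^ 2 := by
    intro ε hε
    refine le_of_tendsto hlim ?_
    have hev := (continuousAt_const.prodMk_nhds hu.continuousAt).eventually
      (f := fun s ↦ (u t, u s)) (eventually_norm_frame_le hut hε)
    filter_upwards [hev.filter_mono nhdsWithin_le_nhds, self_mem_nhdsWithin, hiso] with s hs hst hi
    have hst' : 0 < s - t := sub_pos.2 hst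
    rw [← norm_frame_sq]
    have e1 : ‖frame x₀ ((chart E x₀).symm (u t)) (q s)‖ ≤ 1 + ε := by
      rw [hq, map_smul, norm_smul, norm_inv, Real.norm_eq_abs, abs_of_pos hst',
        inv_mul_le_iff₀ hst', mul_comm]
      exact hs.trans (by gcongr)
    gcongr
  have hcont : Tendsto (fun ε : ℝ ↦ (1 + ε) ^ 2) (𝓝[>] 0) (𝓝 1) := by
    have : Continuous fun ε : ℝ ↦ (1 + ε) ^ 2 := by fun_prop
    simpa using (this.tendsto 0).mono_left nhdsWithin_le_nhds
  exact ge_of_tendsto hcont (by filter_upwards [self_mem_nhdsWithin] with ε hε using hle ε hε)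

/-- A minimizing curve in a chart is a geodesic of unit speed. -/
theorem exists_velocity {x₀ : M} {z : E} {r : ℝ} {C : ℝ≥0}
    (hr : Metric.ball z r ⊆ (chart E x₀).target)
    (hC : ∀ y ∈ Metric.ball z r, ∀ y' ∈ Metric.ball z r,
        dist ((chart E x₀).symm y) ((chart E x₀).symm y') ≤ C * dist y y' ∧
        dist y y' ≤ C * dist ((chart E x₀).symm y) ((chart E x₀).symm y'))
    {a b : ℝ} (hab : a < b) {γ : ℝ → M}
    (hγ : ∀ s ∈ Icc a b, ∀ t ∈ Icc a b, dist (γ s) (γ t) = |s - t|)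
    (hγs : ∀ t ∈ Icc a b, γ t ∈ (chart E x₀).source)
    (hγr : ∀ t ∈ Icc a b, chart E x₀ (γ t) ∈ Metric.ball z r) :
    ∃ v : ℝ → E, ∀ t ∈ Icc a b,
      HasDerivWithinAt (fun t ↦ chart E x₀ (γ t)) (v t) (Icc a b) t ∧
      HasDerivWithinAt v (-christoffel (metric x₀) (chart E x₀ (γ t)) (v t) (v t)) (Icc a b) t ∧
      metric x₀ (chart E x₀ (γ t)) (v t) (v t) = 1 := by
  have hg := (isMetricOn_metric (E := E) x₀).mono (Metric.isOpen_ball (x := z) (ε := r)) hr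
  set u : ℝ → E := fun t ↦ chart E x₀ (γ t) with hu
  have hψ : ∀ t ∈ Icc a b, (chart E x₀).symm (u t) = γ t := fun t ht ↦
    (chart E x₀).left_inv (hγs t ht)
  have huL : LipschitzOnWith C u (Icc a b) := by
    refine LipschitzOnWith.of_dist_le_mul fun s hs t ht ↦ ?_
    refine (hC _ (hγr s hs) _ (hγr t ht)).2.trans_eq ?_
    rw [hψ s hs, hψ t ht, hγ s hs t ht, Real.dist_eq]
  set ũ : ℝ → E := fun t ↦ u (projIcc a b hab.le t) with hũ
  have hũL : LipschitzWith C ũ := lipschitzWith_comp_projIcc hab.le huL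
  have hũu : ∀ t ∈ Icc a b, ũ t = u t := fun t ht ↦ by rw [hũ]; simp only [projIcc_of_mem hab.le ht]
  have hcomp : IsCompact (u '' Icc a b) := isCompact_Icc.image_of_continuousOn huL.continuousOn
  have hspeed : ∀ᵐ t, t ∈ Icc a b → metric x₀ (ũ t) (deriv ũ t) (deriv ũ t) ≤ 1 := by
    filter_upwards [hũL.ae_differentiableAt_real, compl_mem_ae_iff.2 (measure_singleton b)] with
      t h1 hne ht
    have htb : t < b := lt_of_le_of_ne ht.2 hne
    have hmem : ũ t ∈ (chart E x₀).target := by rw [hũu t ht]; exact hr (hγr t ht)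
    refine metric_deriv_le_one h1.hasDerivAt hmem ?_
    filter_upwards [Ioo_mem_nhdsGT htb] with s hs
    have hs' : s ∈ Icc a b := ⟨ht.1.trans hs.1.le, hs.2.le⟩
    rw [hũu t ht, hũu s hs', hψ t ht, hψ s hs', hγ t ht s hs', abs_sub_comm,
      abs_of_pos (sub_pos.2 hs.1)]
  -- The energy of a competitor bounds the distance of its end points, which is `b - a` because `γ`
  -- is an isometric embedding of the interval.
  have hmin : ∀ (w : ℝ → E) (K' : ℝ≥0), LipschitzWith K' w → w a = ũ a → w b = ũ b →
      (∀ t ∈ Icc a b, w t ∈ Metric.ball z r) →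
      b - a ≤ ∫ t in a..b, (1 + metric x₀ (w t) (deriv w t) (deriv w t)) / 2 := by
    intro w K' hw hwa hwb hwU
    have := dist_le_energy_of_lipschitzWith hr (fun y hy y' hy' ↦ (hC y hy y' hy').1) hab.le hw hwU
    have ha := left_mem_Icc.2 hab.le
    have hb := right_mem_Icc.2 hab.le
    rw [hwa, hwb, hũu a ha, hũu b hb, hψ a ha, hψ b hb, hγ a ha b hb, abs_sub_comm,
      abs_of_pos (sub_pos.2 hab)] at this
    exact this
  obtain ⟨v, hv⟩ := hg.exists_velocity hũL hab hcomp (by rintro _ ⟨t, ht, rfl⟩; exact hγr t ht)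
    (fun t ↦ ⟨_, (projIcc a b hab.le t).2, rfl⟩) hspeed hmin
  refine ⟨v, fun t ht ↦ ?_⟩
  obtain ⟨h1, h2, h3⟩ := hv t ht
  rw [hũu t ht] at h2 h3
  exact ⟨h1.congr (fun s hs ↦ (hũu s hs).symm) (hũu t ht).symm, h2, h3⟩

end ChartCoordinates

/-! ### Isometric changes of coordinates -/

namespace LocalMetric

open Set Filter Topology Asymptotics

variable {E : Type*} [NormedAddCommGroup E] [NormedSpace ℝ E] [FiniteDimensional ℝ E]
  {g₁ g₂ : E → E →L[ℝ] E →L[ℝ] ℝ} {U₁ U₂ : Set E} {z : E} {T : E → E}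

/-- An isometry has injective derivative by positivity of `g₁`, and the dimension is finite. -/
theorem fderiv_surjective_of_isometry (hg₁ : IsMetricOn g₁ U₁) (hz : z ∈ U₁)
    (hT : ∀ a b, g₂ (T z) (fderiv ℝ T z a) (fderiv ℝ T z b) = g₁ z a b) :
    Function.Surjective (fderiv ℝ T z) := by
  have hinj : Function.Injective (fderiv ℝ T z : E →ₗ[ℝ] E) := by
    rw [injective_iff_map_eq_zero]
    intro a ha
    by_contra hne
    have h1 := hg₁.pos z hz a hne
    have ha' : fderiv ℝ T z a = 0 := ha
    rw [← hT, ha'] at h1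
    simp at h1
  exact LinearMap.surjective_of_injective hinj

/-- The transformation law of the Christoffel symbols. -/
theorem fderiv_christoffel_eq (hg₁ : IsMetricOn g₁ U₁) (hg₂ : IsMetricOn g₂ U₂) (hz : z ∈ U₁)
    (hTz : T z ∈ U₂) (hTs : ContDiffAt ℝ ∞ T z)
    (hT : ∀ᶠ y in 𝓝 z, ∀ a b, g₂ (T y) (fderiv ℝ T y a) (fderiv ℝ T y b) = g₁ y a b) (a b : E) :
    fderiv ℝ T z (christoffel g₁ z a b) =
      christoffel g₂ (T z) (fderiv ℝ T z a) (fderiv ℝ T z b)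
        + fderiv ℝ (fderiv ℝ T) z a b := by
  have hTd : HasFDerivAt T (fderiv ℝ T z) z := (hTs.differentiableAt (by simp)).hasFDerivAt
  have hDd : HasFDerivAt (fderiv ℝ T) (fderiv ℝ (fderiv ℝ T) z) z :=
    ((hTs.fderiv_right (m := ∞) (by simp)).differentiableAt (by simp)).hasFDerivAt
  have hsymm : ∀ a b, fderiv ℝ (fderiv ℝ T) z a b = fderiv ℝ (fderiv ℝ T) z b a := fun a b ↦
    hTs.isSymmSndFDerivAt
      (by simp [minSmoothness_of_isRCLikeNormedField]; exact WithTop.coe_le_coe.2 le_top) a b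
  -- The differentiated isometry relation. It determines the Christoffel symbols of `g₁`, which are
  -- then tested against vectors in the range of the derivative of `T`, that is, all vectors.
  have key : ∀ c a b, fderiv ℝ g₁ z c a b =
      fderiv ℝ g₂ (T z) (fderiv ℝ T z c) (fderiv ℝ T z a) (fderiv ℝ T z b)
      + g₂ (T z) (fderiv ℝ (fderiv ℝ T) z c a) (fderiv ℝ T z b)
      + g₂ (T z) (fderiv ℝ T z a) (fderiv ℝ (fderiv ℝ T) z c b) := by
    intro c a b
    have h1 : HasFDerivAt (fun y ↦ g₂ (T y) (fderiv ℝ T y a) (fderiv ℝ T y b)) _ z :=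
      (((hg₂.hasFDerivAt hTz).comp z hTd).clm_apply (hDd.clm_apply (hasFDerivAt_const a z))).clm_apply
        (hDd.clm_apply (hasFDerivAt_const b z))
    have h2 := (h1.congr_of_eventuallyEq (hT.mono fun y hy ↦ (hy a b).symm)).unique
      (hg₁.hasFDerivAt_apply hz a b)
    have h3 := DFunLike.congr_fun h2 c
    simp at h3
    linarith
  have hTz' := hT.self_of_nhds
  refine hg₂.ext_left hTz fun d ↦ ?_
  obtain ⟨c, rfl⟩ := fderiv_surjective_of_isometry hg₁ hz hTz' d
  rw [hTz', hg₁.apply_christoffel hz, key, key, key, map_add, add_apply, hg₂.apply_christoffel hTz,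
    hsymm b a, hsymm c a, hsymm c b]
  rw [hg₂.symm _ hTz (fderiv ℝ T z a) (fderiv ℝ (fderiv ℝ T) z b c),
    hg₂.symm _ hTz (fderiv ℝ T z b) (fderiv ℝ (fderiv ℝ T) z a c)]
  ring

/-- The derivative `f'` is `o(s)`, and the mean value inequality on the interval of radius `|s|`
gains one more power of `s`. -/
theorem isLittleO_sq_of_hasDerivAt {F : Type*} [NormedAddCommGroup F] [NormedSpace ℝ F]
    {f f' : ℝ → F} (h0 : f 0 = 0) (hf : ∀ᶠ s in 𝓝 0, HasDerivAt f (f' s) s) (h0' : f' 0 = 0)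
    (hf' : HasDerivAt f' 0 0) : f =o[𝓝 0] fun s ↦ s ^ 2 := by
  rw [isLittleO_iff]
  intro ε hε
  have h1 : f' =o[𝓝 0] fun s ↦ s := by
    have := hf'.isLittleO
    simpa [h0'] using this
  obtain ⟨δ, hδ, hball⟩ := Metric.eventually_nhds_iff_ball.1 (hf.and (isLittleO_iff.1 h1 hε))
  filter_upwards [Metric.ball_mem_nhds 0 hδ] with s hs
  have hsub : Metric.closedBall (0 : ℝ) |s| ⊆ Metric.ball 0 δ := fun t ht ↦ by
    simp only [Metric.mem_ball, Metric.mem_closedBall, dist_zero_right, Real.norm_eq_abs] at *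
    exact ht.trans_lt hs
  have := (convex_closedBall (0 : ℝ) |s|).norm_image_sub_le_of_norm_hasDerivWithin_le
    (f := f) (f' := f') (C := ε * |s|) (x := 0) (y := s)
    (fun t ht ↦ (hball t (hsub ht)).1.hasDerivWithinAt)
    (fun t ht ↦ by
      have h2 := (hball t (hsub ht)).2
      simp only [Metric.mem_closedBall, dist_zero_right, Real.norm_eq_abs] at ht
      rw [Real.norm_eq_abs] at h2
      exact h2.trans (by gcongr)) (by simp) (by simp)
  rw [h0, sub_zero, sub_zero, Real.norm_eq_abs] at this
  rw [norm_pow, Real.norm_eq_abs]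
  calc ‖f s‖ ≤ _ := this
    _ = _ := by ring

/-- Osculating geodesics agree up to second order in all coordinates. -/
theorem isLittleO_osculating (hg₁ : IsMetricOn g₁ U₁) (hg₂ : IsMetricOn g₂ U₂) (hz : z ∈ U₁)
    (hTz : T z ∈ U₂) (hTs : ContDiffAt ℝ ∞ T z)
    (hT : ∀ᶠ y in 𝓝 z, ∀ a b, g₂ (T y) (fderiv ℝ T y a) (fderiv ℝ T y b) = g₁ y a b) (V : E) :
    (fun s ↦ T (osculating g₁ z V s) - osculating g₂ (T z) (fderiv ℝ T z V) s)
      =o[𝓝 0] fun s ↦ s ^ 2 := by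
  have hod : ∀ (g : E → E →L[ℝ] E →L[ℝ] ℝ) (z V : E) (s : ℝ),
      HasDerivAt (osculating g z V) (V + s • -christoffel g z V V) s := fun g z V s ↦ by
    refine ((((hasDerivAt_id s).smul_const V).const_add z).add
      ((((hasDerivAt_id s).pow 2).div_const 2).smul_const (-christoffel g z V V))).congr_deriv ?_
    simp
  have hod' : ∀ (g : E → E →L[ℝ] E →L[ℝ] ℝ) (z V : E),
      HasDerivAt (fun s : ℝ ↦ V + s • -christoffel g z V V) (-christoffel g z V V) 0 :=
    fun g z V ↦ by
      have := ((hasDerivAt_id (0 : ℝ)).smul_const (-christoffel g z V V)).const_add V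
      rwa [one_smul] at this
  have hTe : ∀ᶠ y in 𝓝 z, HasFDerivAt T (fderiv ℝ T y) y := by
    have := (hTs.of_le (m := 1) (by simp)).eventually (by simp)
    exact this.mono fun y hy ↦ (hy.differentiableAt (by simp)).hasFDerivAt
  have hDd : HasFDerivAt (fderiv ℝ T) (fderiv ℝ (fderiv ℝ T) z) z :=
    ((hTs.fderiv_right (m := ∞) (by simp)).differentiableAt (by simp)).hasFDerivAt
  have hoc : Tendsto (osculating g₁ z V) (𝓝 0) (𝓝 z) := by
    have := (hod g₁ z V 0).continuousAt.tendsto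
    rwa [osculating_zero] at this
  refine isLittleO_sq_of_hasDerivAt
    (f' := fun s ↦ fderiv ℝ T (osculating g₁ z V s) (V + s • -christoffel g₁ z V V)
      - (fderiv ℝ T z V + s • -christoffel g₂ (T z) (fderiv ℝ T z V) (fderiv ℝ T z V)))
    (by simp [osculating_zero]) ?_ (by simp [osculating_zero]) ?_
  · filter_upwards [hoc.eventually hTe] with s hs
    exact (hs.comp_hasDerivAt s (hod g₁ z V s)).sub (hod g₂ (T z) (fderiv ℝ T z V) s)
  -- The second derivatives at `0` agree: `D²T(V, V) - DT Γ₁(V, V) = -Γ₂(DT V, DT V)` is the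
  -- transformation law of the Christoffel symbols.
  · rw [← osculating_zero g₁ z V] at hDd
    have h1 := ((hDd.comp_hasDerivAt 0 (hod g₁ z V 0)).clm_apply (hod' g₁ z V)).sub
      (hod' g₂ (T z) (fderiv ℝ T z V))
    refine h1.congr_deriv ?_
    simp only [osculating_zero, zero_smul, add_zero, Function.comp_apply, map_neg,
      fderiv_christoffel_eq hg₁ hg₂ hz hTz hTs hT]
    abel

end LocalMetric

/-! ### Existence of minimizing curves; osculating points in different charts -/

namespace ChartCoordinates

open Set Filter Topology LocalMetric Manifold MeasureTheory Asymptotics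
open scoped NNReal

variable {E : Type*} [NormedAddCommGroup E] [NormedSpace ℝ E] [FiniteDimensional ℝ E]
  {M : Type*} [MetricSpace M] [ChartedSpace E M] [IsManifold 𝓘(ℝ, E) ∞ M]
  [RiemannianBundle (fun x : M ↦ TangentSpace 𝓘(ℝ, E) x)]
  [IsContMDiffRiemannianBundle 𝓘(ℝ, E) ∞ E (fun x : M ↦ TangentSpace 𝓘(ℝ, E) x)]

section

variable [IsRiemannianManifold 𝓘(ℝ, E) M]

/-- A curve of length less than `dist x y + ε` crosses the sphere of radius `r` about `x` by the
intermediate value theorem. Additivity of length bounds what remains. -/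
theorem hasApproxBetween (E : Type*) [NormedAddCommGroup E] [NormedSpace ℝ E]
    [FiniteDimensional ℝ E] (M : Type*) [MetricSpace M] [ChartedSpace E M] [IsManifold 𝓘(ℝ, E) ∞ M]
    [RiemannianBundle (fun x : M ↦ TangentSpace 𝓘(ℝ, E) x)]
    [IsContMDiffRiemannianBundle 𝓘(ℝ, E) ∞ E (fun x : M ↦ TangentSpace 𝓘(ℝ, E) x)]
    [IsRiemannianManifold 𝓘(ℝ, E) M] :
    LengthSpace.HasApproxBetween M := by
  intro x y r ε hr hrd hε
  have hd : 0 < dist x y + ε := by positivity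
  have hlt : riemannianEDist 𝓘(ℝ, E) x y < ENNReal.ofReal (dist x y + ε) := by
    rw [← IsRiemannianManifold.out, edist_dist]
    exact (ENNReal.ofReal_lt_ofReal_iff hd).2 (by linarith)
  obtain ⟨γ, hγ0, hγ1, hγs, hγL, -⟩ :=
    exists_lt_locally_constant_of_riemannianEDist_lt hlt zero_lt_one
  have hc : ContinuousOn (fun t ↦ dist x (γ t)) (Icc 0 1) :=
    (continuous_const.dist hγs.continuous).continuousOn
  obtain ⟨t, ht, hrt⟩ := intermediate_value_Icc zero_le_one hc
    (show r ∈ Icc (dist x (γ 0)) (dist x (γ 1)) by simp [hγ0, hγ1, hr, hrd])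
  refine ⟨γ t, hrt, ?_⟩
  have e1 := riemannianEDist_le_pathELength (I := 𝓘(ℝ, E)) (hγs.contMDiffOn (s := Icc 0 t))
    hγ0 rfl ht.1
  have e2 := riemannianEDist_le_pathELength (I := 𝓘(ℝ, E)) (hγs.contMDiffOn (s := Icc t 1))
    rfl hγ1 ht.2
  have e3 := (add_le_add e1 e2).trans_lt ((pathELength_add ht.1 ht.2).trans_lt hγL)
  rw [← IsRiemannianManifold.out, ← IsRiemannianManifold.out, edist_dist, edist_dist,
    ← ENNReal.ofReal_add dist_nonneg dist_nonneg, ENNReal.ofReal_lt_ofReal_iff hd] at e3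
  simp only at hrt
  linarith

theorem exists_minimizing (E : Type*) [NormedAddCommGroup E] [NormedSpace ℝ E]
    [FiniteDimensional ℝ E] {M : Type*} [MetricSpace M] [ChartedSpace E M] [IsManifold 𝓘(ℝ, E) ∞ M]
    [RiemannianBundle (fun x : M ↦ TangentSpace 𝓘(ℝ, E) x)]
    [IsContMDiffRiemannianBundle 𝓘(ℝ, E) ∞ E (fun x : M ↦ TangentSpace 𝓘(ℝ, E) x)]
    [IsRiemannianManifold 𝓘(ℝ, E) M]
    [CompleteSpace M] (p q : M) : ∃ γ : ℝ → M, γ 0 = p ∧ γ (dist p q) = q ∧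
    ∀ s ∈ Icc 0 (dist p q), ∀ t ∈ Icc 0 (dist p q), dist (γ s) (γ t) = |s - t| := by
  have : ProperSpace E := FiniteDimensional.proper ℝ E
  have : LocallyCompactSpace M := ChartedSpace.locallyCompactSpace E M
  exact (hasApproxBetween E M).exists_minimizing p q

/-- Osculating geodesics in two charts through the same point in the same direction agree up to
second order. -/
theorem isLittleO_dist_osculating {x₀ x₁ x : M} (hx₀ : x ∈ (chart E x₀).source)
    (hx₁ : x ∈ (chart E x₁).source) (V : TangentSpace 𝓘(ℝ, E) x) :
    (fun s ↦ dist ((chart E x₀).symm (osculating (metric x₀) (chart E x₀ x) (coord x₀ x V) s))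
      ((chart E x₁).symm (osculating (metric x₁) (chart E x₁ x) (coord x₁ x V) s)))
      =o[𝓝 0] fun s ↦ s ^ 2 := by
  set z := chart E x₀ x with hz
  have hzt : z ∈ (chart E x₀).target := (chart E x₀).map_source hx₀
  have hψz : (chart E x₀).symm z = x := (chart E x₀).left_inv hx₀
  have hzs : (chart E x₀).symm z ∈ (chart E x₁).source := by rwa [hψz]
  have hTz : transition x₀ x₁ z = chart E x₁ x := by rw [transition, hψz]
  have hDV : fderiv ℝ (transition x₀ x₁) z (coord x₀ x V) = coord x₁ x V := by
    rw [(hasFDerivAt_transition hzt hzs).fderiv]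
    have : ∀ y, y = x → coord x₁ y (frame x₀ y (coord x₀ x V)) = coord x₁ x V := by
      rintro y rfl
      rw [frame_coord hx₀]
    exact this _ hψz
  have htar : transition x₀ x₁ z ∈ (chart E x₁).target := (chart E x₁).map_source hzs
  have hψc : ContinuousAt (chart E x₀).symm z := (contMDiffAt_chart_symm hzt).continuousAt
  have hne : ∀ᶠ y in 𝓝 z, y ∈ (chart E x₀).target ∧ (chart E x₀).symm y ∈ (chart E x₁).source :=
    ((isOpen_target x₀).eventually_mem hzt).and
      (hψc.eventually ((isOpen_source x₁).eventually_mem hzs))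
  have h := isLittleO_osculating (isMetricOn_metric x₀) (isMetricOn_metric x₁) hzt htar
    (contDiffAt_transition hzt hzs)
    (hne.mono fun y hy a b ↦ metric_transition hy.1 hy.2 a b) (coord x₀ x V)
  rw [hTz, hDV] at h
  have htar' : chart E x₁ x ∈ (chart E x₁).target := (chart E x₁).map_source hx₁
  obtain ⟨r, hr, C, -, hC⟩ := exists_ball_dist_comparable htar'
  have hosc : ∀ (g : E → E →L[ℝ] E →L[ℝ] ℝ) (y V : E), Tendsto (osculating g y V) (𝓝 0) (𝓝 y) := by
    intro g y V
    have : Continuous (osculating g y V) := by unfold osculating; fun_prop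
    simpa only [osculating_zero] using this.tendsto 0
  -- Near `x` the distance on `M` is at most `C` times the distance in the chart at `x₁`, where the
  -- coordinate estimate holds.
  refine IsBigO.trans_isLittleO (IsBigO.of_bound C ?_) h
  have hTc : ContinuousAt (transition x₀ x₁) z := (contDiffAt_transition hzt hzs).continuousAt
  rw [ContinuousAt, hTz] at hTc
  filter_upwards [(hosc (metric x₀) z (coord x₀ x V)).eventually hne,
    (hTc.comp (hosc (metric x₀) z (coord x₀ x V))).eventually (Metric.ball_mem_nhds _ hr),
    (hosc (metric x₁) (chart E x₁ x) (coord x₁ x V)).eventually (Metric.ball_mem_nhds _ hr)]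
    with s h1 h2 h3
  rw [Real.norm_eq_abs, abs_of_nonneg dist_nonneg, ← dist_eq_norm]
  have h4 := (hC _ h2 _ h3).1
  simp only [Function.comp_apply] at h4
  rwa [transition, (chart E x₁).left_inv h1.2] at h4

end

end ChartCoordinates

/-! ### The Levi-Civita connection in charts -/

namespace ChartCoordinates

open Set Filter Topology LocalMetric AlmostHermitian

variable {E : Type*} [NormedAddCommGroup E] [NormedSpace ℝ E]
  {M : Type*} [TopologicalSpace M] [ChartedSpace E M] [IsManifold 𝓘(ℝ, E) ∞ M]

/-- The coordinate representation of a vector field in the chart at `x₀`. -/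
def rep (x₀ : M) (Y : Π x : M, TangentSpace 𝓘(ℝ, E) x) (z : E) : E :=
  coord x₀ ((chart E x₀).symm z) (Y ((chart E x₀).symm z))

theorem rep_chart {x₀ x : M} (hx : x ∈ (chart E x₀).source)
    (Y : Π x : M, TangentSpace 𝓘(ℝ, E) x) : rep x₀ Y (chart E x₀ x) = coord x₀ x (Y x) := by
  rw [rep, (chart E x₀).left_inv hx]

theorem trivialization_snd_eq {x₀ x : M} (hx : x ∈ (chart E x₀).source)
    (v : TangentSpace 𝓘(ℝ, E) x) :
    ((trivializationAt E (TangentSpace 𝓘(ℝ, E)) x₀) ⟨x, v⟩).2 = coord x₀ x v := by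
  rw [coord, Trivialization.continuousLinearMapAt_apply, Trivialization.linearMapAt_apply,
    if_pos (mem_baseSet hx)]

theorem mdifferentiableAt_comp_chart_iff {F : Type*} [NormedAddCommGroup F] [NormedSpace ℝ F]
    {x₀ x : M} (hx : x ∈ (chart E x₀).source) {f : M → F} {f' : E → F}
    (hf : ∀ y ∈ (chart E x₀).source, f y = f' (chart E x₀ y)) :
    MDifferentiableAt 𝓘(ℝ, E) 𝓘(ℝ, F) f x ↔ DifferentiableAt ℝ f' (chart E x₀ x) := by
  have ht := (chart E x₀).map_source hx
  constructor
  · intro h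
    have hs : MDifferentiableAt 𝓘(ℝ, E) 𝓘(ℝ, E) (chart E x₀).symm (chart E x₀ x) :=
      (contMDiffAt_chart_symm ht).mdifferentiableAt (by simp)
    rw [← (chart E x₀).left_inv hx] at h
    have h2 := MDifferentiableAt.comp _ h hs
    rw [mdifferentiableAt_iff_differentiableAt] at h2
    refine h2.congr_of_eventuallyEq ?_
    filter_upwards [(isOpen_target x₀).mem_nhds ht] with z hz
    rw [Function.comp_apply, hf _ ((chart E x₀).map_target hz), (chart E x₀).right_inv hz]
  · intro h
    rw [← mdifferentiableAt_iff_differentiableAt] at h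
    refine (MDifferentiableAt.comp x h
      ((contMDiffAt_chart hx).mdifferentiableAt (by simp))).congr_of_eventuallyEq ?_
    filter_upwards [(isOpen_source x₀).mem_nhds hx] with y hy using hf y hy

theorem mdiffAt_iff_rep {x₀ x : M} (hx : x ∈ (chart E x₀).source)
    {Y : Π x : M, TangentSpace 𝓘(ℝ, E) x} :
    MDiffAt (T% Y) x ↔ DifferentiableAt ℝ (rep x₀ Y) (chart E x₀ x) := by
  rw [Trivialization.mdifferentiableAt_section_iff 𝓘(ℝ, E)
    (trivializationAt E (TangentSpace 𝓘(ℝ, E)) x₀) Y (mem_baseSet hx)]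
  refine mdifferentiableAt_comp_chart_iff hx fun y hy ↦ ?_
  rw [trivialization_snd_eq hy, rep_chart hy]

theorem contDiffAt_rep {x₀ x : M} (hx : x ∈ (chart E x₀).source)
    {Y : Π x : M, TangentSpace 𝓘(ℝ, E) x}
    (hY : ContMDiffAt 𝓘(ℝ, E) (𝓘(ℝ, E).prod 𝓘(ℝ, E)) ∞ (T% Y) x) :
    ContDiffAt ℝ ∞ (rep x₀ Y) (chart E x₀ x) := by
  have ht := (chart E x₀).map_source hx
  rw [Trivialization.contMDiffAt_section_iff
    (trivializationAt E (TangentSpace 𝓘(ℝ, E)) x₀) (mem_baseSet hx)] at hY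
  rw [← (chart E x₀).left_inv hx] at hY
  have h2 := hY.comp _ (contMDiffAt_chart_symm ht)
  rw [contMDiffAt_iff_contDiffAt] at h2
  refine h2.congr_of_eventuallyEq ?_
  filter_upwards [(isOpen_target x₀).mem_nhds ht] with z hz
  rw [Function.comp_apply, trivialization_snd_eq ((chart E x₀).map_target hz), rep]

theorem mvfderiv_eq_fderiv {x₀ x : M} (hx : x ∈ (chart E x₀).source) {f : M → ℝ} {f' : E → ℝ}
    (hf : ∀ y ∈ (chart E x₀).source, f y = f' (chart E x₀ y))
    (hd : DifferentiableAt ℝ f' (chart E x₀ x)) (v : TangentSpace 𝓘(ℝ, E) x) :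
    d% f x v = fderiv ℝ f' (chart E x₀ x) (coord x₀ x v) := by
  have h1 := (hd.hasFDerivAt.hasMFDerivAt).comp x (hasMFDerivAt_chart hx)
  have h2 : HasMFDerivAt 𝓘(ℝ, E) 𝓘(ℝ, ℝ) f x _ := h1.congr_of_eventuallyEq (by
    filter_upwards [(isOpen_source x₀).mem_nhds hx] with y hy using hf y hy)
  rw [mvfderiv, h2.mfderiv]
  rfl

variable [FiniteDimensional ℝ E]

theorem inverse_mfderiv_chart {x₀ x : M} (hx : x ∈ (chart E x₀).source) :
    (mfderiv 𝓘(ℝ, E) 𝓘(ℝ, E) (chart E x₀) x).inverse = frame (E := E) x₀ x := by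
  have h := coord_eq_mfderiv hx
  exact ContinuousLinearMap.inverse_eq
    (ContinuousLinearMap.ext fun a ↦ (DFunLike.congr_fun h _).symm.trans (coord_frame hx a))
    (ContinuousLinearMap.ext fun v ↦
      (congrArg (frame (E := E) x₀ x) (DFunLike.congr_fun h v).symm).trans (frame_coord hx v))

theorem mpullback_chart {x₀ x : M} (hx : x ∈ (chart E x₀).source) (V : E → E) :
    mpullback 𝓘(ℝ, E) 𝓘(ℝ, E) (chart E x₀) V x = frame x₀ x (V (chart E x₀ x)) :=
  DFunLike.congr_fun (inverse_mfderiv_chart hx) (V (chart E x₀ x))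

theorem mpullback_rep {x₀ x : M} (hx : x ∈ (chart E x₀).source)
    (Y : Π x : M, TangentSpace 𝓘(ℝ, E) x) :
    mpullback 𝓘(ℝ, E) 𝓘(ℝ, E) (chart E x₀) (rep x₀ Y) x = Y x := by
  rw [mpullback_chart hx, rep_chart hx, frame_coord hx]

theorem mdifferentiableAt_vectorField {V : Π z : E, TangentSpace 𝓘(ℝ, E) z} {z : E}
    (hV : MDifferentiableAt 𝓘(ℝ, E) 𝓘(ℝ, E) (fun z ↦ (V z : E)) z) : MDiffAt (T% V) z := by
  rw [mdifferentiableAt_section]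
  simpa using! hV

theorem mlieBracket_eq_lieBracket (V W : Π z : E, TangentSpace 𝓘(ℝ, E) z) (z : E) :
    mlieBracket 𝓘(ℝ, E) V W z = lieBracket ℝ V W z := by
  rw [← mlieBracketWithin_univ, mlieBracketWithin_eq_lieBracketWithin]
  exact congrFun (lieBracketWithin_univ (𝕜 := ℝ) (E := E)) z

/-- Near `x` each field is the pullback of its representation under the chart, and pullback commutes
with the bracket. -/
theorem coord_mlieBracket {x₀ x : M} (hx : x ∈ (chart E x₀).source)
    {V W : Π x : M, TangentSpace 𝓘(ℝ, E) x} (hV : MDiffAt (T% V) x) (hW : MDiffAt (T% W) x) :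
    coord x₀ x (mlieBracket 𝓘(ℝ, E) V W x) =
      fderiv ℝ (rep x₀ W) (chart E x₀ x) (coord x₀ x (V x))
        - fderiv ℝ (rep x₀ V) (chart E x₀ x) (coord x₀ x (W x)) := by
  have : CompleteSpace E := FiniteDimensional.complete ℝ E
  have hev : ∀ Y : Π x : M, TangentSpace 𝓘(ℝ, E) x,
      mpullback 𝓘(ℝ, E) 𝓘(ℝ, E) (chart E x₀) (rep x₀ Y) =ᶠ[𝓝 x] Y := fun Y ↦ by
    filter_upwards [(isOpen_source x₀).mem_nhds hx] with y hy using mpullback_rep hy Y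
  have hd : ∀ Y : Π x : M, TangentSpace 𝓘(ℝ, E) x, MDiffAt (T% Y) x →
      MDifferentiableAt 𝓘(ℝ, E) (𝓘(ℝ, E).prod 𝓘(ℝ, E))
        (fun z ↦ (⟨z, rep (E := E) x₀ Y z⟩ : TangentBundle 𝓘(ℝ, E) E)) (chart E x₀ x) := by
    intro Y hY
    rw [mdiffAt_iff_rep hx] at hY
    rw [← mdifferentiableAt_iff_differentiableAt] at hY
    exact mdifferentiableAt_vectorField hY
  have : IsManifold 𝓘(ℝ, E) (minSmoothness ℝ 2) M := by
    rw [minSmoothness_of_isRCLikeNormedField]; infer_instance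
  have h := mpullback_mlieBracket (I := 𝓘(ℝ, E)) (I' := 𝓘(ℝ, E)) (n := ∞) (f := chart E x₀)
    (V := rep x₀ V) (W := rep x₀ W) (x₀ := x) (hd V hV) (hd W hW) (contMDiffAt_chart hx) (by
      simp [minSmoothness_of_isRCLikeNormedField]; exact WithTop.coe_le_coe.2 le_top)
  rw [(hev V).mlieBracket_vectorField_eq (hev W)] at h
  have h' : mlieBracket 𝓘(ℝ, E) V W x = frame x₀ x (lieBracket ℝ (rep x₀ V) (rep x₀ W) (chart E x₀ x)) := by
    exact h.symm.trans ((mpullback_chart hx _).trans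
      (congrArg (frame (E := E) x₀ x) (mlieBracket_eq_lieBracket _ _ _)))
  rw [h', coord_frame hx, lieBracket, rep_chart hx, rep_chart hx]

end ChartCoordinates

namespace ChartCoordinates

open Set Filter Topology LocalMetric AlmostHermitian

variable {E : Type*} [NormedAddCommGroup E] [NormedSpace ℝ E] [FiniteDimensional ℝ E]
  {M : Type*} [TopologicalSpace M] [ChartedSpace E M] [IsManifold 𝓘(ℝ, E) ∞ M]
  [RiemannianBundle (fun x : M ↦ TangentSpace 𝓘(ℝ, E) x)]
  [IsContMDiffRiemannianBundle 𝓘(ℝ, E) ∞ E (fun x : M ↦ TangentSpace 𝓘(ℝ, E) x)]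

theorem rep_frame (x₀ : M) (a : E) {z : E} (hz : z ∈ (chart E x₀).target) :
    rep x₀ (fun x ↦ frame x₀ x a) z = a := by
  rw [rep, coord_frame ((chart E x₀).map_target hz)]

theorem mdiffAt_frame {x₀ x : M} (hx : x ∈ (chart E x₀).source) (a : E) :
    MDiffAt (T% fun x : M ↦ frame x₀ x a) x :=
  ((contMDiffOn_frame x₀ a).contMDiffAt ((isOpen_source x₀).mem_nhds hx)).mdifferentiableAt
    (by simp)

theorem mvfderiv_inner {x₀ x : M} (hx : x ∈ (chart E x₀).source)
    {Y Z : Π x : M, TangentSpace 𝓘(ℝ, E) x} (hY : MDiffAt (T% Y) x) (hZ : MDiffAt (T% Z) x)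
    (v : TangentSpace 𝓘(ℝ, E) x) :
    d% (fun y ↦ inner ℝ (Y y) (Z y)) x v =
      fderiv ℝ (metric x₀) (chart E x₀ x) (coord x₀ x v) (coord x₀ x (Y x)) (coord x₀ x (Z x))
      + metric x₀ (chart E x₀ x) (fderiv ℝ (rep x₀ Y) (chart E x₀ x) (coord x₀ x v))
        (coord x₀ x (Z x))
      + metric x₀ (chart E x₀ x) (coord x₀ x (Y x))
        (fderiv ℝ (rep x₀ Z) (chart E x₀ x) (coord x₀ x v)) := by
  have ht := (chart E x₀).map_source hx
  rw [mdiffAt_iff_rep hx] at hY hZ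
  have h1 : HasFDerivAt (fun z ↦ metric x₀ z (rep x₀ Y z) (rep x₀ Z z)) _ (chart E x₀ x) :=
    (((isMetricOn_metric x₀).hasFDerivAt ht).clm_apply hY.hasFDerivAt).clm_apply hZ.hasFDerivAt
  rw [mvfderiv_eq_fderiv hx (f' := fun z ↦ metric x₀ z (rep x₀ Y z) (rep x₀ Z z)) ?_
    h1.differentiableAt, h1.fderiv]
  · simp only [add_apply, ContinuousLinearMap.comp_apply, ContinuousLinearMap.flip_apply,
      rep_chart hx]
    ring
  · intro y hy
    rw [rep_chart hy, rep_chart hy, metric_coord hy]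

/-- The Levi-Civita connection in a chart. -/
theorem coord_leviCivita {x₀ x : M} (hx : x ∈ (chart E x₀).source)
    {Y : Π x : M, TangentSpace 𝓘(ℝ, E) x} (hY : MDiffAt (T% Y) x) (v : TangentSpace 𝓘(ℝ, E) x) :
    coord x₀ x (leviCivita 𝓘(ℝ, E) M Y x v) =
      fderiv ℝ (rep x₀ Y) (chart E x₀ x) (coord x₀ x v)
        + christoffel (metric x₀) (chart E x₀ x) (coord x₀ x v) (coord x₀ x (Y x)) := by
  have ht := (chart E x₀).map_source hx
  have hg := isMetricOn_metric (E := E) x₀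
  refine hg.ext_left ht fun c ↦ ?_
  set a := coord x₀ x v with ha
  -- The Koszul formula is tested with coordinate fields. Their representations are constant, so
  -- their derivatives drop out and only those of `Y` and of the metric survive.
  have hX := mdiffAt_frame hx a
  have hZ := mdiffAt_frame hx c
  have hXx : frame x₀ x a = v := frame_coord hx v
  have hD0 : ∀ b : E, fderiv ℝ (rep x₀ fun x ↦ frame x₀ x b) (chart E x₀ x) = 0 := by
    intro b
    have : rep x₀ (fun x ↦ frame x₀ x b) =ᶠ[𝓝 (chart E x₀ x)] fun _ ↦ b := by
      filter_upwards [(isOpen_target x₀).mem_nhds ht] with z hz using rep_frame x₀ b hz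
    rw [this.fderiv_eq]; simp
  have key := inner_leviCivitaFun hX hY hZ
  have h1 : metric x₀ (chart E x₀ x) (coord x₀ x (leviCivita 𝓘(ℝ, E) M Y x v)) c =
      inner ℝ (leviCivitaFun Y x (frame x₀ x a)) (frame x₀ x c) := by
    rw [hXx, ← metric_coord hx, coord_frame hx]; rfl
  rw [h1, key, koszul, mvfderiv_inner hx hY hZ, mvfderiv_inner hx hX hZ, mvfderiv_inner hx hX hY,
    ← metric_coord hx, ← metric_coord hx, ← metric_coord hx, coord_mlieBracket hx hX hY,
    coord_mlieBracket hx hX hZ, coord_mlieBracket hx hY hZ]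
  simp only [hD0, coord_frame hx, zero_apply, map_zero, sub_zero, zero_sub, map_neg, neg_apply,
    map_add, add_apply, hg.apply_christoffel ht]
  rw [hg.symm _ ht a]
  ring

theorem eventually_mdiffAt {x₀ x : M} (hx : x ∈ (chart E x₀).source)
    {Y : Π x : M, TangentSpace 𝓘(ℝ, E) x}
    (hY : ContMDiffAt 𝓘(ℝ, E) (𝓘(ℝ, E).prod 𝓘(ℝ, E)) ∞ (T% Y) x) :
    ∀ᶠ y in 𝓝 x, MDiffAt (T% Y) y := by
  have h1 := (contDiffAt_rep hx hY).of_le (m := 1) (by simp)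
  have h2 := (contMDiffAt_chart hx).continuousAt.eventually (h1.eventually (by simp))
  filter_upwards [h2, (isOpen_source x₀).mem_nhds hx] with y hy hys
  exact (mdiffAt_iff_rep hys).2 (hy.differentiableAt (by simp))

/-- The coordinate formula on a whole neighbourhood, which is what allows a second covariant
derivative to be taken. -/
theorem rep_leviCivita_eventuallyEq {x₀ x : M} (hx : x ∈ (chart E x₀).source)
    {Y Z : Π x : M, TangentSpace 𝓘(ℝ, E) x}
    (hZ : ContMDiffAt 𝓘(ℝ, E) (𝓘(ℝ, E).prod 𝓘(ℝ, E)) ∞ (T% Z) x) :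
    rep x₀ (fun y ↦ leviCivita 𝓘(ℝ, E) M Z y (Y y)) =ᶠ[𝓝 (chart E x₀ x)]
      fun z ↦ fderiv ℝ (rep x₀ Z) z (rep x₀ Y z)
        + christoffel (metric x₀) z (rep x₀ Y z) (rep x₀ Z z) := by
  have ht := (chart E x₀).map_source hx
  have h1 : Tendsto (chart E x₀).symm (𝓝 (chart E x₀ x)) (𝓝 x) := by
    have := (contMDiffAt_chart_symm ht).continuousAt
    rwa [ContinuousAt, (chart E x₀).left_inv hx] at this
  filter_upwards [h1.eventually (eventually_mdiffAt hx hZ),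
    (isOpen_target x₀).mem_nhds ht] with z hz hzt
  have := coord_leviCivita ((chart E x₀).map_target hzt) hz (Y ((chart E x₀).symm z))
  rw [(chart E x₀).right_inv hzt] at this
  exact this

/-- The curvature tensor in a chart. -/
theorem coord_curvatureField {x₀ x : M} (hx : x ∈ (chart E x₀).source)
    {X Y Z : Π x : M, TangentSpace 𝓘(ℝ, E) x}
    (hX : ContMDiffAt 𝓘(ℝ, E) (𝓘(ℝ, E).prod 𝓘(ℝ, E)) ∞ (T% X) x)
    (hY : ContMDiffAt 𝓘(ℝ, E) (𝓘(ℝ, E).prod 𝓘(ℝ, E)) ∞ (T% Y) x)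
    (hZ : ContMDiffAt 𝓘(ℝ, E) (𝓘(ℝ, E).prod 𝓘(ℝ, E)) ∞ (T% Z) x) :
    coord x₀ x (curvatureField X Y Z x) =
      curvature (metric x₀) (chart E x₀ x) (coord x₀ x (X x)) (coord x₀ x (Y x))
        (coord x₀ x (Z x)) := by
  have ht := (chart E x₀).map_source hx
  have hg := isMetricOn_metric (E := E) x₀
  have hZs := contDiffAt_rep hx hZ
  have hZd : HasFDerivAt (rep x₀ Z) _ (chart E x₀ x) :=
    (hZs.differentiableAt (by simp)).hasFDerivAt
  have hZdd : HasFDerivAt (fderiv ℝ (rep x₀ Z)) _ (chart E x₀ x) :=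
    ((hZs.fderiv_right (m := ∞) (by simp)).differentiableAt (by simp)).hasFDerivAt
  have hsymm : ∀ a b, fderiv ℝ (fderiv ℝ (rep x₀ Z)) (chart E x₀ x) a b =
      fderiv ℝ (fderiv ℝ (rep x₀ Z)) (chart E x₀ x) b a := fun a b ↦
    hZs.isSymmSndFDerivAt
      (by simp [minSmoothness_of_isRCLikeNormedField]; exact WithTop.coe_le_coe.2 le_top) a b
  have key : ∀ {V : Π x : M, TangentSpace 𝓘(ℝ, E) x},
      ContMDiffAt 𝓘(ℝ, E) (𝓘(ℝ, E).prod 𝓘(ℝ, E)) ∞ (T% V) x →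
      ∀ v : TangentSpace 𝓘(ℝ, E) x,
      coord x₀ x (leviCivita 𝓘(ℝ, E) M (fun y ↦ leviCivita 𝓘(ℝ, E) M Z y (V y)) x v) =
        fderiv ℝ (fderiv ℝ (rep x₀ Z)) (chart E x₀ x) (coord x₀ x v) (coord x₀ x (V x))
        + fderiv ℝ (rep x₀ Z) (chart E x₀ x)
          (fderiv ℝ (rep x₀ V) (chart E x₀ x) (coord x₀ x v))
        + (fderiv ℝ (christoffel (metric x₀)) (chart E x₀ x) (coord x₀ x v) (coord x₀ x (V x))
            (coord x₀ x (Z x))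
          + christoffel (metric x₀) (chart E x₀ x)
            (fderiv ℝ (rep x₀ V) (chart E x₀ x) (coord x₀ x v)) (coord x₀ x (Z x))
          + christoffel (metric x₀) (chart E x₀ x) (coord x₀ x (V x))
            (fderiv ℝ (rep x₀ Z) (chart E x₀ x) (coord x₀ x v)))
        + christoffel (metric x₀) (chart E x₀ x) (coord x₀ x v)
          (fderiv ℝ (rep x₀ Z) (chart E x₀ x) (coord x₀ x (V x))
            + christoffel (metric x₀) (chart E x₀ x) (coord x₀ x (V x)) (coord x₀ x (Z x))) := by
    intro V hV v
    have hVd : HasFDerivAt (rep x₀ V) _ (chart E x₀ x) :=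
      ((contDiffAt_rep hx hV).differentiableAt (by simp)).hasFDerivAt
    have h1 := (hZdd.clm_apply hVd).add
      (((hg.hasFDerivAt_christoffel ht).clm_apply hVd).clm_apply hZd)
    have h2 := h1.congr_of_eventuallyEq (rep_leviCivita_eventuallyEq (Y := V) hx hZ)
    have h3 := coord_leviCivita hx ((mdiffAt_iff_rep hx).2 h2.differentiableAt) v
    rw [h2.fderiv] at h3
    rw [h3, coord_leviCivita hx (hZ.mdifferentiableAt (by simp)) (V x)]
    simp only [add_apply, ContinuousLinearMap.comp_apply, ContinuousLinearMap.flip_apply,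
      rep_chart hx]
    abel
  -- The derivatives of `X` and `Y` cancel against the bracket term and the second derivatives of
  -- `Z` cancel by symmetry, which leaves a tensor.
  rw [curvatureField, map_sub, map_sub, key hY, key hX,
    coord_leviCivita hx (hZ.mdifferentiableAt (by simp)),
    coord_mlieBracket hx (hX.mdifferentiableAt (by simp)) (hY.mdifferentiableAt (by simp)),
    curvature, hsymm (coord x₀ x (Y x)) (coord x₀ x (X x))]
  simp only [map_sub, map_add, sub_apply]
  abel

theorem coord_Rm {x₀ x : M} (hx : x ∈ (chart E x₀).source) (u v w : TangentSpace 𝓘(ℝ, E) x) :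
    coord x₀ x (Rm u v w) =
      curvature (metric x₀) (chart E x₀ x) (coord x₀ x u) (coord x₀ x v) (coord x₀ x w) := by
  rw [Rm, coord_curvatureField hx (contMDiffAt_extend ..) (contMDiffAt_extend ..)
    (contMDiffAt_extend ..)]
  simp only [extend_apply_self]

end ChartCoordinates

/-! ### Endomorphism fields in charts -/

namespace ChartCoordinates

open Set Filter Topology LocalMetric AlmostHermitian

variable {E : Type*} [NormedAddCommGroup E] [NormedSpace ℝ E] [FiniteDimensional ℝ E]
  {M : Type*} [TopologicalSpace M] [ChartedSpace E M] [IsManifold 𝓘(ℝ, E) ∞ M]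

/-- The coordinate representation of an endomorphism field in the chart at `x₀`. -/
def repEnd (x₀ : M) (J : Π x : M, TangentSpace 𝓘(ℝ, E) x →L[ℝ] TangentSpace 𝓘(ℝ, E) x) (z : E) :
    E →L[ℝ] E :=
  coord x₀ ((chart E x₀).symm z) ∘L J ((chart E x₀).symm z) ∘L frame x₀ ((chart E x₀).symm z)

variable {J : Π x : M, TangentSpace 𝓘(ℝ, E) x →L[ℝ] TangentSpace 𝓘(ℝ, E) x}

theorem repEnd_chart {x₀ x : M} (hx : x ∈ (chart E x₀).source) (a : E) :
    repEnd x₀ J (chart E x₀ x) a = coord x₀ x (J x (frame x₀ x a)) := by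
  have : ∀ y, y = x → coord x₀ y (J y (frame x₀ y a)) = coord x₀ x (J x (frame x₀ x a)) := by
    rintro y rfl; rfl
  exact this _ ((chart E x₀).left_inv hx)

theorem repEnd_coord {x₀ x : M} (hx : x ∈ (chart E x₀).source) (v : TangentSpace 𝓘(ℝ, E) x) :
    repEnd x₀ J (chart E x₀ x) (coord x₀ x v) = coord x₀ x (J x v) := by
  rw [repEnd_chart hx, frame_coord hx]

theorem contMDiffAt_end_apply (hJ : ContMDiff 𝓘(ℝ, E) (𝓘(ℝ, E).prod 𝓘(ℝ, E →L[ℝ] E)) ∞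
      (fun x ↦ TotalSpace.mk' (E →L[ℝ] E)
        (E := fun x : M ↦ TangentSpace 𝓘(ℝ, E) x →L[ℝ] TangentSpace 𝓘(ℝ, E) x) x (J x)))
    {x : M} {Y : Π x : M, TangentSpace 𝓘(ℝ, E) x}
    (hY : ContMDiffAt 𝓘(ℝ, E) (𝓘(ℝ, E).prod 𝓘(ℝ, E)) ∞ (T% Y) x) :
    ContMDiffAt 𝓘(ℝ, E) (𝓘(ℝ, E).prod 𝓘(ℝ, E)) ∞ (T% fun y ↦ J y (Y y)) x :=
  (hJ x).clm_bundle_apply hY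

theorem contDiffAt_repEnd (hJ : ContMDiff 𝓘(ℝ, E) (𝓘(ℝ, E).prod 𝓘(ℝ, E →L[ℝ] E)) ∞
      (fun x ↦ TotalSpace.mk' (E →L[ℝ] E)
        (E := fun x : M ↦ TangentSpace 𝓘(ℝ, E) x →L[ℝ] TangentSpace 𝓘(ℝ, E) x) x (J x)))
    {x₀ : M} {z : E} (hz : z ∈ (chart E x₀).target) : ContDiffAt ℝ ∞ (repEnd x₀ J) z := by
  have : ContDiffOn ℝ ∞ (repEnd x₀ J) (chart E x₀).target := by
    refine contDiffOn_clm_apply.2 fun a y hy ↦ ?_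
    have hx := (chart E x₀).map_target hy
    have := contDiffAt_rep hx (contMDiffAt_end_apply hJ
      ((contMDiffOn_frame x₀ a).contMDiffAt ((isOpen_source x₀).mem_nhds hx)))
    rw [(chart E x₀).right_inv hy] at this
    exact this.contDiffWithinAt
  exact this.contDiffAt ((isOpen_target x₀).mem_nhds hz)

variable [RiemannianBundle (fun x : M ↦ TangentSpace 𝓘(ℝ, E) x)]
  [IsContMDiffRiemannianBundle 𝓘(ℝ, E) ∞ E (fun x : M ↦ TangentSpace 𝓘(ℝ, E) x)]

/-- Product rule for `J V`: the derivative of the chosen extension `V` of `v` occurs in both terms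
of the definition and cancels. -/
theorem coord_covDerivEnd (hJ : ContMDiff 𝓘(ℝ, E) (𝓘(ℝ, E).prod 𝓘(ℝ, E →L[ℝ] E)) ∞
      (fun x ↦ TotalSpace.mk' (E →L[ℝ] E)
        (E := fun x : M ↦ TangentSpace 𝓘(ℝ, E) x →L[ℝ] TangentSpace 𝓘(ℝ, E) x) x (J x)))
    {x₀ x : M} (hx : x ∈ (chart E x₀).source) (u v : TangentSpace 𝓘(ℝ, E) x) :
    coord x₀ x (covDerivEnd J u v) =
      fderiv ℝ (repEnd x₀ J) (chart E x₀ x) (coord x₀ x u) (coord x₀ x v)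
      + christoffel (metric x₀) (chart E x₀ x) (coord x₀ x u)
        (repEnd x₀ J (chart E x₀ x) (coord x₀ x v))
      - repEnd x₀ J (chart E x₀ x)
        (christoffel (metric x₀) (chart E x₀ x) (coord x₀ x u) (coord x₀ x v)) := by
  have ht := (chart E x₀).map_source hx
  have hV : ContMDiffAt 𝓘(ℝ, E) (𝓘(ℝ, E).prod 𝓘(ℝ, E)) ∞ (T% (extend E v)) x :=
    contMDiffAt_extend ..
  have hVd := (contDiffAt_rep hx hV).differentiableAt (by simp)
  have hJd := (contDiffAt_repEnd hJ ht).differentiableAt (by simp)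
  have hrep : rep x₀ (fun y ↦ J y (extend E v y)) =ᶠ[𝓝 (chart E x₀ x)]
      fun z ↦ repEnd x₀ J z (rep x₀ (extend E v) z) := by
    filter_upwards [(isOpen_target x₀).mem_nhds ht] with z hz
    rw [rep, repEnd, rep]
    simp only [ContinuousLinearMap.comp_apply, frame_coord ((chart E x₀).map_target hz)]
  have h1 := (hJd.hasFDerivAt.clm_apply hVd.hasFDerivAt).congr_of_eventuallyEq hrep
  rw [covDerivEnd, map_sub,
    coord_leviCivita hx ((contMDiffAt_end_apply hJ hV).mdifferentiableAt (by simp)), h1.fderiv,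
    ← repEnd_coord hx (extend E v x), ← repEnd_coord hx (leviCivita 𝓘(ℝ, E) M (extend E v) x u),
    coord_leviCivita hx (hV.mdifferentiableAt (by simp)), map_add]
  simp only [add_apply, ContinuousLinearMap.comp_apply, ContinuousLinearMap.flip_apply,
    rep_chart hx, extend_apply_self]
  abel

end ChartCoordinates

/-! ### Linear differential equations on a compact interval -/

namespace LinearODE

open Set Filter Topology
open scoped NNReal

variable {F : Type*} [NormedAddCommGroup F] [NormedSpace ℝ F]

/-- At the junction both one-sided derivatives are given by the same right-hand side. Away from it
one of the two closed pieces misses `t` and imposes no condition. -/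
theorem hasDerivWithinAt_ite {a b c : ℝ} (hac : a ≤ c) (hcb : c ≤ b) {e₁ e₂ : ℝ → F}
    {f : ℝ → F → F} (h : e₁ c = e₂ c)
    (h₁ : ∀ t ∈ Icc a c, HasDerivWithinAt e₁ (f t (e₁ t)) (Icc a c) t)
    (h₂ : ∀ t ∈ Icc c b, HasDerivWithinAt e₂ (f t (e₂ t)) (Icc c b) t)
    {t : ℝ} (ht : t ∈ Icc a b) :
    HasDerivWithinAt (fun t ↦ if t ≤ c then e₁ t else e₂ t)
      (f t (if t ≤ c then e₁ t else e₂ t)) (Icc a b) t := by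
  set e : ℝ → F := fun t ↦ if t ≤ c then e₁ t else e₂ t with he
  have hl : EqOn e e₁ (Icc a c) := fun s hs ↦ if_pos hs.2
  have hr : EqOn e e₂ (Icc c b) := fun s hs ↦ by
    rcases hs.1.eq_or_lt with rfl | hlt
    · simp only [he, le_refl, if_true, h]
    · exact if_neg hlt.not_ge
  change HasDerivWithinAt e (f t (e t)) (Icc a b) t
  rw [← Icc_union_Icc_eq_Icc hac hcb]
  refine HasDerivWithinAt.union ?_ ?_
  · by_cases htc : t ≤ c
    · have hm : t ∈ Icc a c := ⟨ht.1, htc⟩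
      rw [hl hm]
      exact (h₁ t hm).congr hl (hl hm)
    · exact HasFDerivWithinAt.of_notMem_closure (by rw [isClosed_Icc.closure_eq]; exact fun h ↦ htc h.2)
  · by_cases htc : c ≤ t
    · have hm : t ∈ Icc c b := ⟨htc, ht.2⟩
      rw [hr hm]
      exact (h₂ t hm).congr hr (hr hm)
    · exact HasFDerivWithinAt.of_notMem_closure (by rw [isClosed_Icc.closure_eq]; exact fun h ↦ htc h.1)

variable [CompleteSpace F]

/-- Picard–Lindelöf on the ball of radius `‖x‖` about `x`: there the right-hand side is at most `2 K
‖x‖`, so in time at most `1 / (2K)` the solution cannot leave. -/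
theorem exists_solution_short {A : ℝ → F →L[ℝ] F} {a b : ℝ} (hab : a ≤ b)
    (hA : ContinuousOn A (Icc a b)) {K : ℝ≥0} (hK : ∀ t ∈ Icc a b, ‖A t‖ ≤ K)
    (hs : (b - a) * K ≤ 1 / 2) (x : F) :
    ∃ e : ℝ → F, e a = x ∧ ∀ t ∈ Icc a b, HasDerivWithinAt e (A t (e t)) (Icc a b) t := by
  have hP : IsPicardLindelof (fun t y ↦ A t y) (⟨a, left_mem_Icc.2 hab⟩ : Icc a b) x ‖x‖₊ 0
      (2 * K * ‖x‖₊) K := by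
    constructor
    · intro t ht
      exact (((A t).lipschitz).weaken (hK t ht)).lipschitzOnWith
    · intro y _
      exact hA.clm_apply continuousOn_const
    · intro t ht y hy
      have hy' : ‖y‖ ≤ 2 * ‖x‖ := by
        rw [mem_closedBall_iff_norm] at hy
        have := norm_le_norm_add_norm_sub' y x
        rw [coe_nnnorm] at hy
        linarith
      push_cast
      calc ‖A t y‖ ≤ ‖A t‖ * ‖y‖ := (A t).le_opNorm y
        _ ≤ K * (2 * ‖x‖) := by gcongr; exact hK t ht
        _ = _ := by ring
    · simp only [sub_self, NNReal.coe_zero, sub_zero]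
      rw [max_eq_left (sub_nonneg.2 hab)]
      push_cast
      nlinarith [norm_nonneg x]
  exact hP.exists_eq_forall_mem_Icc_hasDerivWithinAt₀

/-- A linear differential equation with continuous coefficients has solutions on the whole interval
for all initial values. -/
theorem exists_solution {A : ℝ → F →L[ℝ] F} {a b : ℝ} (hab : a ≤ b)
    (hA : ContinuousOn A (Icc a b)) (x : F) :
    ∃ e : ℝ → F, e a = x ∧ ∀ t ∈ Icc a b, HasDerivWithinAt e (A t (e t)) (Icc a b) t := by
  obtain ⟨K, hK⟩ := isCompact_Icc.exists_bound_of_continuousOn hA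
  have main : ∀ (N : ℕ) (c : ℝ) (y : F), c ∈ Icc a b → (b - c) * (max K 0) ≤ N / 2 →
      ∃ e : ℝ → F, e c = y ∧ ∀ t ∈ Icc c b, HasDerivWithinAt e (A t (e t)) (Icc c b) t := by
    intro N
    induction N with
    | zero =>
      intro c y hc h
      exact exists_solution_short (K := (max K 0).toNNReal) hc.2
        (hA.mono (Icc_subset_Icc_left hc.1))
        (fun t ht ↦ (hK t ⟨hc.1.trans ht.1, ht.2⟩).trans (by simp)) (by
          rw [Real.coe_toNNReal _ (le_max_right _ _)]; push_cast at h; linarith) y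
    | succ N ih =>
      intro c y hc h
      have hN : (0 : ℝ) < N + 1 := by positivity
      -- Cutting off the fraction `1 / (N + 1)` leaves a first piece short enough for
      -- `exists_solution_short` and a remainder to which the induction hypothesis for `N` applies.
      set d := c + (b - c) / (N + 1) with hd
      have hbc : 0 ≤ b - c := sub_nonneg.2 hc.2
      have hcd : c ≤ d := by rw [hd]; have := div_nonneg hbc hN.le; linarith
      have hdb : b - d = (b - c) * (N / (N + 1)) := by rw [hd]; field_simp; ring
      have hdb' : d ≤ b := by
        have : 0 ≤ (b - c) * (N / (N + 1)) := by positivity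
        linarith
      push_cast at h
      have hK0 : 0 ≤ max K 0 := le_max_right _ _
      obtain ⟨e₁, h1, h1'⟩ := exists_solution_short (A := A) (K := (max K 0).toNNReal) hcd
        (hA.mono (Icc_subset_Icc hc.1 hdb'))
        (fun t ht ↦ (hK t ⟨hc.1.trans ht.1, ht.2.trans hdb'⟩).trans (by simp)) (by
          rw [Real.coe_toNNReal _ hK0, hd, add_sub_cancel_left, div_mul_eq_mul_div,
            div_le_iff₀ hN]
          linarith) y
      obtain ⟨e₂, h2, h2'⟩ := ih d (e₁ d) ⟨hc.1.trans hcd, hdb'⟩ (by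
        rw [hdb]
        calc (b - c) * (N / (N + 1)) * max K 0 = (b - c) * max K 0 * (N / (N + 1)) := by ring
          _ ≤ (N + 1) / 2 * (N / (N + 1)) := by gcongr
          _ = N / 2 := by field_simp)
      exact ⟨_, (if_pos hcd).trans h1, fun t ht ↦
        hasDerivWithinAt_ite (f := fun t y ↦ A t y) hcd hdb' h2.symm h1' h2' ht⟩
  obtain ⟨N, hN⟩ := exists_nat_ge (2 * ((b - a) * max K 0))
  exact main N a x (left_mem_Icc.2 hab) (by linarith)

end LinearODE

/-! ### Minimizing curves in a Riemannian manifold -/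

namespace ChartCoordinates

open Set Filter Topology LocalMetric
open scoped NNReal

variable {E : Type*} [NormedAddCommGroup E] [NormedSpace ℝ E] [FiniteDimensional ℝ E]
  {M : Type*} [MetricSpace M] [ChartedSpace E M] [IsManifold 𝓘(ℝ, E) ∞ M]
  [RiemannianBundle (fun x : M ↦ TangentSpace 𝓘(ℝ, E) x)]
  [IsContMDiffRiemannianBundle 𝓘(ℝ, E) ∞ E (fun x : M ↦ TangentSpace 𝓘(ℝ, E) x)]
  [IsRiemannianManifold 𝓘(ℝ, E) M]

variable (E) in
/-- The chart at `x₀` maps the image of `S` under `γ` into a ball on which it is Lipschitz in both directions. -/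
def IsAdapted (γ : ℝ → M) (x₀ : M) (S : Set ℝ) : Prop :=
  ∃ (z : E) (r : ℝ) (C : ℝ≥0), Metric.ball z r ⊆ (chart E x₀).target ∧
    (∀ y ∈ Metric.ball z r, ∀ y' ∈ Metric.ball z r,
      dist ((chart E x₀).symm y) ((chart E x₀).symm y') ≤ C * dist y y' ∧
      dist y y' ≤ C * dist ((chart E x₀).symm y) ((chart E x₀).symm y')) ∧
    ∀ t ∈ S, γ t ∈ (chart E x₀).source ∧ chart E x₀ (γ t) ∈ Metric.ball z r

theorem IsAdapted.mono {γ : ℝ → M} {x₀ : M} {S T : Set ℝ} (h : IsAdapted E γ x₀ S) (hTS : T ⊆ S) :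
    IsAdapted E γ x₀ T := by
  obtain ⟨z, r, C, h1, h2, h3⟩ := h
  exact ⟨z, r, C, h1, h2, fun t ht ↦ h3 t (hTS ht)⟩

theorem IsAdapted.mem_source {γ : ℝ → M} {x₀ : M} {S : Set ℝ} (h : IsAdapted E γ x₀ S) {t : ℝ}
    (ht : t ∈ S) : γ t ∈ (chart E x₀).source := by
  obtain ⟨z, r, C, h1, h2, h3⟩ := h
  exact (h3 t ht).1

variable {γ : ℝ → M} {ℓ : ℝ}

theorem continuousOn_of_minimizing
    (hγ : ∀ s ∈ Icc 0 ℓ, ∀ t ∈ Icc 0 ℓ, dist (γ s) (γ t) = |s - t|) : ContinuousOn γ (Icc 0 ℓ) := by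
  have : LipschitzOnWith 1 γ (Icc 0 ℓ) := LipschitzOnWith.of_dist_le_mul fun s hs t ht ↦ by
    rw [hγ s hs t ht, Real.dist_eq]; simp
  exact this.continuousOn

theorem exists_isAdapted {S : Set ℝ} {t : ℝ} (hγ : ContinuousWithinAt γ S t) :
    ∃ δ > 0, IsAdapted E γ (γ t) (S ∩ Metric.ball t δ) := by
  obtain ⟨r, hr, C, h1, h2⟩ :=
    exists_ball_dist_comparable (E := E) (mem_extChartAt_target (I := 𝓘(ℝ, E)) (γ t))
  have hs : ∀ᶠ y in 𝓝 (γ t), y ∈ (chart E (γ t)).source := extChartAt_source_mem_nhds _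
  have hc : ContinuousAt (chart E (γ t)) (γ t) := continuousAt_extChartAt _
  have h3 := hγ.eventually (hs.and (hc.eventually (Metric.ball_mem_nhds _ hr)))
  obtain ⟨δ, hδ, hδS⟩ := Metric.mem_nhdsWithin_iff.1 h3
  exact ⟨δ, hδ, _, r, C, h1, h2, fun s hs ↦ hδS ⟨hs.2, hs.1⟩⟩

/-- Chain rule for the transition map: a velocity found in one chart is the velocity in every chart.
-/
theorem hasDerivWithinAt_chart_of_hasDerivWithinAt {x₀ x₁ : M} {S : Set ℝ} {t : ℝ}
    (hγ : ContinuousWithinAt γ S t) (h₀ : γ t ∈ (chart E x₀).source)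
    (h₁ : γ t ∈ (chart E x₁).source) {X : TangentSpace 𝓘(ℝ, E) (γ t)}
    (h : HasDerivWithinAt (fun s ↦ chart E x₀ (γ s)) (coord x₀ (γ t) X) S t) :
    HasDerivWithinAt (fun s ↦ chart E x₁ (γ s)) (coord x₁ (γ t) X) S t := by
  have hψ : (chart E x₀).symm (chart E x₀ (γ t)) = γ t := (chart E x₀).left_inv h₀
  have hT := hasFDerivAt_transition (x₁ := x₁) ((chart E x₀).map_source h₀) (by rwa [hψ])
  have h2 := hT.comp_hasDerivWithinAt t h
  have hd : (coord x₁ ((chart E x₀).symm (chart E x₀ (γ t))) ∘L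
      frame x₀ ((chart E x₀).symm (chart E x₀ (γ t)))) (coord x₀ (γ t) X) = coord x₁ (γ t) X := by
    have : ∀ y, y = γ t → (coord x₁ y ∘L frame x₀ y) (coord x₀ (γ t) X) = coord x₁ (γ t) X := by
      rintro y rfl
      change coord x₁ (γ t) (frame x₀ (γ t) (coord x₀ (γ t) X)) = _
      rw [frame_coord h₀]
    exact this _ hψ
  rw [hd] at h2
  refine h2.congr_of_eventuallyEq ?_ ?_
  · filter_upwards [hγ.eventually ((isOpen_source x₀).eventually_mem h₀)] with s hs
    exact congrArg (chart E x₁) ((chart E x₀).left_inv hs).symm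
  · exact congrArg (chart E x₁) hψ.symm

/-- `X` is the velocity field of `γ` on `[0, ℓ]`. -/
def IsVelocity (γ : ℝ → M) (ℓ : ℝ) (X : Π t, TangentSpace 𝓘(ℝ, E) (γ t)) : Prop :=
  ∀ (x₀ : M), ∀ t ∈ Icc 0 ℓ, γ t ∈ (chart E x₀).source →
    HasDerivWithinAt (fun s ↦ chart E x₀ (γ s)) (coord x₀ (γ t) (X t)) (Icc 0 ℓ) t

-- Regularity in the chart centred at `γ t`, on a short interval around `t` cut off at `0` and `ℓ`,
-- supplies a velocity at `t`; the chain rule carries it to all other charts.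
variable (E) in
theorem exists_isVelocity (hℓ : 0 < ℓ)
    (hγ : ∀ s ∈ Icc 0 ℓ, ∀ t ∈ Icc 0 ℓ, dist (γ s) (γ t) = |s - t|) :
    ∃ X : Π t, TangentSpace 𝓘(ℝ, E) (γ t), IsVelocity γ ℓ X := by
  have hc := continuousOn_of_minimizing hγ
  have key : ∀ t, ∃ X : TangentSpace 𝓘(ℝ, E) (γ t), t ∈ Icc 0 ℓ →
      HasDerivWithinAt (fun s ↦ chart E (γ t) (γ s)) (coord (γ t) (γ t) X) (Icc 0 ℓ) t := by
    intro t
    by_cases ht : t ∈ Icc 0 ℓ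
    swap
    · exact ⟨0, fun h ↦ absurd h ht⟩
    obtain ⟨δ, hδ, z, r, C, h1, h2, h3⟩ := exists_isAdapted (E := E) (hc t ht)
    set a := max 0 (t - δ / 2) with ha
    set b := min ℓ (t + δ / 2) with hb
    have hab : a < b := by
      rw [ha, hb, max_lt_iff, lt_min_iff, lt_min_iff]
      exact ⟨⟨hℓ, by linarith [ht.1]⟩, by linarith [ht.2], by linarith⟩
    have hsub : Icc a b ⊆ Icc 0 ℓ ∩ Metric.ball t δ := by
      intro s hs
      have h4 := max_le_iff.1 hs.1
      have h5 := le_min_iff.1 hs.2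
      refine ⟨⟨h4.1, h5.1⟩, ?_⟩
      rw [Metric.mem_ball, Real.dist_eq, abs_lt]
      constructor <;> linarith [h4.2, h5.2]
    have htab : t ∈ Icc a b := ⟨max_le ht.1 (by linarith), le_min ht.2 (by linarith)⟩
    obtain ⟨v, hv⟩ := exists_velocity h1 h2 hab
      (fun s hs t ht ↦ hγ s (hsub hs).1 t (hsub ht).1) (fun s hs ↦ (h3 s (hsub hs)).1)
      (fun s hs ↦ (h3 s (hsub hs)).2)
    refine ⟨frame (γ t) (γ t) (v t), fun _ ↦ ?_⟩
    have he : coord (γ t) (γ t) (frame (γ t) (γ t) (v t)) = v t :=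
      coord_frame (mem_extChartAt_source (γ t)) (v t)
    rw [he]
    refine (hv t htab).1.mono_of_mem_nhdsWithin ?_
    rw [mem_nhdsWithin]
    refine ⟨Ioo (t - δ / 2) (t + δ / 2), isOpen_Ioo, ⟨by linarith, by linarith⟩, fun s hs ↦ ?_⟩
    exact ⟨max_le hs.2.1 hs.1.1.le, le_min hs.2.2 hs.1.2.le⟩
  choose X hX using key
  exact ⟨X, fun x₀ t ht hx ↦ hasDerivWithinAt_chart_of_hasDerivWithinAt (hc t ht)
    (mem_extChartAt_source (γ t)) hx (hX t ht)⟩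

/-- The velocity of a minimizing curve satisfies the geodesic equation in adapted charts. -/
theorem IsVelocity.geodesic {X : Π t, TangentSpace 𝓘(ℝ, E) (γ t)} (hX : IsVelocity γ ℓ X)
    (hγ : ∀ s ∈ Icc 0 ℓ, ∀ t ∈ Icc 0 ℓ, dist (γ s) (γ t) = |s - t|)
    {x₀ : M} {a b : ℝ} (hab : a < b) (hsub : Icc a b ⊆ Icc 0 ℓ)
    (had : IsAdapted E γ x₀ (Icc a b)) {t : ℝ} (ht : t ∈ Icc a b) :
    HasDerivWithinAt (fun s ↦ chart E x₀ (γ s)) (coord x₀ (γ t) (X t)) (Icc a b) t ∧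
      HasDerivWithinAt (fun s ↦ coord x₀ (γ s) (X s))
        (-christoffel (metric x₀) (chart E x₀ (γ t)) (coord x₀ (γ t) (X t)) (coord x₀ (γ t) (X t)))
        (Icc a b) t ∧
      inner ℝ (X t) (X t) = 1 := by
  obtain ⟨z, r, C, h1, h2, h3⟩ := had
  obtain ⟨v, hv⟩ := exists_velocity h1 h2 hab
    (fun s hs t ht ↦ hγ s (hsub hs) t (hsub ht)) (fun s hs ↦ (h3 s hs).1) (fun s hs ↦ (h3 s hs).2)
  have hXd : ∀ s ∈ Icc a b,
      HasDerivWithinAt (fun s ↦ chart E x₀ (γ s)) (coord x₀ (γ s) (X s)) (Icc a b) s := fun s hs ↦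
    (hX x₀ s (hsub hs) (h3 s hs).1).mono hsub
  have heq : ∀ s ∈ Icc a b, coord x₀ (γ s) (X s) = v s := fun s hs ↦
    (uniqueDiffOn_Icc hab s hs).eq_deriv _ (hXd s hs) (hv s hs).1
  obtain ⟨-, h5, h6⟩ := hv t ht
  refine ⟨hXd t ht, ?_, ?_⟩
  · rw [heq t ht]
    exact h5.congr heq (heq t ht)
  · rw [← metric_coord (h3 t ht).1, heq t ht]
    exact h6

/-- `γ` is a minimizing curve on `[0, ℓ]` with velocity `X`, and the chart at `x j` is adapted to
`γ` on the interval `[τ j, τ (j + 1)]` of a partition of `[0, ℓ]` into `N` intervals. -/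
structure IsMinimizingChain (γ : ℝ → M) (ℓ : ℝ) (X : Π t, TangentSpace 𝓘(ℝ, E) (γ t)) (N : ℕ)
    (τ : ℕ → ℝ) (x : ℕ → M) : Prop where
  velocity : IsVelocity γ ℓ X
  dist_eq : ∀ s ∈ Icc 0 ℓ, ∀ t ∈ Icc 0 ℓ, dist (γ s) (γ t) = |s - t|
  zero : τ 0 = 0
  last : τ N = ℓ
  strictMono : StrictMono τ
  mem_source : ∀ j ≤ N, γ (τ j) ∈ (chart E (x j)).source
  adapted : ∀ j < N, IsAdapted E γ (x j) (Icc (τ j) (τ (j + 1)))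

-- A uniform partition finer than a Lebesgue number of the cover of `[0, ℓ]` by adapted intervals.
-- The chart `x N` serves no interval; it only gives the last vertex a chart, so that sums over
-- vertices have the same form throughout.
variable (E) in
theorem exists_isMinimizingChain (hℓ : 0 < ℓ)
    (hγ : ∀ s ∈ Icc 0 ℓ, ∀ t ∈ Icc 0 ℓ, dist (γ s) (γ t) = |s - t|) :
    ∃ (X : Π t, TangentSpace 𝓘(ℝ, E) (γ t)) (N : ℕ) (τ : ℕ → ℝ) (x : ℕ → M),
      IsMinimizingChain γ ℓ X N τ x := by
  obtain ⟨X, hX⟩ := exists_isVelocity E hℓ hγ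
  have hγc := continuousOn_of_minimizing hγ
  choose! δ hδ had using fun t (ht : t ∈ Icc 0 ℓ) ↦ exists_isAdapted (E := E) (hγc t ht)
  obtain ⟨η, hη, hleb⟩ := lebesgue_number_lemma_of_metric (c := fun t : Icc 0 ℓ ↦
    Metric.ball (t : ℝ) (δ t)) (isCompact_Icc (a := (0 : ℝ)) (b := ℓ))
    (fun t ↦ Metric.isOpen_ball) fun t ht ↦ mem_iUnion.2 ⟨⟨t, ht⟩, Metric.mem_ball_self (hδ t ht)⟩
  obtain ⟨N, hN⟩ := exists_nat_gt (ℓ / η)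
  have hN0 : (0 : ℝ) < N := (div_pos hℓ hη).trans hN
  have hstep : ℓ / N < η := by rw [div_lt_comm₀ hN0 hη]; exact hN
  have hstep0 : 0 < ℓ / N := div_pos hℓ hN0
  set τ : ℕ → ℝ := fun j ↦ j * (ℓ / N) with hτ
  have hτN : τ N = ℓ := by simp only [hτ]; field_simp
  have hmem : ∀ j ≤ N, τ j ∈ Icc 0 ℓ := fun j hj ↦ by
    refine ⟨by positivity, ?_⟩
    rw [← hτN]
    simp only [hτ]
    gcongr
  have : Nonempty (Icc 0 ℓ) := ⟨⟨0, left_mem_Icc.2 hℓ.le⟩⟩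
  choose! i hi using fun j (hj : j ≤ N) ↦ hleb (τ j) (hmem j hj)
  have hsucc : ∀ j, τ (j + 1) = τ j + ℓ / N := fun j ↦ by simp only [hτ]; push_cast; ring
  refine ⟨X, N, τ, fun j ↦ γ (i j), hX, hγ, by simp [hτ], hτN,
    strictMono_nat_of_lt_succ fun j ↦ by rw [hsucc]; linarith, fun j hj ↦ ?_, fun j hj ↦ ?_⟩
  · exact (had _ (i j).2).mem_source ⟨hmem j hj, hi j hj (Metric.mem_ball_self hη)⟩
  · refine (had _ (i j).2).mono fun t ht ↦ ⟨⟨(hmem j hj.le).1.trans ht.1,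
      ht.2.trans (hmem (j + 1) hj).2⟩, hi j hj.le ?_⟩
    rw [Metric.mem_ball, Real.dist_eq, abs_of_nonneg (by linarith [ht.1])]
    have := ht.2
    rw [hsucc] at this
    linarith

namespace IsMinimizingChain

variable {X : Π t, TangentSpace 𝓘(ℝ, E) (γ t)} {N : ℕ} {τ : ℕ → ℝ} {x : ℕ → M}

theorem lt_succ (h : IsMinimizingChain γ ℓ X N τ x) (j : ℕ) : τ j < τ (j + 1) :=
  h.strictMono (Nat.lt_succ_self j)

theorem subset_Icc (h : IsMinimizingChain γ ℓ X N τ x) {j : ℕ} (hj : j < N) :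
    Icc (τ j) (τ (j + 1)) ⊆ Icc 0 ℓ := by
  refine Icc_subset_Icc ?_ ?_
  · rw [← h.zero]; exact h.strictMono.monotone (Nat.zero_le _)
  · rw [← h.last]; exact h.strictMono.monotone hj

theorem nonneg (h : IsMinimizingChain γ ℓ X N τ x) : 0 ≤ ℓ := by
  rw [← h.zero, ← h.last]; exact h.strictMono.monotone (Nat.zero_le _)

theorem source (h : IsMinimizingChain γ ℓ X N τ x) {j : ℕ} (hj : j < N) {t : ℝ}
    (ht : t ∈ Icc (τ j) (τ (j + 1))) : γ t ∈ (chart E (x j)).source :=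
  (h.adapted j hj).mem_source ht

theorem geodesic (h : IsMinimizingChain γ ℓ X N τ x) {j : ℕ} (hj : j < N) {t : ℝ}
    (ht : t ∈ Icc (τ j) (τ (j + 1))) :
    HasDerivWithinAt (fun s ↦ chart E (x j) (γ s)) (coord (x j) (γ t) (X t))
        (Icc (τ j) (τ (j + 1))) t ∧
      HasDerivWithinAt (fun s ↦ coord (x j) (γ s) (X s))
        (-christoffel (metric (x j)) (chart E (x j) (γ t)) (coord (x j) (γ t) (X t))
          (coord (x j) (γ t) (X t))) (Icc (τ j) (τ (j + 1))) t ∧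
      inner ℝ (X t) (X t) = 1 :=
  h.velocity.geodesic h.dist_eq (h.lt_succ j) (h.subset_Icc hj) (h.adapted j hj) ht

end IsMinimizingChain

end ChartCoordinates

/-! ### Second variation of a minimizing curve across charts -/

namespace ChartCoordinates

open Set Filter Topology LocalMetric
open scoped NNReal

variable {E : Type*} [NormedAddCommGroup E] [NormedSpace ℝ E] [FiniteDimensional ℝ E]
  {M : Type*} [MetricSpace M] [ChartedSpace E M] [IsManifold 𝓘(ℝ, E) ∞ M]
  [RiemannianBundle (fun x : M ↦ TangentSpace 𝓘(ℝ, E) x)]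
  [IsContMDiffRiemannianBundle 𝓘(ℝ, E) ∞ E (fun x : M ↦ TangentSpace 𝓘(ℝ, E) x)]
  [IsRiemannianManifold 𝓘(ℝ, E) M] {γ : ℝ → M} {ℓ : ℝ}

/-- The point reached in time `s` by the curve that starts with velocity `V` and has, up to second
order, no acceleration in the chart at `x₀`. -/
def varPoint (x₀ : M) {x : M} (V : TangentSpace 𝓘(ℝ, E) x) (s : ℝ) : M :=
  (chart E x₀).symm (osculating (metric x₀) (chart E x₀ x) (coord x₀ x V) s)

theorem varPoint_zero {x₀ x : M} (hx : x ∈ (chart E x₀).source) (s : ℝ) :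
    varPoint x₀ (0 : TangentSpace 𝓘(ℝ, E) x) s = x := by
  simp only [varPoint, map_zero, osculating, smul_zero, add_zero, neg_zero]
  exact (chart E x₀).left_inv hx

/-- The second variation formula, as an upper bound for the distance between the end points of the
varied curve. -/
theorem eventually_dist_varPoint_le {X : Π t, TangentSpace 𝓘(ℝ, E) (γ t)} (hX : IsVelocity γ ℓ X)
    (hγ : ∀ s ∈ Icc 0 ℓ, ∀ t ∈ Icc 0 ℓ, dist (γ s) (γ t) = |s - t|)
    {x₀ : M} {a b : ℝ} (hab : a < b) (hsub : Icc a b ⊆ Icc 0 ℓ)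
    (had : IsAdapted E γ x₀ (Icc a b)) {W : Π t, TangentSpace 𝓘(ℝ, E) (γ t)} {V' : ℝ → E}
    (hV : ∀ t ∈ Icc a b, HasDerivWithinAt (fun t ↦ coord x₀ (γ t) (W t)) (V' t) (Icc a b) t)
    (hV' : ContinuousOn V' (Icc a b)) (hperp : ∀ t ∈ Icc a b, inner ℝ (X t) (W t) = 0)
    {ε : ℝ} (hε : 0 < ε) :
    ∀ᶠ s in 𝓝[>] (0 : ℝ), dist (varPoint x₀ (W a) s) (varPoint x₀ (W b) s) ≤
      (b - a) + s ^ 2 / 2 * ((∫ t in a..b, indexForm (metric x₀) (chart E x₀ (γ t))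
        (coord x₀ (γ t) (X t)) (coord x₀ (γ t) (W t)) (V' t)) + ε) := by
  have hgeo := fun t ht ↦ hX.geodesic hγ hab hsub had (t := t) ht
  have hs := fun t ht ↦ had.mem_source (t := t) ht
  obtain ⟨z, r, C, h1, h2, h3⟩ := had
  have hg := (isMetricOn_metric (E := E) x₀).mono (Metric.isOpen_ball (x := z) (ε := r)) h1
  have hev := hg.eventually_energy_le hab (fun t ht ↦ (h3 t ht).2) (fun t ht ↦ (hgeo t ht).1)
    (fun t ht ↦ (hgeo t ht).2.1) (fun t ht ↦ by rw [metric_coord (hs t ht)]; exact (hgeo t ht).2.2)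
    hV hV' (fun t ht ↦ by rw [metric_coord (hs t ht)]; exact hperp t ht) hε
  filter_upwards [hev] with s hs
  obtain ⟨h4, ⟨K, h5⟩, h6⟩ := hs
  exact (dist_le_energy h1 (fun y hy y' hy' ↦ (h2 y hy y' hy').1) hab.le h5 h4).trans h6

/-- The second variation of a minimizing curve is nonnegative. -/
theorem IsMinimizingChain.sum_indexForm_nonneg {X : Π t, TangentSpace 𝓘(ℝ, E) (γ t)}
    {N : ℕ} {τ : ℕ → ℝ} {x : ℕ → M} (h : IsMinimizingChain γ ℓ X N τ x)
    {W : Π t, TangentSpace 𝓘(ℝ, E) (γ t)} {V' : ℕ → ℝ → E}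
    (hV : ∀ j < N, ∀ t ∈ Icc (τ j) (τ (j + 1)),
      HasDerivWithinAt (fun t ↦ coord (x j) (γ t) (W t)) (V' j t) (Icc (τ j) (τ (j + 1))) t)
    (hV' : ∀ j < N, ContinuousOn (V' j) (Icc (τ j) (τ (j + 1))))
    (hperp : ∀ j < N, ∀ t ∈ Icc (τ j) (τ (j + 1)), inner ℝ (X t) (W t) = 0)
    (hW0 : W 0 = 0) (hWℓ : W ℓ = 0) :
    0 ≤ ∑ j ∈ Finset.range N, ∫ t in τ j..τ (j + 1), indexForm (metric (x j))
      (chart E (x j) (γ t)) (coord (x j) (γ t) (X t)) (coord (x j) (γ t) (W t)) (V' j t) := by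
  set I : ℕ → ℝ := fun j ↦ ∫ t in τ j..τ (j + 1), indexForm (metric (x j))
      (chart E (x j) (γ t)) (coord (x j) (γ t) (X t)) (coord (x j) (γ t) (W t)) (V' j t) with hI
  -- Each interval costs `ε` from the energy estimate in its chart and `2ε` from replacing the
  -- varied end point by the one in the next chart, since an error `ε s²` is `(s²/2) · 2ε`.
  have key : ∀ ε > 0, 0 ≤ ∑ j ∈ Finset.range N, (I j + 3 * ε) := by
    intro ε hε
    have e1 : ∀ᶠ s in 𝓝[>] (0 : ℝ), ∀ j ∈ Finset.range N,
        dist (varPoint (x j) (W (τ j)) s) (varPoint (x (j + 1)) (W (τ (j + 1))) s) ≤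
          (τ (j + 1) - τ j) + s ^ 2 / 2 * (I j + 3 * ε) := by
      rw [Filter.eventually_all_finset]
      intro j hj
      rw [Finset.mem_range] at hj
      have h1 := eventually_dist_varPoint_le h.velocity h.dist_eq (h.lt_succ j)
        (h.subset_Icc hj) (h.adapted j hj) (hV j hj)
        (hV' j hj) (hperp j hj) hε
      have h2 := (isLittleO_dist_osculating (h.source hj (right_mem_Icc.2 (h.lt_succ j).le))
        (h.mem_source (j + 1) hj) (W (τ (j + 1)))).def hε
      filter_upwards [h1, h2.filter_mono nhdsWithin_le_nhds] with s h1 h2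
      rw [Real.norm_of_nonneg dist_nonneg, Real.norm_of_nonneg (sq_nonneg s)] at h2
      have h3 : dist (varPoint (x j) (W (τ (j + 1))) s) (varPoint (x (j + 1)) (W (τ (j + 1))) s) ≤
        ε * s ^ 2 := h2
      refine (dist_triangle _ (varPoint (x j) (W (τ (j + 1))) s) _).trans ?_
      change _ ≤ (τ (j + 1) - τ j) + s ^ 2 / 2 * (I j + ε) at h1
      nlinarith
    obtain ⟨s, hs, hs0⟩ := (e1.and self_mem_nhdsWithin).exists
    have hs0' : 0 < s := hs0
    have h0 : varPoint (x 0) (W (τ 0)) s = γ 0 := by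
      have : W (τ 0) = 0 := by rw [h.zero]; exact hW0
      rw [this, varPoint_zero (h.mem_source 0 (Nat.zero_le _)), h.zero]
    have hN : varPoint (x N) (W (τ N)) s = γ ℓ := by
      have : W (τ N) = 0 := by rw [h.last]; exact hWℓ
      rw [this, varPoint_zero (h.mem_source N le_rfl), h.last]
    -- The varied vertices still lead from `γ 0` to `γ ℓ`, at distance `ℓ`. The lengths of the
    -- intervals telescope to `ℓ`, and the second order terms must be nonnegative.
    have h1 := dist_le_range_sum_dist (fun j ↦ varPoint (x j) (W (τ j)) s) N
    have hℓ : 0 ≤ ℓ := h.nonneg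
    rw [h0, hN, h.dist_eq 0 (left_mem_Icc.2 hℓ) ℓ (right_mem_Icc.2 hℓ), abs_sub_comm, sub_zero,
      abs_of_nonneg hℓ] at h1
    have h2 := h1.trans (Finset.sum_le_sum hs)
    rw [Finset.sum_add_distrib, Finset.sum_range_sub, h.last, h.zero, sub_zero, ← Finset.mul_sum] at h2
    have h3 : 0 ≤ s ^ 2 / 2 * ∑ j ∈ Finset.range N, (I j + 3 * ε) := by linarith
    exact nonneg_of_mul_nonneg_right h3 (by positivity)
  refine le_of_forall_pos_le_add fun ε hε ↦ ?_
  have hk := key (ε / (3 * (N + 1))) (by positivity)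
  rw [Finset.sum_add_distrib, Finset.sum_const, Finset.card_range, nsmul_eq_mul] at hk
  have h2 : (N : ℝ) * (3 * (ε / (3 * (N + 1)))) ≤ ε := by
    have : (N : ℝ) * (3 * (ε / (3 * (N + 1)))) = ε * (N / (N + 1)) := by field_simp
    rw [this]
    have : (N : ℝ) / (N + 1) ≤ 1 := by rw [div_le_one (by positivity)]; linarith
    nlinarith
  linarith

end ChartCoordinates

/-! ### Covariant derivatives along curves -/

/-- The equation `∇g = 0` in coordinates. -/
theorem LocalMetric.IsMetricOn.fderiv_eq {E : Type*} [NormedAddCommGroup E] [NormedSpace ℝ E]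
    [FiniteDimensional ℝ E] {g : E → E →L[ℝ] E →L[ℝ] ℝ} {U : Set E} (hg : IsMetricOn g U) {z : E}
    (hz : z ∈ U) (c a b : E) :
    fderiv ℝ g z c a b = g z (christoffel g z c a) b + g z a (christoffel g z c b) := by
  rw [hg.symm z hz a, hg.apply_christoffel hz, hg.apply_christoffel hz, hg.fderiv_symm hz a c b,
    hg.fderiv_symm hz b c a, hg.fderiv_symm hz c b a]
  ring

namespace ChartCoordinates

open Set Filter Topology LocalMetric AlmostHermitian
open scoped NNReal

variable {E : Type*} [NormedAddCommGroup E] [NormedSpace ℝ E] [FiniteDimensional ℝ E]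
  {M : Type*} [TopologicalSpace M] [ChartedSpace E M] [IsManifold 𝓘(ℝ, E) ∞ M]
  [RiemannianBundle (fun x : M ↦ TangentSpace 𝓘(ℝ, E) x)]
  [IsContMDiffRiemannianBundle 𝓘(ℝ, E) ∞ E (fun x : M ↦ TangentSpace 𝓘(ℝ, E) x)]
  {γ : ℝ → M}

/-- On `S`, the curve `γ` stays in the chart at `x₀` and has the velocity `X`. -/
structure IsChartCurve (γ : ℝ → M) (X : Π t, TangentSpace 𝓘(ℝ, E) (γ t)) (x₀ : M) (S : Set ℝ) :
    Prop where
  source : ∀ t ∈ S, γ t ∈ (chart E x₀).source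
  hasDeriv : ∀ t ∈ S, HasDerivWithinAt (fun s ↦ chart E x₀ (γ s)) (coord x₀ (γ t) (X t)) S t

/-- The field `D` is the covariant derivative of the field `e` along the curve `γ` with velocity
`X` on `S`, computed in the chart at `x₀`, and it is continuous. -/
structure HasCovDeriv (X : Π t, TangentSpace 𝓘(ℝ, E) (γ t)) (x₀ : M) (S : Set ℝ)
    (e D : Π t, TangentSpace 𝓘(ℝ, E) (γ t)) : Prop where
  hasDeriv : ∀ t ∈ S, HasDerivWithinAt (fun s ↦ coord x₀ (γ s) (e s))
    (coord x₀ (γ t) (D t)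
      - christoffel (metric x₀) (chart E x₀ (γ t)) (coord x₀ (γ t) (X t)) (coord x₀ (γ t) (e t)))
    S t
  continuousOn : ContinuousOn (fun t ↦ coord x₀ (γ t) (D t)) S

variable {X : Π t, TangentSpace 𝓘(ℝ, E) (γ t)} {x₀ : M} {S : Set ℝ}

namespace IsChartCurve

theorem mem_target (hc : IsChartCurve γ X x₀ S) {t : ℝ} (ht : t ∈ S) :
    chart E x₀ (γ t) ∈ (chart E x₀).target :=
  (chart E x₀).map_source (hc.source t ht)

theorem continuousOn (hc : IsChartCurve γ X x₀ S) : ContinuousOn (fun t ↦ chart E x₀ (γ t)) S :=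
  fun t ht ↦ (hc.hasDeriv t ht).continuousWithinAt

theorem continuousOn_comp (hc : IsChartCurve γ X x₀ S) {F : Type*} [TopologicalSpace F] {f : E → F}
    (hf : ∀ t ∈ S, ContinuousAt f (chart E x₀ (γ t))) :
    ContinuousOn (fun t ↦ f (chart E x₀ (γ t))) S := fun t ht ↦
  ContinuousAt.comp_continuousWithinAt (f := fun t ↦ chart E x₀ (γ t)) (hf t ht)
    (hc.continuousOn t ht)

theorem continuousOn_metric (hc : IsChartCurve γ X x₀ S) :
    ContinuousOn (fun t ↦ metric x₀ (chart E x₀ (γ t))) S := hc.continuousOn_comp fun _ ht ↦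
  ((isMetricOn_metric x₀).contDiffAt (hc.mem_target ht)).continuousAt

theorem continuousOn_christoffel (hc : IsChartCurve γ X x₀ S) :
    ContinuousOn (fun t ↦ christoffel (metric x₀) (chart E x₀ (γ t))) S :=
  hc.continuousOn_comp fun _ ht ↦
    ((isMetricOn_metric x₀).contDiffAt_christoffel (hc.mem_target ht)).continuousAt

end IsChartCurve

namespace HasCovDeriv

variable {e D e' D' : Π t, TangentSpace 𝓘(ℝ, E) (γ t)}

theorem continuousOn_coord (he : HasCovDeriv X x₀ S e D) :
    ContinuousOn (fun t ↦ coord x₀ (γ t) (e t)) S :=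
  fun t ht ↦ (he.hasDeriv t ht).continuousWithinAt

/-- In the product rule the Christoffel terms cancel against the derivative of the metric, by
`fderiv_eq`. -/
theorem hasDerivWithinAt_inner (hc : IsChartCurve γ X x₀ S) (he : HasCovDeriv X x₀ S e D)
    (he' : HasCovDeriv X x₀ S e' D') {t : ℝ} (ht : t ∈ S) :
    HasDerivWithinAt (fun s ↦ inner ℝ (e s) (e' s))
      (inner ℝ (D t) (e' t) + inner ℝ (e t) (D' t)) S t := by
  have hg := isMetricOn_metric (E := E) x₀
  have hz := hc.mem_target ht
  have h1 := (hg.hasFDerivAt hz).comp_hasDerivWithinAt t (hc.hasDeriv t ht)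
  have h2 := (h1.clm_apply (he.hasDeriv t ht)).clm_apply (he'.hasDeriv t ht)
  refine (h2.congr (fun s hs ↦ (metric_coord (hc.source s hs) _ _).symm)
    (metric_coord (hc.source t ht) _ _).symm).congr_deriv ?_
  rw [← metric_coord (hc.source t ht), ← metric_coord (hc.source t ht)]
  simp only [add_apply, Function.comp_apply, map_sub, sub_apply, hg.fderiv_eq hz]
  ring

theorem smul (he : HasCovDeriv X x₀ S e D) {f f' : ℝ → ℝ}
    (hf : ∀ t ∈ S, HasDerivWithinAt f (f' t) S t) (hf' : ContinuousOn f' S) :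
    HasCovDeriv X x₀ S (fun t ↦ f t • e t) (fun t ↦ f' t • e t + f t • D t) where
  hasDeriv t ht := by
    have h := (hf t ht).smul (he.hasDeriv t ht)
    simp only [map_smul, map_add]
    refine h.congr_deriv ?_
    rw [smul_sub]
    abel
  continuousOn := by
    simp only [map_smul, map_add]
    have hfc : ContinuousOn f S := fun t ht ↦ (hf t ht).continuousWithinAt
    exact (hf'.smul he.continuousOn_coord).add (hfc.smul he.continuousOn)

theorem continuousOn_inner (hc : IsChartCurve γ X x₀ S) {e e' : Π t, TangentSpace 𝓘(ℝ, E) (γ t)}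
    (he : ContinuousOn (fun t ↦ coord x₀ (γ t) (e t)) S)
    (he' : ContinuousOn (fun t ↦ coord x₀ (γ t) (e' t)) S) :
    ContinuousOn (fun t ↦ inner ℝ (e t) (e' t)) S :=
  ((hc.continuousOn_metric.clm_apply he).clm_apply he').congr fun t ht ↦
    (metric_coord (hc.source t ht) _ _).symm

theorem continuousOn_deriv (hc : IsChartCurve γ X x₀ S)
    (hX : ContinuousOn (fun t ↦ coord x₀ (γ t) (X t)) S) (he : HasCovDeriv X x₀ S e D) :
    ContinuousOn (fun t ↦ coord x₀ (γ t) (D t) - christoffel (metric x₀) (chart E x₀ (γ t))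
      (coord x₀ (γ t) (X t)) (coord x₀ (γ t) (e t))) S :=
  he.continuousOn.sub ((hc.continuousOn_christoffel.clm_apply hX).clm_apply he.continuousOn_coord)

/-- The coordinate integrand is intrinsic, so integrals computed in different charts can be compared
with a single function on `[0, ℓ]`. -/
theorem indexForm_eq (hc : IsChartCurve γ X x₀ S) {t : ℝ} (ht : t ∈ S)
    (e D : Π t, TangentSpace 𝓘(ℝ, E) (γ t)) :
    indexForm (metric x₀) (chart E x₀ (γ t)) (coord x₀ (γ t) (X t)) (coord x₀ (γ t) (e t))
      (coord x₀ (γ t) (D t) - christoffel (metric x₀) (chart E x₀ (γ t)) (coord x₀ (γ t) (X t))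
        (coord x₀ (γ t) (e t))) =
      inner ℝ (D t) (D t) - inner ℝ (Rm (e t) (X t) (X t)) (e t) := by
  have hx := hc.source t ht
  rw [indexForm, sub_add_cancel, ← coord_Rm hx, metric_coord hx, metric_coord hx]

variable {J : Π x : M, TangentSpace 𝓘(ℝ, E) x →L[ℝ] TangentSpace 𝓘(ℝ, E) x}

/-- In `D(Je) = (∇_X J)e + J De` the last term vanishes because `e` is parallel. The case `e = X`
brings in `N(X)`. -/
theorem endomorphism (hJ : ContMDiff 𝓘(ℝ, E) (𝓘(ℝ, E).prod 𝓘(ℝ, E →L[ℝ] E)) ∞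
      (fun x ↦ TotalSpace.mk' (E →L[ℝ] E)
        (E := fun x : M ↦ TangentSpace 𝓘(ℝ, E) x →L[ℝ] TangentSpace 𝓘(ℝ, E) x) x (J x)))
    (hc : IsChartCurve γ X x₀ S) (hX : ContinuousOn (fun t ↦ coord x₀ (γ t) (X t)) S)
    (he : HasCovDeriv X x₀ S e fun _ ↦ 0) :
    HasCovDeriv X x₀ S (fun t ↦ J (γ t) (e t)) (fun t ↦ covDerivEnd J (X t) (e t)) := by
  have hec := he.continuousOn_coord
  have hR : ∀ t ∈ S, ContDiffAt ℝ ∞ (repEnd x₀ J) (chart E x₀ (γ t)) := fun t ht ↦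
    contDiffAt_repEnd hJ (hc.mem_target ht)
  constructor
  · intro t ht
    have h1 := ((hR t ht).differentiableAt (by simp)).hasFDerivAt.comp_hasDerivWithinAt t
      (hc.hasDeriv t ht)
    have h2 := h1.clm_apply (he.hasDeriv t ht)
    refine (h2.congr (fun s hs ↦ (repEnd_coord (hc.source s hs) _).symm)
      (repEnd_coord (hc.source t ht) _).symm).congr_deriv ?_
    rw [coord_covDerivEnd hJ (hc.source t ht), ← repEnd_coord (hc.source t ht), map_zero, zero_sub,
      map_neg]
    simp only [Function.comp_apply]
    abel
  · have hRc : ContinuousOn (fun t ↦ repEnd x₀ J (chart E x₀ (γ t))) S :=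
      hc.continuousOn_comp fun t ht ↦ (hR t ht).continuousAt
    have hDRc : ContinuousOn (fun t ↦ fderiv ℝ (repEnd x₀ J) (chart E x₀ (γ t))) S :=
      hc.continuousOn_comp fun t ht ↦ ((hR t ht).fderiv_right (m := 0) (by simp)).continuousAt
    have hΓ := hc.continuousOn_christoffel
    refine ContinuousOn.congr ?_ fun t ht ↦ coord_covDerivEnd hJ (hc.source t ht) _ _
    exact (((hDRc.clm_apply hX).clm_apply hec).add ((hΓ.clm_apply hX).clm_apply
      (hRc.clm_apply hec))).sub (hRc.clm_apply ((hΓ.clm_apply hX).clm_apply hec))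

end HasCovDeriv

end ChartCoordinates

/-! ### The length of a minimizing curve -/

namespace ChartCoordinates

open Set Filter Topology LocalMetric AlmostHermitian
open scoped NNReal

section

variable {E : Type*} [NormedAddCommGroup E] [NormedSpace ℝ E] [FiniteDimensional ℝ E]
  {M : Type*} [TopologicalSpace M] [ChartedSpace E M] [IsManifold 𝓘(ℝ, E) ∞ M]
  [RiemannianBundle (fun x : M ↦ TangentSpace 𝓘(ℝ, E) x)]
  [IsContMDiffRiemannianBundle 𝓘(ℝ, E) ∞ E (fun x : M ↦ TangentSpace 𝓘(ℝ, E) x)]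

theorem coord_injective {x₀ x : M} (hx : x ∈ (chart E x₀).source) :
    Function.Injective (coord (E := E) x₀ x) :=
  Function.LeftInverse.injective (g := frame x₀ x) (frame_coord hx)

/-- `Rm` is defined through extensions of its arguments, so linearity is read off from its tensorial
expression in a chart. -/
theorem Rm_add_left {x : M} (u u' v w : TangentSpace 𝓘(ℝ, E) x) :
    Rm (u + u') v w = Rm u v w + Rm u' v w := by
  have hx : x ∈ (chart E x).source := mem_extChartAt_source x
  refine coord_injective hx ?_
  rw [map_add, coord_Rm hx, coord_Rm hx, coord_Rm hx, map_add]
  simp only [curvature, map_add, add_apply]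
  abel

theorem Rm_smul_left {x : M} (c : ℝ) (u v w : TangentSpace 𝓘(ℝ, E) x) :
    Rm (c • u) v w = c • Rm u v w := by
  have hx : x ∈ (chart E x).source := mem_extChartAt_source x
  refine coord_injective hx ?_
  rw [map_smul, coord_Rm hx, coord_Rm hx, map_smul]
  simp only [curvature, map_smul, smul_apply, smul_sub, smul_add]

end

/-- Over the half period `[0, ℓ]` both `cos²` and `sin²` have mean one half. -/
theorem integral_cos_sq_sub_sin_sq {ℓ : ℝ} (hℓ : 0 < ℓ) (A B : ℝ) :
    ∫ t in (0 : ℝ)..ℓ, (A * Real.cos (Real.pi / ℓ * t) ^ 2 - B * Real.sin (Real.pi / ℓ * t) ^ 2) =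
      ℓ / 2 * (A - B) := by
  have hc : Real.pi / ℓ ≠ 0 := (div_pos Real.pi_pos hℓ).ne'
  have h1 := intervalIntegral.integral_comp_mul_left (a := 0) (b := ℓ)
    (fun y ↦ A * Real.cos y ^ 2 - B * Real.sin y ^ 2) hc
  rw [h1, mul_zero, div_mul_cancel₀ _ hℓ.ne', intervalIntegral.integral_sub,
    intervalIntegral.integral_const_mul, intervalIntegral.integral_const_mul, integral_cos_sq,
    integral_sin_sq]
  · simp
    field_simp
  · exact (by fun_prop : Continuous fun y ↦ A * Real.cos y ^ 2).intervalIntegrable _ _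
  · exact (by fun_prop : Continuous fun y ↦ B * Real.sin y ^ 2).intervalIntegrable _ _

variable {E : Type*} [NormedAddCommGroup E] [NormedSpace ℝ E] [FiniteDimensional ℝ E]
  {M : Type*} [MetricSpace M] [ChartedSpace E M] [IsManifold 𝓘(ℝ, E) ∞ M]
  [RiemannianBundle (fun x : M ↦ TangentSpace 𝓘(ℝ, E) x)]
  [IsContMDiffRiemannianBundle 𝓘(ℝ, E) ∞ E (fun x : M ↦ TangentSpace 𝓘(ℝ, E) x)]
  [IsRiemannianManifold 𝓘(ℝ, E) M] {γ : ℝ → M} {ℓ : ℝ}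

namespace IsMinimizingChain

variable {X : Π t, TangentSpace 𝓘(ℝ, E) (γ t)} {N : ℕ} {τ : ℕ → ℝ} {x : ℕ → M}

theorem isChartCurve (h : IsMinimizingChain γ ℓ X N τ x) {j : ℕ} (hj : j < N) :
    IsChartCurve γ X (x j) (Icc (τ j) (τ (j + 1))) :=
  ⟨fun _ ht ↦ h.source hj ht, fun _ ht ↦ (h.geodesic hj ht).1⟩

theorem hasCovDeriv_velocity (h : IsMinimizingChain γ ℓ X N τ x) {j : ℕ} (hj : j < N) :
    HasCovDeriv X (x j) (Icc (τ j) (τ (j + 1))) X fun _ ↦ 0 where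
  hasDeriv t ht := by
    rw [map_zero, zero_sub]
    exact (h.geodesic hj ht).2.1
  continuousOn := by
    simp only [map_zero]
    exact continuousOn_const

/-- Comparison of the index form of a family of unit fields with that of the sphere. -/
theorem sq_le_of_frame (h : IsMinimizingChain γ ℓ X N τ x) (hℓ : 0 < ℓ) {ι : Type*} [Fintype ι]
    {e D : ι → Π t, TangentSpace 𝓘(ℝ, E) (γ t)}
    (he : ∀ i, ∀ j < N, HasCovDeriv X (x j) (Icc (τ j) (τ (j + 1))) (e i) (D i))
    (hone : ∀ i, ∀ j < N, ∀ t ∈ Icc (τ j) (τ (j + 1)), inner ℝ (e i t) (e i t) = 1)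
    (hperp : ∀ i, ∀ j < N, ∀ t ∈ Icc (τ j) (τ (j + 1)), inner ℝ (X t) (e i t) = 0) {k : ℝ}
    (hk : ∀ j < N, ∀ t ∈ Icc (τ j) (τ (j + 1)), k ^ 2 + ∑ i, inner ℝ (D i t) (D i t) ≤
      ∑ i, inner ℝ (Rm (e i t) (X t) (X t)) (e i t)) :
    k ^ 2 ≤ Fintype.card ι * (Real.pi / ℓ) ^ 2 := by
  set c := Real.pi / ℓ with hc
  set f : ℝ → ℝ := fun t ↦ Real.sin (c * t) with hf
  set f' : ℝ → ℝ := fun t ↦ c * Real.cos (c * t) with hf'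
  have hfd : ∀ t, HasDerivAt f (f' t) t := fun t ↦ by
    have := ((hasDerivAt_id t).const_mul c).sin
    simpa [hf, hf', mul_comm] using this
  have hcov := fun i j hj ↦ (he i j hj).smul (f := f) (f' := f')
    (fun t _ ↦ (hfd t).hasDerivWithinAt) (by fun_prop)
  have hXc := fun j hj ↦ (h.hasCovDeriv_velocity (j := j) hj).continuousOn_coord
  set F : ι → ℕ → ℝ → ℝ := fun i j t ↦ indexForm (metric (x j)) (chart E (x j) (γ t))
    (coord (x j) (γ t) (X t)) (coord (x j) (γ t) (f t • e i t))
    (coord (x j) (γ t) (f' t • e i t + f t • D i t) - christoffel (metric (x j))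
      (chart E (x j) (γ t)) (coord (x j) (γ t) (X t)) (coord (x j) (γ t) (f t • e i t))) with hF
  have hFc : ∀ i, ∀ j < N, ContinuousOn (F i j) (Icc (τ j) (τ (j + 1))) := fun i j hj ↦
    (isMetricOn_metric (x j)).continuousOn_indexForm (fun t ht ↦ (h.isChartCurve hj).mem_target ht)
      (h.isChartCurve hj).continuousOn (hXc j hj) (hcov i j hj).continuousOn_coord
      ((hcov i j hj).continuousOn_deriv (h.isChartCurve hj) (hXc j hj))
  have hFi : ∀ i, ∀ j < N, IntervalIntegrable (F i j) MeasureTheory.volume (τ j) (τ (j + 1)) :=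
    fun i j hj ↦ (hFc i j hj).intervalIntegrable_of_Icc (h.lt_succ j).le
  have hpos : ∀ i, 0 ≤ ∑ j ∈ Finset.range N, ∫ t in τ j..τ (j + 1), F i j t := fun i ↦
    h.sum_indexForm_nonneg (W := fun t ↦ f t • e i t) (fun j hj t ht ↦ (hcov i j hj).hasDeriv t ht)
      (fun j hj ↦ (hcov i j hj).continuousOn_deriv (h.isChartCurve hj) (hXc j hj))
      (fun j hj t ht ↦ by rw [real_inner_smul_right, hperp i j hj t ht, mul_zero])
      (by simp [hf]) (by
        have : f ℓ = 0 := by simp only [hf, hc]; rw [div_mul_cancel₀ _ hℓ.ne', Real.sin_pi]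
        rw [this, zero_smul])
  -- The derivative of a constant squared length. It kills the mixed term of `|f' e + f De|²`.
  have heD : ∀ i, ∀ j < N, ∀ t ∈ Icc (τ j) (τ (j + 1)), inner ℝ (e i t) (D i t) = 0 := by
    intro i j hj t ht
    have h1 := (he i j hj).hasDerivWithinAt_inner (h.isChartCurve hj) (he i j hj) ht
    have h2 := (hasDerivWithinAt_const t (Icc (τ j) (τ (j + 1))) (1 : ℝ)).congr
      (fun s hs ↦ hone i j hj s hs) (hone i j hj t ht)
    have h3 := (uniqueDiffOn_Icc (h.lt_succ j) t ht).eq_deriv _ h1 h2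
    rw [real_inner_comm] at h3
    linarith
  set A : ℝ := Fintype.card ι * c ^ 2 with hA
  set B : ℝ → ℝ := fun t ↦ A * Real.cos (c * t) ^ 2 - k ^ 2 * Real.sin (c * t) ^ 2 with hB
  have hBc : Continuous B := by fun_prop
  have hFB : ∀ j < N, ∀ t ∈ Icc (τ j) (τ (j + 1)), ∑ i, F i j t ≤ B t := by
    intro j hj t ht
    have h1 : ∀ i, F i j t = f' t ^ 2 + f t ^ 2 * (inner ℝ (D i t) (D i t)
        - inner ℝ (Rm (e i t) (X t) (X t)) (e i t)) := by
      intro i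
      have h2 := HasCovDeriv.indexForm_eq (h.isChartCurve hj) ht (fun t ↦ f t • e i t)
        (fun t ↦ f' t • e i t + f t • D i t)
      refine h2.trans ?_
      have h3 : inner ℝ (D i t) (e i t) = 0 := by rw [real_inner_comm]; exact heD i j hj t ht
      simp only [Rm_smul_left, inner_add_left, inner_add_right, real_inner_smul_left,
        real_inner_smul_right, hone i j hj t ht, heD i j hj t ht, h3]
      ring
    simp only [h1, Finset.sum_add_distrib, Finset.sum_const, Finset.card_univ, nsmul_eq_mul,
      ← Finset.mul_sum, Finset.sum_sub_distrib]
    have h4 := hk j hj t ht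
    have h5 : f t ^ 2 * (∑ i, inner ℝ (D i t) (D i t)
        - ∑ i, inner ℝ (Rm (e i t) (X t) (X t)) (e i t)) ≤ f t ^ 2 * -k ^ 2 := by
      gcongr
      linarith
    have h6 : B t = Fintype.card ι * f' t ^ 2 - k ^ 2 * f t ^ 2 := by
      simp only [hB, hA, hf, hf']
      ring
    linarith
  -- The sum of the nonnegative indices is at most the integral of `B`, which equals `(ℓ/2)(A -
  -- k²)`.
  have hsum : 0 ≤ ∫ t in (0 : ℝ)..ℓ, B t :=
    calc 0 ≤ ∑ i, ∑ j ∈ Finset.range N, ∫ t in τ j..τ (j + 1), F i j t :=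
          Finset.sum_nonneg fun i _ ↦ hpos i
      _ = ∑ j ∈ Finset.range N, ∫ t in τ j..τ (j + 1), ∑ i, F i j t := by
          rw [Finset.sum_comm]
          refine Finset.sum_congr rfl fun j hj ↦ ?_
          rw [intervalIntegral.integral_finsetSum fun i _ ↦ hFi i j (Finset.mem_range.1 hj)]
      _ ≤ ∑ j ∈ Finset.range N, ∫ t in τ j..τ (j + 1), B t := by
          refine Finset.sum_le_sum fun j hj ↦ ?_
          have hj' := Finset.mem_range.1 hj
          refine intervalIntegral.integral_mono_on (h.lt_succ j).le ?_
            (hBc.intervalIntegrable _ _) (hFB j hj')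
          exact (continuousOn_finsetSum _ fun i _ ↦ hFc i j hj').intervalIntegrable_of_Icc
            (h.lt_succ j).le
      _ = ∫ t in τ 0..τ N, B t :=
          intervalIntegral.sum_integral_adjacent_intervals fun j _ ↦ hBc.intervalIntegrable _ _
      _ = ∫ t in (0 : ℝ)..ℓ, B t := by rw [h.zero, h.last]
  rw [hB, hc, integral_cos_sq_sub_sin_sq hℓ] at hsum
  have := nonneg_of_mul_nonneg_right hsum (by positivity)
  linarith

end IsMinimizingChain

end ChartCoordinates

/-! ### Traces of the curvature and almost Hermitian structures -/

namespace AlmostHermitian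

open ChartCoordinates

variable {E : Type*} [NormedAddCommGroup E] [NormedSpace ℝ E] [FiniteDimensional ℝ E]
  {M : Type*} [TopologicalSpace M] [ChartedSpace E M] [IsManifold 𝓘(ℝ, E) ∞ M]
  [RiemannianBundle (fun x : M ↦ TangentSpace 𝓘(ℝ, E) x)]
  [IsContMDiffRiemannianBundle 𝓘(ℝ, E) ∞ E (fun x : M ↦ TangentSpace 𝓘(ℝ, E) x)]

/-- The trace of the curvature on a subspace may be computed in any orthonormal basis. -/
theorem curvatureTraceOn_eq_sum {x : M} (W : Submodule ℝ (TangentSpace 𝓘(ℝ, E) x))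
    (u : TangentSpace 𝓘(ℝ, E) x) {ι : Type*} [Fintype ι] {e : ι → TangentSpace 𝓘(ℝ, E) x}
    (he : Orthonormal ℝ e) (hW : ∀ i, e i ∈ W) (hcard : Fintype.card ι = finrank ℝ W) :
    curvatureTraceOn W u = ∑ i, inner ℝ (Rm (e i) u u) (e i) := by
  have := finiteDimensional_tangentSpace (I := 𝓘(ℝ, E)) x
  let R : TangentSpace 𝓘(ℝ, E) x →ₗ[ℝ] TangentSpace 𝓘(ℝ, E) x :=
    { toFun := fun y ↦ Rm y u u
      map_add' := fun y y' ↦ Rm_add_left y y' u u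
      map_smul' := fun c y ↦ Rm_smul_left c y u u }
  -- The compression to `W` of `y ↦ Rm(y, u)u`. Both sums are its trace, and the trace does not
  -- depend on the basis.
  let A : W →ₗ[ℝ] W := (W.orthogonalProjectionOnto : TangentSpace 𝓘(ℝ, E) x →ₗ[ℝ] W) ∘ₗ R ∘ₗ W.subtype
  have hA : ∀ w : W, inner ℝ w (A w) =
      inner ℝ (Rm (w : TangentSpace 𝓘(ℝ, E) x) u u) (w : TangentSpace 𝓘(ℝ, E) x) := by
    intro w
    rw [real_inner_comm]
    exact W.inner_orthogonalProjectionOnto_eq_of_mem_right w _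
  let e' : ι → W := fun i ↦ ⟨e i, hW i⟩
  have he' : Orthonormal ℝ e' := ⟨fun i ↦ he.1 i, fun _ _ hij ↦ he.2 hij⟩
  let b : OrthonormalBasis ι ℝ W := OrthonormalBasis.mk he'
    (he'.linearIndependent.span_eq_top_of_card_eq_finrank' hcard).ge
  have h1 := A.trace_eq_sum_inner (stdOrthonormalBasis ℝ W)
  have h2 := A.trace_eq_sum_inner b
  rw [h1] at h2
  simp only [hA] at h2
  rw [curvatureTraceOn, h2]
  refine Finset.sum_congr rfl fun i _ ↦ ?_
  rw [OrthonormalBasis.coe_mk]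

variable {J : Π x : M, TangentSpace 𝓘(ℝ, E) x →L[ℝ] TangentSpace 𝓘(ℝ, E) x}
  {Ω : Π x : M, TangentSpace 𝓘(ℝ, E) x →L[ℝ] TangentSpace 𝓘(ℝ, E) x →L[ℝ] ℝ}

/-- `⟨X, JX⟩ = ⟨JX, JJX⟩ = -⟨JX, X⟩`. -/
theorem IsAlmostHermitian.inner_self_map (hJ : IsAlmostHermitian J Ω) {x : M}
    (X : TangentSpace 𝓘(ℝ, E) x) : inner ℝ X (J x X) = 0 := by
  have h1 := hJ.isometry x X (J x X)
  rw [hJ.sq_eq_neg, inner_neg_right, real_inner_comm] at h1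
  linarith

theorem IsAlmostHermitian.finrank_orthogonal (hJ : IsAlmostHermitian J Ω) {x : M}
    {X : TangentSpace 𝓘(ℝ, E) x} (hX : inner ℝ X X = 1) :
    finrank ℝ (Submodule.span ℝ {X, J x X})ᗮ + 2 = finrank ℝ E := by
  have := finiteDimensional_tangentSpace (I := 𝓘(ℝ, E)) x
  have ho : Orthonormal ℝ ![X, J x X] := by
    rw [orthonormal_iff_ite]
    intro i j
    fin_cases i <;> fin_cases j <;>
      simp [hX, hJ.isometry, hJ.inner_self_map, real_inner_comm, -inner_self_eq_norm_sq_to_K]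
  have h1 := finrank_span_eq_card ho.linearIndependent
  rw [Matrix.range_cons, Matrix.range_cons, Matrix.range_empty, Set.union_empty,
    Set.singleton_union, Fintype.card_fin] at h1
  have h2 := (Submodule.span ℝ {X, J x X}).finrank_add_finrank_orthogonal
  rw [h1] at h2
  have h3 : finrank ℝ (TangentSpace 𝓘(ℝ, E) x) = finrank ℝ E := rfl
  omega

end AlmostHermitian

/-! ### Fields adapted to `J` along a minimizing curve -/

namespace ChartCoordinates

open Set Filter Topology LocalMetric AlmostHermitian
open scoped NNReal

variable {E : Type*} [NormedAddCommGroup E] [NormedSpace ℝ E] [FiniteDimensional ℝ E]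
  {M : Type*} [MetricSpace M] [ChartedSpace E M] [IsManifold 𝓘(ℝ, E) ∞ M]
  [RiemannianBundle (fun x : M ↦ TangentSpace 𝓘(ℝ, E) x)]
  [IsContMDiffRiemannianBundle 𝓘(ℝ, E) ∞ E (fun x : M ↦ TangentSpace 𝓘(ℝ, E) x)]
  [IsRiemannianManifold 𝓘(ℝ, E) M] {γ : ℝ → M} {ℓ : ℝ}

namespace IsMinimizingChain

variable {X : Π t, TangentSpace 𝓘(ℝ, E) (γ t)} {N : ℕ} {τ : ℕ → ℝ} {x : ℕ → M}
  {J : Π x : M, TangentSpace 𝓘(ℝ, E) x →L[ℝ] TangentSpace 𝓘(ℝ, E) x}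
  {Ω : Π x : M, TangentSpace 𝓘(ℝ, E) x →L[ℝ] TangentSpace 𝓘(ℝ, E) x →L[ℝ] ℝ}

theorem norm_velocity (h : IsMinimizingChain γ ℓ X N τ x) {j : ℕ} (hj : j < N) {t : ℝ}
    (ht : t ∈ Icc (τ j) (τ (j + 1))) : ‖X t‖ = 1 := by
  have h1 := (h.geodesic hj ht).2.2
  rwa [real_inner_self_eq_norm_sq, pow_eq_one_iff_of_nonneg (norm_nonneg _) two_ne_zero] at h1

theorem hasCovDeriv_map_velocity (h : IsMinimizingChain γ ℓ X N τ x) (hJ : IsAlmostHermitian J Ω)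
    {j : ℕ} (hj : j < N) :
    HasCovDeriv X (x j) (Icc (τ j) (τ (j + 1))) (fun t ↦ J (γ t) (X t))
      (fun t ↦ covDerivEnd J (X t) (X t)) :=
  (h.hasCovDeriv_velocity hj).endomorphism hJ.smooth (h.isChartCurve hj)
    (h.hasCovDeriv_velocity hj).continuousOn_coord

/-- The derivative is known only within each interval of the partition; neighbouring intervals share
an end point, which carries the constant from one to the next. -/
theorem eq_of_hasDerivWithinAt_zero (h : IsMinimizingChain γ ℓ X N τ x) {f : ℝ → ℝ}
    (hf : ∀ j < N, ∀ t ∈ Icc (τ j) (τ (j + 1)), HasDerivWithinAt f 0 (Icc (τ j) (τ (j + 1))) t)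
    {j : ℕ} (hj : j < N) {t : ℝ} (ht : t ∈ Icc (τ j) (τ (j + 1))) : f t = f (τ 0) := by
  have key : ∀ j < N, ∀ t ∈ Icc (τ j) (τ (j + 1)), f t = f (τ j) := fun j hj ↦
    constant_of_has_deriv_right_zero (fun t ht ↦ (hf j hj t ht).continuousWithinAt) fun t ht ↦
      (hf j hj t (Ico_subset_Icc_self ht)).mono_of_mem_nhdsWithin (Icc_mem_nhdsGE_of_mem ht)
  rw [key j hj t ht]
  clear ht
  induction j with
  | zero => rfl
  | succ j ih =>
    rw [← ih (by omega)]
    exact key j (by omega) _ (right_mem_Icc.2 (h.lt_succ j).le)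

/-- In the chart the equation `De = -⟨e, n⟩ w` reads `y' = -g(y, n) w - Γ(X, y)`, which is linear in
`y` with continuous coefficients. -/
theorem exists_field_step (h : IsMinimizingChain γ ℓ X N τ x)
    {n w : Π t, TangentSpace 𝓘(ℝ, E) (γ t)} {j : ℕ} (hj : j < N)
    (hn : ContinuousOn (fun t ↦ coord (x j) (γ t) (n t)) (Icc (τ j) (τ (j + 1))))
    (hw : ContinuousOn (fun t ↦ coord (x j) (γ t) (w t)) (Icc (τ j) (τ (j + 1))))
    (e₀ : TangentSpace 𝓘(ℝ, E) (γ (τ j))) :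
    ∃ e : Π t, TangentSpace 𝓘(ℝ, E) (γ t), e (τ j) = e₀ ∧
      HasCovDeriv X (x j) (Icc (τ j) (τ (j + 1))) e fun t ↦ -inner ℝ (e t) (n t) • w t := by
  have : CompleteSpace E := FiniteDimensional.complete ℝ E
  have hc := h.isChartCurve hj
  have hXc := (h.hasCovDeriv_velocity hj).continuousOn_coord
  set A : ℝ → E →L[ℝ] E := fun t ↦
    -((metric (x j) (chart E (x j) (γ t))).flip (coord (x j) (γ t) (n t))).smulRight
      (coord (x j) (γ t) (w t))
    - christoffel (metric (x j)) (chart E (x j) (γ t)) (coord (x j) (γ t) (X t)) with hA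
  have hAc : ContinuousOn A (Icc (τ j) (τ (j + 1))) := by
    rw [continuousOn_clm_apply]
    intro y
    exact ((((hc.continuousOn_metric.clm_apply continuousOn_const).clm_apply hn).smul hw).neg).sub
      ((hc.continuousOn_christoffel.clm_apply hXc).clm_apply continuousOn_const)
  obtain ⟨y, hy0, hy⟩ := LinearODE.exists_solution (h.lt_succ j).le hAc (coord (x j) (γ (τ j)) e₀)
  have hcf : ∀ t ∈ Icc (τ j) (τ (j + 1)), coord (x j) (γ t) (frame (x j) (γ t) (y t)) = y t :=
    fun t ht ↦ coord_frame (hc.source t ht) _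
  have hyc : ContinuousOn y (Icc (τ j) (τ (j + 1))) := fun t ht ↦ (hy t ht).continuousWithinAt
  have hfc : ContinuousOn (fun t ↦ coord (x j) (γ t) (frame (x j) (γ t) (y t)))
      (Icc (τ j) (τ (j + 1))) := hyc.congr hcf
  refine ⟨fun t ↦ frame (x j) (γ t) (y t), ?_, ?_, ?_⟩
  · change frame (x j) (γ (τ j)) (y (τ j)) = e₀
    rw [hy0, frame_coord (hc.source _ (left_mem_Icc.2 (h.lt_succ j).le))]
  · intro t ht
    refine ((hy t ht).congr hcf (hcf t ht)).congr_deriv ?_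
    rw [map_smul, ← metric_coord (hc.source t ht), hcf t ht]
    simp only [hA, sub_apply, neg_apply, ContinuousLinearMap.smulRight_apply,
      ContinuousLinearMap.flip_apply, neg_smul]
  · simp only [map_smul]
    exact ((HasCovDeriv.continuousOn_inner hc hfc hn).neg).smul hw

/-- Solve on the intervals in turn, with the final value on one as the initial value on the next. No
differentiability across a partition point is asked for, so agreement of the values is enough. -/
theorem exists_field (h : IsMinimizingChain γ ℓ X N τ x)
    {n w : Π t, TangentSpace 𝓘(ℝ, E) (γ t)}
    (hn : ∀ j < N, ContinuousOn (fun t ↦ coord (x j) (γ t) (n t)) (Icc (τ j) (τ (j + 1))))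
    (hw : ∀ j < N, ContinuousOn (fun t ↦ coord (x j) (γ t) (w t)) (Icc (τ j) (τ (j + 1))))
    (e₀ : TangentSpace 𝓘(ℝ, E) (γ (τ 0))) :
    ∃ e : Π t, TangentSpace 𝓘(ℝ, E) (γ t), e (τ 0) = e₀ ∧ ∀ j < N,
      HasCovDeriv X (x j) (Icc (τ j) (τ (j + 1))) e fun t ↦ -inner ℝ (e t) (n t) • w t := by
  have key : ∀ k ≤ N, ∃ e : Π t, TangentSpace 𝓘(ℝ, E) (γ t), e (τ 0) = e₀ ∧ ∀ j < k,
      HasCovDeriv X (x j) (Icc (τ j) (τ (j + 1))) e fun t ↦ -inner ℝ (e t) (n t) • w t := by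
    intro k
    induction k with
    | zero =>
      intro _
      -- No interval has been treated yet, so only the value at `τ 0` matters.
      exact ⟨Function.update (fun _ ↦ 0) (τ 0) e₀, Function.update_self .., fun j hj ↦ by omega⟩
    | succ k ih =>
      intro hk
      obtain ⟨e, he0, he⟩ := ih (by omega)
      obtain ⟨f, hf0, hf⟩ := h.exists_field_step (j := k) hk (hn k hk) (hw k hk) (e (τ k))
      have congr : ∀ (j : ℕ) (e e' : Π t, TangentSpace 𝓘(ℝ, E) (γ t)),
          (∀ t ∈ Icc (τ j) (τ (j + 1)), e' t = e t) →
          HasCovDeriv X (x j) (Icc (τ j) (τ (j + 1))) e (fun t ↦ -inner ℝ (e t) (n t) • w t) →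
          HasCovDeriv X (x j) (Icc (τ j) (τ (j + 1))) e' (fun t ↦ -inner ℝ (e' t) (n t) • w t) := by
        intro j e e' hee h
        refine ⟨fun t ht ↦ ?_, h.continuousOn.congr fun t ht ↦ by simp only [hee t ht]⟩
        rw [hee t ht]
        exact (h.hasDeriv t ht).congr (fun s hs ↦ by simp only [hee s hs]) (by simp only [hee t ht])
      refine ⟨fun t ↦ if t ≤ τ k then e t else f t, ?_, fun j hj ↦ ?_⟩
      · simp only [h.strictMono.monotone (Nat.zero_le k), if_true]
        exact he0
      · rcases Nat.lt_succ_iff_lt_or_eq.1 hj with hjk | rfl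
        · refine congr j e _ (fun t ht ↦ if_pos ?_) (he j hjk)
          exact ht.2.trans (h.strictMono.monotone hjk)
        · refine congr j f _ (fun t ht ↦ ?_) hf
          rcases ht.1.eq_or_lt with rfl | hlt
          · simp only [le_refl, if_true, hf0]
          · exact if_neg hlt.not_ge
  exact key N le_rfl

/-- The frame consists of the single field `JX`, a unit field normal to `X` with covariant
derivative `N(X)`. -/
theorem sq_le_of_holomorphic_curvature (h : IsMinimizingChain γ ℓ X N τ x) (hℓ : 0 < ℓ)
    (hJ : IsAlmostHermitian J Ω) {k : ℝ}
    (hk : ∀ (x : M) (X : TangentSpace 𝓘(ℝ, E) x), ‖X‖ = 1 →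
      k ^ 2 ≤ inner ℝ (Rm (J x X) X X) (J x X) - ‖covDerivEnd J X X‖ ^ 2) :
    k ^ 2 ≤ (Real.pi / ℓ) ^ 2 := by
  have h1 := h.sq_le_of_frame hℓ (ι := Unit) (e := fun _ t ↦ J (γ t) (X t))
    (D := fun _ t ↦ covDerivEnd J (X t) (X t)) (fun _ j hj ↦ h.hasCovDeriv_map_velocity hJ hj)
    (fun _ j hj t ht ↦ by rw [hJ.isometry]; exact (h.geodesic hj ht).2.2)
    (fun _ j hj t ht ↦ hJ.inner_self_map _) (k := k) (fun j hj t ht ↦ by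
      have h3 := hk _ _ (h.norm_velocity hj ht)
      simp only [Finset.univ_unique, Finset.sum_const, Finset.card_singleton, one_smul,
        real_inner_self_eq_norm_sq]
      linarith)
  simpa using h1

/-- Write `n = N(X)` and `w = JX`. The fields solve `De = -⟨e, n⟩ w`, so they stay orthonormal and
orthogonal to `X` and `w`, and `∑ |Deᵢ|² = ∑ ⟨eᵢ, n⟩²`. Plain parallel transport would not preserve
orthogonality to `JX`. -/
theorem sq_le_of_curvatureTraceOn (h : IsMinimizingChain γ ℓ X N τ x) (hℓ : 0 < ℓ)
    (hJ : IsAlmostHermitian J Ω) {k : ℝ}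
    (hk : ∀ (x : M) (X : TangentSpace 𝓘(ℝ, E) x), ‖X‖ = 1 →
      k ^ 2 ≤ curvatureTraceOn (Submodule.span ℝ {X, J x X})ᗮ X - ‖covDerivEnd J X X‖ ^ 2) :
    k ^ 2 ≤ (finrank ℝ E - 2 : ℝ) * (Real.pi / ℓ) ^ 2 := by
  have hN : 0 < N := by
    rcases Nat.eq_zero_or_pos N with rfl | hN
    · exact absurd (h.zero.symm.trans h.last) hℓ.ne
    · exact hN
  have hX1 : ∀ j < N, ∀ t ∈ Icc (τ j) (τ (j + 1)), inner ℝ (X t) (X t) = 1 := fun j hj t ht ↦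
    (h.geodesic hj ht).2.2
  have h0 : inner ℝ (X (τ 0)) (X (τ 0)) = 1 := hX1 0 hN _ (left_mem_Icc.2 (h.lt_succ 0).le)
  have hfin := fun t ↦ finiteDimensional_tangentSpace (I := 𝓘(ℝ, E)) (γ t)
  have := hfin (τ 0)
  set W₀ := (Submodule.span ℝ {X (τ 0), J (γ (τ 0)) (X (τ 0))})ᗮ with hW₀
  set n : Π t, TangentSpace 𝓘(ℝ, E) (γ t) := fun t ↦ covDerivEnd J (X t) (X t) with hn
  set w : Π t, TangentSpace 𝓘(ℝ, E) (γ t) := fun t ↦ J (γ t) (X t) with hw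
  have hcw := fun j (hj : j < N) ↦ h.hasCovDeriv_map_velocity hJ hj
  set b := stdOrthonormalBasis ℝ W₀ with hb
  choose e he0 he using fun i ↦ h.exists_field (n := n) (w := w)
    (fun j hj ↦ (hcw j hj).continuousOn) (fun j hj ↦ (hcw j hj).continuousOn_coord)
    (b i : TangentSpace 𝓘(ℝ, E) (γ (τ 0)))
  have hww : ∀ j < N, ∀ t ∈ Icc (τ j) (τ (j + 1)), inner ℝ (w t) (w t) = 1 := fun j hj t ht ↦
    (hJ.isometry _ _ _).trans (hX1 j hj t ht)
  have hmem : ∀ i, inner ℝ (X (τ 0)) (e i (τ 0)) = 0 ∧ inner ℝ (w (τ 0)) (e i (τ 0)) = 0 := by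
    intro i
    rw [he0]
    have h1 := (Submodule.mem_orthogonal _ _).1 (b i).2
    exact ⟨h1 _ (Submodule.subset_span (by simp)), h1 _ (Submodule.subset_span (by simp [hw]))⟩
  -- The derivative of `⟨w, e⟩` is `⟨n, e⟩ - ⟨e, n⟩ |w|² = 0`; this is what the equation for `e` was
  -- chosen for.
  have hwe : ∀ i, ∀ j < N, ∀ t ∈ Icc (τ j) (τ (j + 1)), inner ℝ (w t) (e i t) = 0 := by
    intro i j hj t ht
    have h1 := h.eq_of_hasDerivWithinAt_zero (f := fun t ↦ inner ℝ (w t) (e i t))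
      (fun j hj t ht ↦ ((hcw j hj).hasDerivWithinAt_inner (h.isChartCurve hj) (he i j hj)
        ht).congr_deriv (by
          rw [real_inner_smul_right, hww j hj t ht, real_inner_comm]
          ring)) hj ht
    exact h1.trans (hmem i).2
  have hXe : ∀ i, ∀ j < N, ∀ t ∈ Icc (τ j) (τ (j + 1)), inner ℝ (X t) (e i t) = 0 := by
    intro i j hj t ht
    have h1 := h.eq_of_hasDerivWithinAt_zero (f := fun t ↦ inner ℝ (X t) (e i t))
      (fun j hj t ht ↦ ((h.hasCovDeriv_velocity hj).hasDerivWithinAt_inner (h.isChartCurve hj)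
        (he i j hj) ht).congr_deriv (by
          rw [real_inner_smul_right, hJ.inner_self_map, inner_zero_left]
          ring)) hj ht
    exact h1.trans (hmem i).1
  have hee : ∀ i i', ∀ j < N, ∀ t ∈ Icc (τ j) (τ (j + 1)),
      inner ℝ (e i t) (e i' t) = if i = i' then 1 else 0 := by
    intro i i' j hj t ht
    have h1 := h.eq_of_hasDerivWithinAt_zero (f := fun t ↦ inner ℝ (e i t) (e i' t))
      (fun j hj t ht ↦ ((he i j hj).hasDerivWithinAt_inner (h.isChartCurve hj)
        (he i' j hj) ht).congr_deriv (by
          rw [real_inner_smul_right, real_inner_smul_left, hwe i' j hj t ht,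
            real_inner_comm (w t) (e i t), hwe i j hj t ht]
          ring)) hj ht
    refine h1.trans ?_
    simp only [he0]
    exact orthonormal_iff_ite.1 b.orthonormal i i'
  have hfr : finrank ℝ W₀ + 2 = finrank ℝ E := hJ.finrank_orthogonal h0
  have hmain := h.sq_le_of_frame hℓ (k := k) he
    (fun i j hj t ht ↦ (hee i i j hj t ht).trans (if_pos rfl)) hXe (by
      intro j hj t ht
      have ho : Orthonormal ℝ fun i ↦ e i t := orthonormal_iff_ite.2 fun i i' ↦ hee i i' j hj t ht
      have h3 := hk _ _ (h.norm_velocity hj ht)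
      have hfr' := hJ.finrank_orthogonal (hX1 j hj t ht)
      rw [curvatureTraceOn_eq_sum _ _ ho (fun i ↦ by
        rw [Submodule.mem_orthogonal]
        intro u hu
        obtain ⟨a, b, rfl⟩ := Submodule.mem_span_pair.1 hu
        rw [inner_add_left, real_inner_smul_left, real_inner_smul_left, hXe i j hj t ht,
          hwe i j hj t ht]
        ring) (by
        rw [Fintype.card_fin]; exact Nat.add_right_cancel (hfr.trans hfr'.symm))] at h3
      -- Bessel's inequality bounds the total cost `∑ |Deᵢ|²` by `|N(X)|²`.
      have hB := ho.sum_inner_products_le (x := n t) (s := Finset.univ)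
      have h4 : ∀ i, inner ℝ (-inner ℝ (e i t) (n t) • w t) (-inner ℝ (e i t) (n t) • w t) =
          ‖inner ℝ (e i t) (n t)‖ ^ 2 := by
        intro i
        rw [real_inner_smul_left, real_inner_smul_right, hww j hj t ht, Real.norm_eq_abs, sq_abs]
        ring
      simp only [h4]
      linarith)
  rw [Fintype.card_fin] at hmain
  have hcast : (finrank ℝ W₀ : ℝ) = finrank ℝ E - 2 := by
    rw [← hfr]; push_cast; ring
  rwa [hcast] at hmain

end IsMinimizingChain

end ChartCoordinates

/-! ### The distance bounds -/

namespace AlmostHermitian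

open Set ChartCoordinates

variable {E : Type*} [NormedAddCommGroup E] [NormedSpace ℝ E] [FiniteDimensional ℝ E]
  {M : Type*} [MetricSpace M] [ChartedSpace E M] [IsManifold 𝓘(ℝ, E) ∞ M]
  [RiemannianBundle (fun x : M ↦ TangentSpace 𝓘(ℝ, E) x)]
  [IsContMDiffRiemannianBundle 𝓘(ℝ, E) ∞ E (fun x : M ↦ TangentSpace 𝓘(ℝ, E) x)]
  [IsRiemannianManifold 𝓘(ℝ, E) M] [CompleteSpace M]
  {J : Π x : M, TangentSpace 𝓘(ℝ, E) x →L[ℝ] TangentSpace 𝓘(ℝ, E) x}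
  {Ω : Π x : M, TangentSpace 𝓘(ℝ, E) x →L[ℝ] TangentSpace 𝓘(ℝ, E) x →L[ℝ] ℝ}

theorem dist_le_of_holomorphic_curvature (hJ : IsAlmostHermitian J Ω) {k : ℝ} (hk0 : 0 < k)
    (hk : ∀ (x : M) (X : TangentSpace 𝓘(ℝ, E) x), ‖X‖ = 1 →
      k ^ 2 ≤ inner ℝ (Rm (J x X) X X) (J x X) - ‖covDerivEnd J X X‖ ^ 2) (p q : M) :
    dist p q ≤ Real.pi / k := by
  obtain ⟨γ, -, -, hγ⟩ := exists_minimizing E p q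
  rcases (dist_nonneg (x := p) (y := q)).eq_or_lt with h0 | h0
  · rw [← h0]
    positivity
  obtain ⟨X, N, τ, x, hc⟩ := exists_isMinimizingChain E h0 hγ
  have h1 := le_of_sq_le_sq (hc.sq_le_of_holomorphic_curvature h0 hJ hk) (by positivity)
  rwa [le_div_comm₀ hk0 h0] at h1

theorem dist_le_of_curvatureTraceOn (hJ : IsAlmostHermitian J Ω) {k : ℝ} (hk0 : 0 < k)
    (hk : ∀ (x : M) (X : TangentSpace 𝓘(ℝ, E) x), ‖X‖ = 1 →
      k ^ 2 ≤ curvatureTraceOn (Submodule.span ℝ {X, J x X})ᗮ X - ‖covDerivEnd J X X‖ ^ 2)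
    (p q : M) : dist p q ≤ Real.sqrt (finrank ℝ E - 2) * Real.pi / k := by
  obtain ⟨γ, -, -, hγ⟩ := exists_minimizing E p q
  rcases (dist_nonneg (x := p) (y := q)).eq_or_lt with h0 | h0
  · rw [← h0]
    positivity
  obtain ⟨X, N, τ, x, hc⟩ := exists_isMinimizingChain E h0 hγ
  have h1 := hc.sq_le_of_curvatureTraceOn h0 hJ hk
  have h2 : (0 : ℝ) < (Real.pi / dist p q) ^ 2 := by positivity
  -- Nonnegativity is extracted from the inequality itself: `k² > 0` is at most this number times a
  -- positive one.
  have h3 : (0 : ℝ) ≤ finrank ℝ E - 2 :=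
    (pos_of_mul_pos_left ((pow_pos hk0 2).trans_le h1) h2.le).le
  have h4 : k ≤ Real.sqrt (finrank ℝ E - 2) * Real.pi / dist p q := by
    refine le_of_sq_le_sq ?_ (by positivity)
    rwa [mul_div_assoc, mul_pow, Real.sq_sqrt h3]
  rwa [le_div_comm₀ hk0 h0] at h4

end AlmostHermitian

/-- The points at finite distance from `p` form a clopen set, since balls of radius one never leave
it or its complement. -/
theorem edist_ne_top_of_connected {M : Type*} [EMetricSpace M] [ConnectedSpace M] (p q : M) :
    edist p q ≠ ⊤ := by
  have h : IsClopen {y : M | edist y p < ⊤} := by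
    refine ⟨⟨?_⟩, ?_⟩
    · rw [EMetric.isOpen_iff]
      refine fun y hy ↦ ⟨1, one_pos, fun z hz hz' ↦ hy ?_⟩
      refine (edist_triangle y z p).trans_lt (ENNReal.add_lt_top.2 ⟨?_, hz'⟩)
      rw [edist_comm]
      exact (show edist z y < 1 from hz).trans ENNReal.one_lt_top
    · rw [EMetric.isOpen_iff]
      refine fun y hy ↦ ⟨1, one_pos, fun z hz ↦ ?_⟩
      exact (edist_triangle z y p).trans_lt (ENNReal.add_lt_top.2
        ⟨(show edist z y < 1 from hz).trans ENNReal.one_lt_top, hy⟩)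
  have h1 := h.eq_univ ⟨p, by simp⟩
  have h2 : q ∈ {y : M | edist y p < ⊤} := by rw [h1]; trivial
  rw [edist_comm]
  exact h2.ne

end

theorem theorem4p2 (n : ℕ)
    {M : Type*} [EMetricSpace M] [ChartedSpace (EuclideanSpace ℝ (Fin (2 * n))) M]
    [IsManifold (𝓡 (2 * n)) ∞ M]
    [RiemannianBundle (fun x : M ↦ TangentSpace (𝓡 (2 * n)) x)]
    [IsContMDiffRiemannianBundle (𝓡 (2 * n)) ∞ (EuclideanSpace ℝ (Fin (2 * n)))
      (fun x : M ↦ TangentSpace (𝓡 (2 * n)) x)]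
    [IsRiemannianManifold (𝓡 (2 * n)) M]
    [ConnectedSpace M] [CompleteSpace M]
    (J : Π x : M, TangentSpace (𝓡 (2 * n)) x →L[ℝ] TangentSpace (𝓡 (2 * n)) x)
    (Ω : Π x : M, TangentSpace (𝓡 (2 * n)) x →L[ℝ] TangentSpace (𝓡 (2 * n)) x →L[ℝ] ℝ)
    (hJ : AlmostHermitian.IsAlmostHermitian J Ω) :
    (∀ k₁ : ℝ, 0 < k₁ →
      (∀ (x : M) (X : TangentSpace (𝓡 (2 * n)) x), ‖X‖ = 1 →
        k₁ ^ 2 ≤ inner ℝ (AlmostHermitian.Rm (J x X) X X) (J x X) - ‖AlmostHermitian.covDerivEnd J X X‖ ^ 2) →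
      Metric.ediam (Set.univ : Set M) ≤ ENNReal.ofReal (Real.pi / k₁)) ∧
    (∀ k₂ : ℝ, 0 < k₂ →
      (∀ (x : M) (X : TangentSpace (𝓡 (2 * n)) x), ‖X‖ = 1 →
        k₂ ^ 2 ≤ AlmostHermitian.curvatureTraceOn (Submodule.span ℝ {X, J x X})ᗮ X - ‖AlmostHermitian.covDerivEnd J X X‖ ^ 2) →
      Metric.ediam (Set.univ : Set M) ≤
        ENNReal.ofReal (Real.sqrt (2 * n - 2) * Real.pi / k₂)) := by
  -- Connectedness makes the distance real valued; the extended distance is kept, so the Riemannian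
  -- structure still refers to it.
  let m : MetricSpace M := EMetricSpace.toMetricSpace edist_ne_top_of_connected
  constructor
  · intro k hk0 hk
    refine Metric.ediam_le fun p _ q _ ↦ ?_
    rw [edist_dist]
    exact ENNReal.ofReal_le_ofReal (AlmostHermitian.dist_le_of_holomorphic_curvature
      (E := EuclideanSpace ℝ (Fin (2 * n))) hJ hk0 hk p q)
  · intro k hk0 hk
    refine Metric.ediam_le fun p _ q _ ↦ ?_
    rw [edist_dist]
    have h := AlmostHermitian.dist_le_of_curvatureTraceOn
      (E := EuclideanSpace ℝ (Fin (2 * n))) hJ hk0 hk p q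
    rw [finrank_euclideanSpace_fin, Nat.cast_mul, Nat.cast_ofNat] at h
    exact ENNReal.ofReal_le_ofReal h
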